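/- Let $0<\alpha\le 2$, let $(Y_x)_{x\in\mathbb{Z}}$ be i.i.d. real random variables with a symmetric $\alpha$-stable law, i.e. with characteristic function $\mathbb{E}e^{itY_x}=e^{-c|t|^\alpha}$ for all $t\in\mathbb{R}$, for some $c>0$, and let $$\Pi=\{x+Y_x:x\in\mathbb{Z}\},\qquad \Pi_0=\{x+Y_x:x\in\mathbb{Z}\setminus\{0\}\}$$ be the perturbed lattice and the perturbed lattice with the point of index $0$ removed. Laws of point processes are taken on the $\sigma$-algebra generated by the numbers of points in Borel sets; absolute continuity and singularity of point processes refer to their laws. A $\Pi$-point is a real random variable $Z$ with $Z\in\Pi$ almost surely. The process $\Pi$ is called * deletion tolerant if, for every $\Pi$-point $Z$, $\Pi\setminus\{Z\}$ is absolutely continuous with respect to $\Pi$; * deletion singular if, for every $\Pi$-point $Z$, $\Pi\setminus\{Z\}$ and $\Pi$ are mutually singular; * insertion tolerant if, for every Borel set $V\subset\mathbb{R}$ with Lebesgue measure in $(0,\infty)$ and $U$ uniform in $V$ and independent of $\Pi$, $\Pi\cup\{U\}$ is absolutely continuous with respect to $\Pi$; * rigid if, for every ball $B\subset\mathbb{R}$,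 there is a measurable function $N_B$ of point configurations such that $N_B(\Pi\setminus B)=|\Pi\cap B|<\infty$ almost surely. Then: 1. If $\alpha<1$, then $\Pi$ is deletion tolerant and insertion tolerant, and $\Pi$ and $\Pi_0$ are mutually absolutely continuous. 2. If $\alpha\ge 1$, then $\Pi$ is deletion singular and rigid. -/

import Mathlib

open MeasureTheory ProbabilityTheory
open scoped ENNReal

/-- A set of points of the real line, seen as a realisation of a point process. (The point processes
considered below are almost surely locally finite.) -/
@[ext]
structure PointSet where
  /-- the points of the set -/
  points : Set ℝ

namespace PointSet

/-- The number of points in `B`. -/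
noncomputable def count (S : PointSet) (B : Set ℝ) : ℕ∞ := (S.points ∩ B).encard

/-- The usual σ-algebra on point configurations: the smallest one for which the number of points in
`B` is measurable, for every Borel set `B`. -/
noncomputable instance instMeasurableSpace : MeasurableSpace PointSet :=
  ⨆ (B : Set ℝ) (_ : MeasurableSet B), MeasurableSpace.comap (fun S => S.count B) inferInstance

/-- The point set with the point `z` removed. -/
def delete (S : PointSet) (z : ℝ) : PointSet := ⟨S.points \ {z}⟩

/-- The point set with the point `z` added. -/
def add (S : PointSet) (z : ℝ) : PointSet := ⟨insert z S.points⟩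

/-- The points of the set that lie in `B`. -/
def inter (S : PointSet) (B : Set ℝ) : PointSet := ⟨S.points ∩ B⟩

end PointSet

/-- A measure `μ` on the line is a (nondegenerate) symmetric `α`-stable law, `0 < α ≤ 2`, if its
characteristic function is `t ↦ exp (-c |t| ^ α)` for some scale `c > 0`. -/
def IsSymmetricStable (α : ℝ) (μ : Measure ℝ) : Prop :=
  0 < α ∧ α ≤ 2 ∧ ∃ c : ℝ, 0 < c ∧ ∀ t : ℝ, charFun μ t = ((Real.exp (-(c * |t| ^ α)) : ℝ) : ℂ)

section PointProcess

variable {Ω : Type*}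

/-- The process `Π_S = {x + Y x : x ∈ ℤ \ S}`. -/
def perturbedLatticeOff (S : Set ℤ) (Y : ℤ → Ω → ℝ) (ω : Ω) : PointSet :=
  ⟨{z | ∃ x : ℤ, x ∉ S ∧ z = x + Y x ω}⟩

/-- The perturbed lattice `Π = {x + Y x : x ∈ ℤ}`. -/
def perturbedLattice (Y : ℤ → Ω → ℝ) (ω : Ω) : PointSet :=
  ⟨{z | ∃ x : ℤ, z = x + Y x ω}⟩

variable [MeasurableSpace Ω]

/-- `Z` is an `X`-point: a real random variable with `Z ∈ X` almost surely. -/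
def IsPointOf (P : Measure Ω) (X : Ω → PointSet) (Z : Ω → ℝ) : Prop :=
  Measurable Z ∧ ∀ᵐ ω ∂P, Z ω ∈ (X ω).points

/-- For every `X`-point `Z`, the law of `X \ Z` is absolutely continuous with respect to the law
of `X`. -/
def DeletionTolerant (P : Measure Ω) (X : Ω → PointSet) : Prop :=
  ∀ Z : Ω → ℝ, IsPointOf P X Z → P.map (fun ω => (X ω).delete (Z ω)) ≪ P.map X

/-- For every `X`-point `Z`, the laws of `X \ Z` and of `X` are mutually singular. -/
def DeletionSingular (P : Measure Ω) (X : Ω → PointSet) : Prop :=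
  ∀ Z : Ω → ℝ, IsPointOf P X Z → P.map (fun ω => (X ω).delete (Z ω)) ⟂ₘ P.map X

/-- For every Borel set `V` with `0 < |V| < ∞`, if `U` is uniform in `V` and independent of `X`
(realised as the second coordinate of `Ω × ℝ` under the product measure; `cond volume V` is the
uniform law on `V`), the law of `X ∪ U` is absolutely continuous with respect to the law of `X`. -/
def InsertionTolerant (P : Measure Ω) (X : Ω → PointSet) : Prop :=
  ∀ V : Set ℝ, MeasurableSet V → 0 < volume V → volume V < ∞ →
    (P.prod (cond volume V)).map (fun p : Ω × ℝ => (X p.1).add p.2) ≪ P.map X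

/-- For every ball `B` (open or closed), the number of points in `B` is almost surely finite and
equal to a measurable function of the set of points outside `B`. -/
def Rigid (P : Measure Ω) (X : Ω → PointSet) : Prop :=
  ∀ (c r : ℝ), 0 < r → ∀ B : Set ℝ, B = Metric.ball c r ∨ B = Metric.closedBall c r →
    ∃ N : PointSet → ℕ, Measurable N ∧ ∀ᵐ ω ∂P, (N ((X ω).inter Bᶜ) : ℕ∞) = (X ω).count B

/-! Measurability of the maps whose image measures are used above. -/

theorem PointSet.measurable_of_countable {ι : Type*} [Countable ι] {X : Ω → PointSet}
    (f : ι → Ω → ℝ) (hf : ∀ i, Measurable (f i)) (A : ι → Set Ω) (hA : ∀ i, MeasurableSet (A i))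
    (hX : ∀ ω, (X ω).points = {z | ∃ i, ω ∈ A i ∧ z = f i ω}) : Measurable X := by
  classical
  have key : ∀ B : Set ℝ, MeasurableSet B → ∀ k : ℕ,
      MeasurableSet {ω | (k : ℕ∞) ≤ (X ω).count B} := by
    intro B hB k
    have h : {ω | (k : ℕ∞) ≤ (X ω).count B} = ⋃ (t : Finset ι) (_ : t.card = k),
        {ω | (∀ i ∈ t, ω ∈ A i ∧ f i ω ∈ B) ∧ ∀ i ∈ t, ∀ j ∈ t, i ≠ j → f i ω ≠ f j ω} := by
      ext ω
      simp only [Set.mem_ofPred_eq, Set.mem_iUnion, exists_prop]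
      constructor
      · intro hk
        obtain ⟨T, hT, hTk⟩ := Set.exists_subset_encard_eq hk
        have hfin : T.Finite := Set.finite_of_encard_eq_coe hTk
        have hmem : ∀ z ∈ T, ∃ i, (ω ∈ A i ∧ f i ω ∈ B) ∧ f i ω = z := by
          intro z hz
          have h1 := (hT hz).1
          rw [hX] at h1
          obtain ⟨i, hi, rfl⟩ := h1
          exact ⟨i, ⟨hi, (hT hz).2⟩, rfl⟩
        choose g hg using hmem
        have hinj : Function.Injective (fun z : T => g z z.2) := fun a b hab => by
          have hab' : g a a.2 = g b b.2 := hab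
          exact Subtype.ext (by rw [← (hg a a.2).2, ← (hg b b.2).2, hab'])
        have : Fintype T := hfin.fintype
        refine ⟨Finset.univ.image (fun z : T => g z z.2), ?_, ?_, ?_⟩
        · rw [Finset.card_image_of_injective _ hinj, Finset.card_univ, ← Set.toFinset_card]
          rw [Set.encard_eq_coe_toFinset_card] at hTk
          exact_mod_cast hTk
        · intro i hi
          simp only [Finset.mem_image, Finset.mem_univ, true_and] at hi
          obtain ⟨z, rfl⟩ := hi
          exact (hg z z.2).1
        · intro i hi j hj hij
          simp only [Finset.mem_image, Finset.mem_univ, true_and] at hi hj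
          obtain ⟨z, rfl⟩ := hi
          obtain ⟨w, rfl⟩ := hj
          rw [(hg z z.2).2, (hg w w.2).2]
          exact fun h => hij (by rw [Subtype.ext h])
      · rintro ⟨t, rfl, h1, h2⟩
        have hinj : Set.InjOn (fun i => f i ω) t := fun a ha b hb hab => by
          by_contra hne
          exact h2 a ha b hb hne hab
        have hsub : (fun i => f i ω) '' t ⊆ (X ω).points ∩ B := by
          rintro _ ⟨i, hi, rfl⟩
          refine ⟨?_, (h1 i hi).2⟩
          rw [hX]
          exact ⟨i, (h1 i hi).1, rfl⟩
        calc (t.card : ℕ∞) = ((fun i => f i ω) '' (t : Set ι)).encard := by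
              rw [hinj.encard_image, Set.encard_coe_eq_coe_finsetCard]
          _ ≤ _ := Set.encard_le_encard hsub
    rw [h]
    refine MeasurableSet.iUnion fun t => MeasurableSet.iUnion fun _ => ?_
    have h1 : {ω | (∀ i ∈ t, ω ∈ A i ∧ f i ω ∈ B) ∧ ∀ i ∈ t, ∀ j ∈ t, i ≠ j → f i ω ≠ f j ω}
        = (⋂ i ∈ t, (A i ∩ f i ⁻¹' B)) ∩ ⋂ i ∈ t, ⋂ j ∈ t, {ω | i ≠ j → f i ω ≠ f j ω} := by
      ext; simp
    rw [h1]
    refine MeasurableSet.inter ?_ ?_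
    · exact t.measurableSet_biInter fun i _ => (hA i).inter (hf i hB)
    · refine t.measurableSet_biInter fun i _ => t.measurableSet_biInter fun j _ => ?_
      by_cases hij : i = j
      · simp [hij]
      · have h2 : {ω | i ≠ j → f i ω ≠ f j ω} = {ω | f i ω = f j ω}ᶜ := by
          ext; simp [hij]
        rw [h2]
        exact (measurableSet_eq_fun (hf i) (hf j)).compl
  rw [measurable_iff_comap_le, PointSet.instMeasurableSpace]
  simp only [MeasurableSpace.comap_iSup, MeasurableSpace.comap_comp, iSup_le_iff]
  intro B hB
  rw [← measurable_iff_comap_le]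
  refine measurable_to_countable' fun n => ?_
  induction n using ENat.recTopCoe with
  | top =>
    have : ((fun S : PointSet => S.count B) ∘ X) ⁻¹' {⊤}
        = ⋂ k : ℕ, {ω | (k : ℕ∞) ≤ (X ω).count B} := by
      ext ω
      simp only [Set.mem_preimage, Function.comp_apply, Set.mem_singleton_iff, Set.mem_iInter,
        Set.mem_ofPred_eq]
      exact ⟨fun h k => by simp [h], fun h => ENat.eq_top_iff_forall_ge.2 h⟩
    rw [this]
    exact MeasurableSet.iInter fun k => key B hB k
  | coe k =>
    have : ((fun S : PointSet => S.count B) ∘ X) ⁻¹' {(k : ℕ∞)}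
        = {ω | (k : ℕ∞) ≤ (X ω).count B} \ {ω | ((k + 1 : ℕ) : ℕ∞) ≤ (X ω).count B} := by
      ext ω
      simp only [Set.mem_preimage, Function.comp_apply, Set.mem_singleton_iff, Set.mem_sdiff,
        Set.mem_ofPred_eq]
      generalize (X ω).count B = m
      induction m using ENat.recTopCoe with
      | top => simp
      | coe m => norm_cast; omega
    rw [this]
    exact (key B hB k).diff (key B hB (k + 1))

theorem measurable_perturbedLatticeOff (S : Set ℤ) {Y : ℤ → Ω → ℝ} (hY : ∀ x, Measurable (Y x)) :
    Measurable (perturbedLatticeOff S Y) := by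
  classical
  refine PointSet.measurable_of_countable (fun (x : ℤ) ω => (x : ℝ) + Y x ω)
    (fun x => (hY x).const_add _) (fun x => {_ω | x ∉ S}) (fun x => MeasurableSet.const _) ?_
  intro ω
  rfl

theorem measurable_perturbedLattice {Y : ℤ → Ω → ℝ} (hY : ∀ x, Measurable (Y x)) :
    Measurable (perturbedLattice Y) := by
  refine PointSet.measurable_of_countable (fun (x : ℤ) ω => (x : ℝ) + Y x ω)
    (fun x => (hY x).const_add _) (fun _ => Set.univ) (fun _ => MeasurableSet.univ) ?_
  intro ω
  simp [perturbedLattice]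

theorem measurable_perturbedLattice_delete {Y : ℤ → Ω → ℝ} (hY : ∀ x, Measurable (Y x))
    {Z : Ω → ℝ} (hZ : Measurable Z) :
    Measurable (fun ω => (perturbedLattice Y ω).delete (Z ω)) := by
  refine PointSet.measurable_of_countable (fun (x : ℤ) ω => (x : ℝ) + Y x ω)
    (fun x => (hY x).const_add _) (fun x => {ω | (x : ℝ) + Y x ω = Z ω}ᶜ)
    (fun x => (measurableSet_eq_fun ((hY x).const_add _) hZ).compl) ?_
  intro ω
  ext z
  simp only [perturbedLattice, PointSet.delete, Set.mem_sdiff, Set.mem_ofPred_eq,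
    Set.mem_singleton_iff, Set.mem_compl_iff]
  constructor
  · rintro ⟨⟨x, rfl⟩, h⟩
    exact ⟨x, h, rfl⟩
  · rintro ⟨x, h, rfl⟩
    exact ⟨⟨x, rfl⟩, h⟩

theorem measurable_perturbedLattice_add {Y : ℤ → Ω → ℝ} (hY : ∀ x, Measurable (Y x)) :
    Measurable (fun p : Ω × ℝ => (perturbedLattice Y p.1).add p.2) := by
  refine PointSet.measurable_of_countable
    (fun (o : Option ℤ) (p : Ω × ℝ) => o.elim p.2 fun x => (x : ℝ) + Y x p.1)
    ?_ (fun _ => Set.univ) (fun _ => MeasurableSet.univ) ?_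
  · rintro (_ | x)
    · exact measurable_snd
    · exact ((hY x).comp measurable_fst).const_add _
  · intro p
    ext z
    simp [perturbedLattice, PointSet.add, Option.exists]

end PointProcess

/-! ### Measurability on configurations and the window σ-algebras. -/

namespace PointSet

open Set Filter Topology

/-! Case `α < 1`: a hole in the lattice cannot be located. Place the hole uniformly in `{0, …, 2^k -
1}`. A fixed window contains finitely many points in expectation, so as `k` grows the hole becomes
invisible there and the laws converge to that of `Π` on events of a window. Convergence on all
events follows once consecutive laws are summably close in total variation
(`tendsto_measureReal_of_summable`).

For this, put `M = 2^(k+1)`. The stable density is at least of order `M^(-1-α)` on `[-M, M]`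
(`exists_smul_restrict_le_stable`): by Pólya's criterion the law is a scale mixture of Fejér laws,
the characteristic function being convex on `(0, ∞)`. Hence every point with index in `[0, M)` has a
component of weight `p` of order `M^(-α)` that is uniform on `[0, M]`. About `pM`, of order
`M^(1-α)`, points are then interchangeable, and a second moment argument (`abs_sum_biased_mean_le`)
shows that spreading the hole from half of the indices to all of them changes the law by
`O((pM)^(-1/2))`, which is geometrically small in `k`.

From the limit, `Π₀ ≪ Π`: saturate a null event under integer translations; the saturated event has
the same probability for every hole, and the limit of the averages is `0`. Conversely `Π ≪ Π₀`,
since a null event for one hole is null for all holes. Deletion tolerance follows because a deleted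
point has one of countably many indices, insertion tolerance because `Π₀` with an independent point
of equivalent law is `Π`.

Case `α ≥ 1`: smooth linear statistics determine the number of points. The tail bound `P(|Y| > r) ≤
C/r` makes the variance of `∑ tent((x + Y x)/L)` bounded in `L`. Averaging over many widely
separated scales makes the statistics nearly uncorrelated, so there are bumps `h n → 1` whose
statistics have summable variance (`exists_bump_energy_le`). Almost surely these statistics minus
their means tend to `0`. Deleting a point shifts the limit by `-1`, which separates the two laws;
comparing the statistic of the points outside `B` with the mean recovers the number of points in
`B`. -/

theorem measurable_count {B : Set ℝ} (hB : MeasurableSet B) :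
    Measurable fun S : PointSet => S.count B := by
  rw [measurable_iff_comap_le]
  exact le_iSup₂ (f := fun (B : Set ℝ) (_ : MeasurableSet B) =>
    MeasurableSpace.comap (fun S : PointSet => S.count B) inferInstance) B hB

theorem measurable_of_count {β : Type*} [MeasurableSpace β] {f : β → PointSet}
    (hf : ∀ B, MeasurableSet B → Measurable fun b => (f b).count B) : Measurable f := by
  rw [measurable_iff_comap_le, instMeasurableSpace]
  simp only [MeasurableSpace.comap_iSup, MeasurableSpace.comap_comp, iSup_le_iff]
  intro B hB
  exact measurable_iff_comap_le.1 (hf B hB)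

theorem measurable_inter {B : Set ℝ} (hB : MeasurableSet B) :
    Measurable fun S : PointSet => S.inter B := by
  refine measurable_of_count fun C hC => ?_
  have : (fun S : PointSet => (S.inter B).count C) = fun S => S.count (B ∩ C) := by
    ext S; simp [count, inter, Set.inter_assoc]
  rw [this]
  exact measurable_count (hB.inter hC)

/-- The sum of `h` over the points of the set. -/
noncomputable def sum (h : ℝ → ℝ≥0∞) (S : PointSet) : ℝ≥0∞ := ∑' z : S.points, h z

/-- The counting measure of the point set. -/
noncomputable def toMeasure (S : PointSet) : Measure ℝ :=
  Measure.sum fun z : S.points => Measure.dirac (z : ℝ)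

theorem toMeasure_apply (S : PointSet) {B : Set ℝ} (hB : MeasurableSet B) :
    S.toMeasure B = (S.count B : ℝ≥0∞) := by
  rw [toMeasure, Measure.sum_apply _ hB]
  simp only [Measure.dirac_apply' _ hB, count]
  rw [tsum_subtype S.points (fun z => B.indicator (1 : ℝ → ℝ≥0∞) z)]
  have : (fun z => S.points.indicator (fun z => B.indicator (1 : ℝ → ℝ≥0∞) z) z)
      = (S.points ∩ B).indicator fun _ => (1 : ℝ≥0∞) := by
    ext z
    by_cases h1 : z ∈ S.points <;> by_cases h2 : z ∈ B <;> simp [h1, h2]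
  rw [this, ← tsum_subtype (S.points ∩ B) fun _ => (1 : ℝ≥0∞), ENNReal.tsum_one]
  rfl

theorem measurable_toMeasure : Measurable toMeasure := by
  refine Measure.measurable_of_measurable_coe _ fun B hB => ?_
  simp only [toMeasure_apply _ hB]
  exact (measurable_from_top (f := fun n : ℕ∞ => (n : ℝ≥0∞))).comp (measurable_count hB)

theorem sum_eq_lintegral {h : ℝ → ℝ≥0∞} (hh : Measurable h) (S : PointSet) :
    S.sum h = ∫⁻ z, h z ∂S.toMeasure := by
  simp [sum, toMeasure, lintegral_sum_measure, lintegral_dirac' _ hh]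

theorem measurable_sum {h : ℝ → ℝ≥0∞} (hh : Measurable h) : Measurable (sum h) := by
  have : sum h = fun S => ∫⁻ z, h z ∂S.toMeasure := funext (sum_eq_lintegral hh)
  rw [this]
  exact (Measure.measurable_lintegral hh).comp measurable_toMeasure

/-- The point set moved by `t`. -/
def translate (t : ℝ) (S : PointSet) : PointSet := ⟨(fun z => z + t) '' S.points⟩

theorem measurable_translate (t : ℝ) : Measurable (translate t) := by
  refine measurable_of_count fun B hB => ?_
  have : (fun S => (translate t S).count B) = fun S => S.count ((fun z => z + t) ⁻¹' B) := by
    ext S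
    rw [count, count, translate, ← Set.image_inter_preimage,
      (add_left_injective t).encard_image]
  rw [this]
  exact measurable_count (hB.preimage (measurable_id.add_const t))

theorem measurable_add_const (z : ℝ) : Measurable fun S : PointSet => S.add z := by
  refine measurable_of_count fun B hB => ?_
  -- Points carry no multiplicity and `z` may already belong to `S`, so only `B \ {z}` is counted in
  -- `S`.
  have : (fun S : PointSet => (S.add z).count B)
      = fun S => S.count (B \ {z}) + B.indicator 1 z := by
    ext S
    have hd : Disjoint (S.points ∩ (B \ {z})) (B ∩ {z}) :=
      Set.disjoint_left.2 fun a ha hb => ha.2.2 hb.2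
    have hu : insert z S.points ∩ B = S.points ∩ (B \ {z}) ∪ B ∩ {z} := by
      ext a
      by_cases h : a = z
      · subst h; simp [and_comm]
      · simp [h]
    by_cases hz : z ∈ B
    · simp only [count, add, hu, Set.encard_union_eq hd]
      simp [hz]
    · simp only [count, add, hu, Set.encard_union_eq hd]
      simp [hz]
  rw [this]
  exact (measurable_count (hB.diff (measurableSet_singleton z))).add_const _

/-- The σ-algebra of the events that depend only on the points in `[-n, n]`. -/
noncomputable abbrev windowSpace (n : ℕ) : MeasurableSpace PointSet :=
  MeasurableSpace.comap (fun S => S.inter (Icc (-n : ℝ) n)) inferInstance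

theorem monotone_windowSpace : Monotone windowSpace := by
  intro m n hmn
  have : (fun S : PointSet => S.inter (Icc (-m : ℝ) m))
      = (fun S : PointSet => S.inter (Icc (-m : ℝ) m)) ∘ fun S => S.inter (Icc (-n : ℝ) n) := by
    ext S z
    simp only [inter, Function.comp, Set.mem_inter_iff, Set.mem_Icc]
    have : (m : ℝ) ≤ n := by exact_mod_cast hmn
    constructor
    · rintro ⟨h, h1, h2⟩; exact ⟨⟨h, by linarith, by linarith⟩, h1, h2⟩
    · rintro ⟨⟨h, -⟩, h1⟩; exact ⟨h, h1⟩
  rw [windowSpace, windowSpace, this, ← MeasurableSpace.comap_comp]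
  exact MeasurableSpace.comap_mono (measurable_iff_comap_le.1 (measurable_inter measurableSet_Icc))

theorem windowSpace_le (n : ℕ) : windowSpace n ≤ instMeasurableSpace :=
  measurable_iff_comap_le.1 (measurable_inter measurableSet_Icc)

/-- Counts increase along growing windows, by continuity from below of the counting measure.
Consequently the window events generate everything, and convergence of laws need only be checked on
them. -/
theorem iSup_windowSpace : ⨆ n, windowSpace n = instMeasurableSpace := by
  refine le_antisymm (iSup_le windowSpace_le) ?_
  conv_lhs => rw [instMeasurableSpace]
  refine iSup₂_le fun B hB => ?_
  rw [← measurable_iff_comap_le]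
  have hcount : ∀ n : ℕ, Measurable[⨆ n, windowSpace n]
      fun S : PointSet => (((S.inter (Icc (-n : ℝ) n)).count B : ℕ∞) : ℝ≥0∞) := by
    intro n
    have h1 : Measurable[windowSpace n] fun S : PointSet => S.inter (Icc (-n : ℝ) n) :=
      comap_measurable _
    have h2 := (measurable_from_top (f := fun n : ℕ∞ => (n : ℝ≥0∞))).comp
      ((measurable_count hB).comp h1)
    exact h2.mono (le_iSup windowSpace n) le_rfl
  have hlim : (fun S : PointSet => ((S.count B : ℕ∞) : ℝ≥0∞))
      = fun S => ⨆ n : ℕ, (((S.inter (Icc (-n : ℝ) n)).count B : ℕ∞) : ℝ≥0∞) := by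
    ext S
    have h1 : ∀ n : ℕ, (S.inter (Icc (-n : ℝ) n)).count B = S.count (Icc (-n : ℝ) n ∩ B) := by
      intro n; simp [count, inter, Set.inter_assoc]
    simp only [h1]
    simp only [← toMeasure_apply S hB,
      ← fun n : ℕ => toMeasure_apply S ((measurableSet_Icc (a := (-n : ℝ)) (b := n)).inter hB)]
    have hU : B = ⋃ n : ℕ, Icc (-n : ℝ) n ∩ B := by
      ext z
      simp only [Set.mem_iUnion, Set.mem_inter_iff, Set.mem_Icc]
      obtain ⟨n, hn⟩ := exists_nat_ge |z|
      exact ⟨fun h => ⟨n, abs_le.1 hn, h⟩, fun ⟨_, _, h⟩ => h⟩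
    conv_lhs => rw [hU]
    refine Monotone.measure_iUnion ?_
    intro m n hmn
    have : (m : ℝ) ≤ n := by exact_mod_cast hmn
    exact Set.inter_subset_inter_left _ (Set.Icc_subset_Icc (by linarith) this)
  have h3 : Measurable[⨆ n, windowSpace n] fun S : PointSet => ((S.count B : ℕ∞) : ℝ≥0∞) := by
    rw [hlim]
    exact Measurable.iSup (mδ := ⨆ n, windowSpace n) hcount
  refine @measurable_to_countable' _ _ _ _ (⨆ n, windowSpace n) _ fun n => ?_
  have : (fun S : PointSet => S.count B) ⁻¹' {n}
      = (fun S : PointSet => ((S.count B : ℕ∞) : ℝ≥0∞)) ⁻¹' {(n : ℝ≥0∞)} := by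
    ext S; simp
  rw [this]
  exact h3 (measurableSet_singleton _)

end PointSet

/-! ### Second moment argument for nearly indistinguishable holes. -/

section WeightedAverages

variable {Z ι : Type*} [MeasurableSpace Z] {P : Measure Z} [IsProbabilityMeasure P]
  {W : Finset ι} {p : ℝ} {D h : ι → Z → ℝ}

theorem integrable_of_mem_unitInterval {f : Z → ℝ} (hf : Measurable f) (h0 : ∀ z, 0 ≤ f z)
    (h1 : ∀ z, f z ≤ 1) : Integrable f P :=
  Integrable.of_bound hf.aestronglyMeasurable 1
    (Filter.Eventually.of_forall fun z => by rw [Real.norm_eq_abs, abs_of_nonneg (h0 z)]; exact h1 z)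

/-- The second moment of a weighted sum of centred, pairwise uncorrelated `[0, 1]`-valued
functions. -/
theorem integral_sq_sum_le (hDm : ∀ x, Measurable (D x)) (hD0 : ∀ x z, 0 ≤ D x z)
    (hD1 : ∀ x z, D x z ≤ 1) (hED : ∀ x ∈ W, ∫ z, D x z ∂P = p)
    (hEDD : ∀ x ∈ W, ∀ y ∈ W, x ≠ y → ∫ z, D x z * D y z ∂P = p ^ 2) (a : ι → ℝ) :
    ∫ z, (∑ x ∈ W, a x * (D x z - p)) ^ 2 ∂P ≤ p * ∑ x ∈ W, a x ^ 2 := by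
  classical
  have hiD : ∀ x, Integrable (D x) P := fun x =>
    integrable_of_mem_unitInterval (hDm x) (hD0 x) (hD1 x)
  have hiDD : ∀ x y, Integrable (fun z => D x z * D y z) P := fun x y =>
    integrable_of_mem_unitInterval ((hDm x).mul (hDm y)) (fun z => mul_nonneg (hD0 x z) (hD0 y z))
      (fun z => mul_le_one₀ (hD1 x z) (hD0 y z) (hD1 y z))
  have hi : ∀ x y, Integrable (fun z => (D x z - p) * (D y z - p)) P := by
    intro x y
    have : (fun z => (D x z - p) * (D y z - p))
        = fun z => D x z * D y z - p * D x z - p * D y z + p ^ 2 := by ext z; ring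
    rw [this]
    exact (((hiDD x y).sub ((hiD x).const_mul p)).sub ((hiD y).const_mul p)).add
      (integrable_const _)
  have hcov : ∀ x ∈ W, ∀ y ∈ W, ∫ z, (D x z - p) * (D y z - p) ∂P
      = ∫ z, D x z * D y z ∂P - p ^ 2 := by
    intro x hx y hy
    have : (fun z => (D x z - p) * (D y z - p))
        = fun z => D x z * D y z - p * D x z - p * D y z + p ^ 2 := by ext z; ring
    have i1 : Integrable (fun z => D x z * D y z - p * D x z) P :=
      (hiDD x y).sub ((hiD x).const_mul p)
    have i2 : Integrable (fun z => D x z * D y z - p * D x z - p * D y z) P :=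
      i1.sub ((hiD y).const_mul p)
    rw [this, integral_add i2 (integrable_const _), integral_sub i1 ((hiD y).const_mul p),
      integral_sub (hiDD x y) ((hiD x).const_mul p),
      integral_const_mul, integral_const_mul, hED x hx, hED y hy]
    simp
    ring
  have hexp : (fun z => (∑ x ∈ W, a x * (D x z - p)) ^ 2)
      = fun z => ∑ x ∈ W, ∑ y ∈ W, a x * a y * ((D x z - p) * (D y z - p)) := by
    ext z
    rw [sq, Finset.sum_mul_sum]
    refine Finset.sum_congr rfl fun x _ => Finset.sum_congr rfl fun y _ => by ring
  rw [hexp, integral_finsetSum _ fun x _ => integrable_finsetSum _ fun y _ =>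
    (hi x y).const_mul _, Finset.mul_sum]
  refine Finset.sum_le_sum fun x hx => ?_
  rw [integral_finsetSum _ fun y _ => (hi x y).const_mul _]
  rw [Finset.sum_eq_single x]
  · rw [integral_const_mul, hcov x hx x hx]
    have : ∫ z, D x z * D x z ∂P ≤ p := by
      rw [← hED x hx]
      exact integral_mono (hiDD x x) (hiD x) fun z => mul_le_of_le_one_right (hD0 x z) (hD1 x z)
    nlinarith [sq_nonneg (a x), sq_nonneg p, mul_nonneg (sq_nonneg (a x)) (sq_nonneg p)]
  · intro y hy hyx
    rw [integral_const_mul, hcov x hx y hy, hEDD x hx y hy hyx.symm]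
    ring
  · exact fun hx' => absurd hx hx'

/-- If biasing by `D x * D y` makes `h x` and `h y` indistinguishable, then the means `q x` of the
`h x` biased by `D x` nearly average out against weights `c x` of vanishing sum. -/
theorem abs_sum_biased_mean_le (hp : 0 < p) (hDm : ∀ x, Measurable (D x)) (hD0 : ∀ x z, 0 ≤ D x z)
    (hD1 : ∀ x z, D x z ≤ 1) (hED : ∀ x ∈ W, ∫ z, D x z ∂P = p)
    (hEDD : ∀ x ∈ W, ∀ y ∈ W, x ≠ y → ∫ z, D x z * D y z ∂P = p ^ 2)
    (hhm : ∀ x, Measurable (h x)) (hh0 : ∀ x z, 0 ≤ h x z) (hh1 : ∀ x z, h x z ≤ 1)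
    (hsymm : ∀ x ∈ W, ∀ y ∈ W, x ≠ y →
      ∫ z, D x z * D y z * h x z ∂P = ∫ z, D x z * D y z * h y z ∂P)
    {q : ι → ℝ} (hq : ∀ x ∈ W, ∫ z, D x z * h x z ∂P = p * q x)
    {M : ℝ} (hM : 0 < M) (hWM : (W.card : ℝ) = M) {c : ι → ℝ} (hc : ∀ x ∈ W, |c x| = M⁻¹)
    (hc0 : ∑ x ∈ W, c x = 0) :
    |∑ x ∈ W, c x * q x| ≤ 2 * √((p * M)⁻¹) + 2 * (p * M)⁻¹ := by
  classical
  set η := (p * M)⁻¹ with hη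
  have hη0 : 0 < η := by positivity
  -- `T` has mean `1` and `U` mean `0`, both with variance at most `η`; the mean of `R` is the sum
  -- to be bounded, and `|R|`, `|V|`, `|U|` are all at most `T`.
  set T : Z → ℝ := fun z => ∑ y ∈ W, η * D y z with hT
  set U : Z → ℝ := fun z => ∑ x ∈ W, p⁻¹ * c x * D x z with hU
  set R : Z → ℝ := fun z => ∑ x ∈ W, p⁻¹ * c x * (D x z * h x z) with hR
  set V : Z → ℝ := fun z => ∑ y ∈ W, η * (D y z * h y z) with hV
  have hDh1 : ∀ x z, D x z * h x z ≤ 1 := fun x z => mul_le_one₀ (hD1 x z) (hh0 x z) (hh1 x z)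
  have hDh0 : ∀ x z, 0 ≤ D x z * h x z := fun x z => mul_nonneg (hD0 x z) (hh0 x z)
  have hXeq : ∀ z, T z - 1 = ∑ x ∈ W, η * (D x z - p) := by
    intro z
    simp only [hT, mul_sub, Finset.sum_sub_distrib, Finset.sum_const, nsmul_eq_mul, hWM]
    rw [hη]; field_simp
  have hUeq : ∀ z, U z = ∑ x ∈ W, p⁻¹ * c x * (D x z - p) := by
    intro z
    simp only [hU, mul_sub, Finset.sum_sub_distrib]
    rw [← Finset.sum_mul, ← Finset.mul_sum, hc0]; ring
  have hX2 : ∫ z, (T z - 1) ^ 2 ∂P ≤ η := by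
    simp only [hXeq]
    refine (integral_sq_sum_le hDm hD0 hD1 hED hEDD fun _ => η).trans_eq ?_
    rw [Finset.sum_const, nsmul_eq_mul, hWM, hη]; field_simp
  have hU2 : ∫ z, U z ^ 2 ∂P ≤ η := by
    simp only [hUeq]
    refine (integral_sq_sum_le hDm hD0 hD1 hED hEDD fun x => p⁻¹ * c x).trans_eq ?_
    have : ∑ x ∈ W, (p⁻¹ * c x) ^ 2 = ∑ x ∈ W, (p⁻¹ * M⁻¹) ^ 2 :=
      Finset.sum_congr rfl fun x hx => by rw [mul_pow, mul_pow, ← sq_abs (c x), hc x hx]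
    rw [this, Finset.sum_const, nsmul_eq_mul, hWM, hη]; field_simp
  have hTm : Measurable T := by fun_prop
  have hUm : Measurable U := by fun_prop
  have hRm : Measurable R := by fun_prop
  have hVm : Measurable V := by fun_prop
  have hT0 : ∀ z, 0 ≤ T z := fun z =>
    Finset.sum_nonneg fun y _ => mul_nonneg hη0.le (hD0 y z)
  have hcW : ∀ x ∈ W, p⁻¹ * |c x| = η := fun x hx => by rw [hc x hx, hη, mul_inv]
  have hRT : ∀ z, |R z| ≤ T z := by
    intro z
    refine (Finset.abs_sum_le_sum_abs _ _).trans (Finset.sum_le_sum fun x hx => ?_)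
    rw [abs_mul, abs_mul, abs_of_pos (inv_pos.2 hp), hcW x hx, abs_of_nonneg (hDh0 x z)]
    exact mul_le_mul_of_nonneg_left (mul_le_of_le_one_right (hD0 x z) (hh1 x z)) hη0.le
  have hVT : ∀ z, |V z| ≤ T z := by
    intro z
    refine (Finset.abs_sum_le_sum_abs _ _).trans (Finset.sum_le_sum fun x hx => ?_)
    rw [abs_mul, abs_of_pos hη0, abs_of_nonneg (hDh0 x z)]
    exact mul_le_mul_of_nonneg_left (mul_le_of_le_one_right (hD0 x z) (hh1 x z)) hη0.le
  have hUT : ∀ z, |U z| ≤ T z := by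
    intro z
    refine (Finset.abs_sum_le_sum_abs _ _).trans (Finset.sum_le_sum fun x hx => ?_)
    rw [abs_mul, abs_mul, abs_of_pos (inv_pos.2 hp), hcW x hx, abs_of_nonneg (hD0 x z)]
  have hTb : ∀ z, T z ≤ p⁻¹ := by
    intro z
    calc T z ≤ ∑ y ∈ W, η * 1 :=
          Finset.sum_le_sum fun y _ => mul_le_mul_of_nonneg_left (hD1 y z) hη0.le
      _ = p⁻¹ := by rw [Finset.sum_const, nsmul_eq_mul, hWM, hη]; field_simp
  have hbd : ∀ {f : Z → ℝ}, Measurable f → (K : ℝ) → (∀ z, |f z| ≤ K) → Integrable f P :=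
    fun hf K hK => Integrable.of_bound hf.aestronglyMeasurable K
      (Filter.Eventually.of_forall fun z => by rw [Real.norm_eq_abs]; exact hK z)
  have hiprod : ∀ {f g : Z → ℝ}, Measurable f → Measurable g → (∀ z, |f z| ≤ T z) →
      (∀ z, |g z| ≤ T z) → Integrable (fun z => f z * g z) P := by
    intro f g hf hg h1 h2
    refine hbd (hf.mul hg) (p⁻¹ * p⁻¹) fun z => ?_
    rw [abs_mul]
    exact mul_le_mul ((h1 z).trans (hTb z)) ((h2 z).trans (hTb z)) (abs_nonneg _)
      (inv_nonneg.2 hp.le)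
  have hTT : ∀ z, |T z| ≤ T z := fun z => (abs_of_nonneg (hT0 z)).le
  have hiR : Integrable R P := hbd hRm p⁻¹ fun z => (hRT z).trans (hTb z)
  have hiT : Integrable T P := hbd hTm p⁻¹ fun z => (hTT z).trans (hTb z)
  have hi1 : ∀ x, Integrable (fun z => D x z * h x z) P := fun x =>
    integrable_of_mem_unitInterval ((hDm x).mul (hhm x)) (hDh0 x) (hDh1 x)
  have hi2 : ∀ x y w, Integrable (fun z => D x z * D y z * h w z) P := fun x y w =>
    integrable_of_mem_unitInterval (((hDm x).mul (hDm y)).mul (hhm w))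
      (fun z => mul_nonneg (mul_nonneg (hD0 x z) (hD0 y z)) (hh0 w z))
      (fun z => mul_le_one₀ (mul_le_one₀ (hD1 x z) (hD0 y z) (hD1 y z)) (hh0 w z) (hh1 w z))
  have hsum : ∑ x ∈ W, c x * q x = ∫ z, R z ∂P := by
    rw [hR, integral_finsetSum _ fun x _ => (hi1 x).const_mul _]
    refine Finset.sum_congr rfl fun x hx => ?_
    rw [integral_const_mul, hq x hx]
    field_simp
  -- Symmetry moves the signed weight `c x` from `h x` to a factor without `h`. Thus `∫ R = ∫ (R (1
  -- - T) + V U)`, where each product contains a small factor.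
  have hRTVU : ∫ z, R z * T z ∂P = ∫ z, V z * U z ∂P := by
    have e1 : (fun z => R z * T z)
        = fun z => ∑ x ∈ W, ∑ y ∈ W, p⁻¹ * c x * η * (D x z * D y z * h x z) := by
      ext z
      simp only [hR, hT]
      rw [Finset.sum_mul_sum]
      exact Finset.sum_congr rfl fun x _ => Finset.sum_congr rfl fun y _ => by ring
    have e2 : (fun z => V z * U z)
        = fun z => ∑ x ∈ W, ∑ y ∈ W, p⁻¹ * c x * η * (D x z * D y z * h y z) := by
      ext z
      simp only [hV, hU]
      rw [Finset.sum_mul_sum, Finset.sum_comm]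
      exact Finset.sum_congr rfl fun x _ => Finset.sum_congr rfl fun y _ => by ring
    rw [e1, e2, integral_finsetSum _ fun x _ => integrable_finsetSum _ fun y _ =>
      (hi2 x y x).const_mul _, integral_finsetSum _ fun x _ => integrable_finsetSum _ fun y _ =>
      (hi2 x y y).const_mul _]
    refine Finset.sum_congr rfl fun x hx => ?_
    rw [integral_finsetSum _ fun y _ => (hi2 x y x).const_mul _,
      integral_finsetSum _ fun y _ => (hi2 x y y).const_mul _]
    refine Finset.sum_congr rfl fun y hy => ?_
    rw [integral_const_mul, integral_const_mul]
    by_cases hxy : x = y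
    · rw [hxy]
    · rw [hsymm x hx y hy hxy]
  have hmain : ∑ x ∈ W, c x * q x = ∫ z, (R z - R z * T z + V z * U z) ∂P := by
    have i1 : Integrable (fun z => R z - R z * T z) P := hiR.sub (hiprod hRm hTm hRT hTT)
    rw [integral_add i1 (hiprod hVm hUm hVT hUT),
      integral_sub hiR (hiprod hRm hTm hRT hTT), hRTVU, hsum]
    ring
  have hsη : 0 < √η := Real.sqrt_pos.2 hη0
  have hsq : √η * √η = η := Real.mul_self_sqrt hη0.le
  have hiX2 : Integrable (fun z => (T z - 1) ^ 2) P := by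
    have : (fun z => (T z - 1) ^ 2) = fun z => T z * T z - 2 * T z + 1 := by ext z; ring
    rw [this]
    exact ((hiprod hTm hTm hTT hTT).sub (hiT.const_mul 2)).add (integrable_const _)
  have hiU2 : Integrable (fun z => U z ^ 2) P := by
    simp only [sq]
    exact hiprod hUm hUm hUT hUT
  -- AM-GM with weight `√η`, in place of Cauchy–Schwarz: it is balanced when the second moment of
  -- `t` is of order `η`.
  have habs : ∀ t : ℝ, |t| ≤ √η / 2 + (√η)⁻¹ / 2 * t ^ 2 := by
    intro t
    have h1 : 0 ≤ (√η)⁻¹ * (√η - |t|) ^ 2 := by positivity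
    have h2 : (√η)⁻¹ * (√η - |t|) ^ 2 = √η - 2 * |t| + (√η)⁻¹ * t ^ 2 := by
      rw [sub_sq, sq_abs]; field_simp
    linarith
  have hpt : ∀ z, |R z - R z * T z + V z * U z| ≤ √η + ((√η)⁻¹ / 2 + 3 / 2) * (T z - 1) ^ 2
      + ((√η)⁻¹ / 2 + 1 / 2) * U z ^ 2 := by
    intro z
    have h1 : |R z - R z * T z + V z * U z| ≤ T z * |T z - 1| + T z * |U z| := by
      have e : R z - R z * T z + V z * U z = -(R z * (T z - 1)) + V z * U z := by ring
      rw [e]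
      refine (abs_add_le _ _).trans ?_
      rw [abs_neg, abs_mul, abs_mul]
      gcongr
      · exact hRT z
      · exact hVT z
    have h2 := habs (T z - 1)
    have h3 := habs (U z)
    have h4 : T z ≤ 1 + |T z - 1| := by linarith [le_abs_self (T z - 1)]
    have h5 : T z * |T z - 1| + T z * |U z|
        ≤ |T z - 1| + |U z| + |T z - 1| ^ 2 + |T z - 1| * |U z| := by
      nlinarith [abs_nonneg (T z - 1), abs_nonneg (U z)]
    have h6 : |T z - 1| * |U z| ≤ (|T z - 1| ^ 2 + |U z| ^ 2) / 2 := by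
      nlinarith [sq_nonneg (|T z - 1| - |U z|)]
    rw [sq_abs, sq_abs] at h6
    rw [sq_abs] at h5
    linarith
  rw [hmain]
  refine (abs_integral_le_integral_abs).trans ?_
  have hi3 : Integrable (fun z => √η + ((√η)⁻¹ / 2 + 3 / 2) * (T z - 1) ^ 2
      + ((√η)⁻¹ / 2 + 1 / 2) * U z ^ 2) P :=
    ((integrable_const _).add (hiX2.const_mul _)).add (hiU2.const_mul _)
  refine (integral_mono ((hiR.sub (hiprod hRm hTm hRT hTT)).add
    (hiprod hVm hUm hVT hUT)).abs hi3 hpt).trans ?_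
  have i1 : Integrable (fun z => √η + ((√η)⁻¹ / 2 + 3 / 2) * (T z - 1) ^ 2) P :=
    (integrable_const _).add (hiX2.const_mul _)
  rw [integral_add i1 (hiU2.const_mul _),
    integral_add (integrable_const _) (hiX2.const_mul _), integral_const_mul, integral_const_mul]
  have hsi : (√η)⁻¹ * η = √η := by rw [inv_mul_eq_div, Real.div_sqrt]
  have h7 : ((√η)⁻¹ / 2 + 3 / 2) * ∫ z, (T z - 1) ^ 2 ∂P ≤ ((√η)⁻¹ / 2 + 3 / 2) * η := by gcongr
  have h8 : ((√η)⁻¹ / 2 + 1 / 2) * ∫ z, U z ^ 2 ∂P ≤ ((√η)⁻¹ / 2 + 1 / 2) * η := by gcongr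
  simp only [integral_const, probReal_univ, smul_eq_mul, one_mul]
  nlinarith

end WeightedAverages

/-! ### Resampling coordinates of a product measure. -/

section ProductSpace

/-- The point set with points `z i`, `i ∈ I`. -/
def pointsOf (I : Set ℤ) (z : ℤ → ℝ) : PointSet := ⟨z '' I⟩

theorem measurable_pointsOf (I : Set ℤ) : Measurable (pointsOf I) := by
  refine PointSet.measurable_of_countable (fun (x : ℤ) z => z x) (fun x => measurable_pi_apply x)
    (fun x => {_z | x ∈ I}) (fun x => MeasurableSet.const _) ?_
  intro z
  ext a
  simp [pointsOf, eq_comm]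

theorem measurable_pointsOf_add (I : Set ℤ) :
    Measurable fun p : (ℤ → ℝ) × ℝ => (pointsOf I p.1).add p.2 := by
  refine PointSet.measurable_of_countable
    (fun (o : Option ℤ) (p : (ℤ → ℝ) × ℝ) => o.elim p.2 fun x => p.1 x)
    ?_ (fun o => {_p | o.elim True fun x => x ∈ I}) (fun _ => MeasurableSet.const _) ?_
  · rintro (_ | x)
    · exact measurable_snd
    · exact (measurable_pi_apply x).comp measurable_fst
  · intro p
    ext a
    simp [pointsOf, PointSet.add, Option.exists, eq_comm]

theorem pointsOf_update_of_notMem {I : Set ℤ} {x : ℤ} (hx : x ∉ I) (z : ℤ → ℝ) (a : ℝ) :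
    pointsOf I (Function.update z x a) = pointsOf I z := by
  ext b
  simp only [pointsOf, Set.mem_image]
  refine exists_congr fun w => and_congr_right fun hw => ?_
  rw [Function.update_of_ne (ne_of_mem_of_not_mem hw hx)]

theorem pointsOf_update_insert {I : Set ℤ} {x : ℤ} (hx : x ∉ I) (z : ℤ → ℝ) (a : ℝ) :
    pointsOf (insert x I) (Function.update z x a) = (pointsOf I z).add a := by
  have h := congrArg PointSet.points (pointsOf_update_of_notMem hx z a)
  ext b
  simp only [pointsOf, PointSet.add] at h ⊢
  rw [Set.image_insert_eq, h, Function.update_self]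

theorem measurable_update_prod (i : ℤ) :
    Measurable fun p : (ℤ → ℝ) × ℝ => Function.update p.1 i p.2 :=
  measurable_pi_iff.2 fun j => by
    by_cases h : j = i
    · subst h; simpa using measurable_snd
    · simp only [Function.update_of_ne h]; fun_prop

variable {ν : ℤ → Measure ℝ} [∀ w, IsProbabilityMeasure (ν w)]

/-- Resampling one coordinate preserves the product measure. -/
theorem map_update_infinitePi (i : ℤ) :
    ((Measure.infinitePi ν).prod (ν i)).map (fun p => Function.update p.1 i p.2)
      = Measure.infinitePi ν := by
  refine Measure.eq_infinitePi _ fun s t ht => ?_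
  rw [Measure.map_apply (measurable_update_prod i) (.pi s.countable_toSet fun j _ => ht j)]
  by_cases hi : i ∈ s
  · have : (fun p : (ℤ → ℝ) × ℝ => Function.update p.1 i p.2) ⁻¹' Set.pi s t
        = (Set.pi (s.erase i) t) ×ˢ t i := by
      ext ⟨z, a⟩
      simp only [Set.mem_preimage, Set.mem_pi, Finset.mem_coe, Set.mem_prod, Finset.mem_erase]
      constructor
      · intro h
        refine ⟨fun j hj => ?_, by simpa using h i hi⟩
        simpa [Function.update_of_ne hj.1] using h j hj.2
      · rintro ⟨h1, h2⟩ j hj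
        by_cases hji : j = i
        · subst hji; simpa using h2
        · simpa [Function.update_of_ne hji] using h1 j ⟨hji, hj⟩
    rw [this, Measure.prod_prod, Measure.infinitePi_pi _ fun j _ => ht j, mul_comm,
      Finset.mul_prod_erase s (fun j => ν j (t j)) hi]
  · have : (fun p : (ℤ → ℝ) × ℝ => Function.update p.1 i p.2) ⁻¹' Set.pi s t
        = (Set.pi s t) ×ˢ Set.univ := by
      ext ⟨z, a⟩
      simp only [Set.mem_preimage, Set.mem_pi, Finset.mem_coe, Set.mem_prod, Set.mem_univ,
        and_true]
      refine forall₂_congr fun j hj => ?_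
      rw [Function.update_of_ne (ne_of_mem_of_not_mem hj hi)]
    rw [this, Measure.prod_prod, Measure.infinitePi_pi _ fun j _ => ht j]
    simp

theorem integral_infinitePi_eq_integral_update (i : ℤ) {f : (ℤ → ℝ) → ℝ} (hf : Measurable f) :
    ∫ z, f z ∂Measure.infinitePi ν
      = ∫ p, f (Function.update p.1 i p.2) ∂(Measure.infinitePi ν).prod (ν i) := by
  conv_lhs => rw [← map_update_infinitePi (ν := ν) i]
  rw [integral_map (measurable_update_prod i).aemeasurable hf.aestronglyMeasurable]

/-- A coordinate is independent of any function that does not depend on it. -/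
theorem integral_mul_of_update_eq (i : ℤ) {f : ℝ → ℝ} (hf : Measurable f) {g : (ℤ → ℝ) → ℝ}
    (hg : Measurable g) (hgi : ∀ z a, g (Function.update z i a) = g z) :
    ∫ z, f (z i) * g z ∂Measure.infinitePi ν
      = (∫ a, f a ∂ν i) * ∫ z, g z ∂Measure.infinitePi ν := by
  rw [integral_infinitePi_eq_integral_update i
    (f := fun z => f (z i) * g z) ((hf.comp (measurable_pi_apply i)).mul hg)]
  simp only [Function.update_self, hgi]
  rw [mul_comm, ← integral_prod_mul g f]
  simp only [mul_comm]

/-- Truncating the Radon–Nikodym derivative at `1` turns its almost everywhere bound into a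
pointwise one, as the second moment argument requires. -/
theorem exists_density_le_one {ρ κ : Measure ℝ} [IsFiniteMeasure ρ] [IsFiniteMeasure κ]
    (h : ρ ≤ κ) : ∃ D : ℝ → ℝ, Measurable D ∧ (∀ a, 0 ≤ D a) ∧ (∀ a, D a ≤ 1) ∧
      κ.withDensity (fun a => ENNReal.ofReal (D a)) = ρ := by
  refine ⟨fun a => min 1 (ρ.rnDeriv κ a).toReal,
    measurable_const.min (Measure.measurable_rnDeriv ρ κ).ennreal_toReal,
    fun a => le_min zero_le_one ENNReal.toReal_nonneg, fun a => min_le_left _ _, ?_⟩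
  conv_rhs => rw [← Measure.withDensity_rnDeriv_eq ρ κ (Measure.absolutelyContinuous_of_le h)]
  refine withDensity_congr_ae ?_
  filter_upwards [Measure.rnDeriv_le_one_of_le h] with a ha
  have ha' : ρ.rnDeriv κ a ≤ 1 := ha
  have htop : ρ.rnDeriv κ a ≠ ∞ := ne_top_of_le_ne_top ENNReal.one_ne_top ha'
  rw [min_eq_right (ENNReal.toReal_le_of_le_ofReal zero_le_one (by simpa using ha')),
    ENNReal.ofReal_toReal htop]

/-- Biasing by the density of `p • u` amounts to resampling the coordinate from `u`. -/
theorem integral_density_mul (i : ℤ) {u : Measure ℝ} [IsProbabilityMeasure u] {p : ℝ} (hp : 0 ≤ p)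
    {D : ℝ → ℝ} (hD : Measurable D) (hD0 : ∀ a, 0 ≤ D a) (hD1 : ∀ a, D a ≤ 1)
    (hDu : (ν i).withDensity (fun a => ENNReal.ofReal (D a)) = ENNReal.ofReal p • u)
    {g : (ℤ → ℝ) → ℝ} (hg : Measurable g) (hg0 : ∀ z, 0 ≤ g z) (hg1 : ∀ z, g z ≤ 1) :
    ∫ z, D (z i) * g z ∂Measure.infinitePi ν
      = p * ∫ z, ∫ a, g (Function.update z i a) ∂u ∂Measure.infinitePi ν := by
  rw [integral_infinitePi_eq_integral_update i
    (f := fun z => D (z i) * g z) ((hD.comp (measurable_pi_apply i)).mul hg)]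
  simp only [Function.update_self]
  have hint : Integrable (fun q : (ℤ → ℝ) × ℝ => D q.2 * g (Function.update q.1 i q.2))
      ((Measure.infinitePi ν).prod (ν i)) :=
    integrable_of_mem_unitInterval
      ((hD.comp measurable_snd).mul (hg.comp (measurable_update_prod i)))
      (fun q => mul_nonneg (hD0 _) (hg0 _)) (fun q => mul_le_one₀ (hD1 _) (hg0 _) (hg1 _))
  rw [integral_prod _ hint, ← integral_const_mul]
  congr 1
  ext z
  have h := integral_withDensity_eq_integral_toReal_smul (μ := ν i)
    (f := fun a => ENNReal.ofReal (D a)) hD.ennreal_ofReal (by simp)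
    (fun a => g (Function.update z i a))
  rw [hDu, integral_smul_measure, ENNReal.toReal_ofReal hp] at h
  simp only [smul_eq_mul, ENNReal.toReal_ofReal (hD0 _)] at h
  exact h.symm

/-- The probability that the points with an index other than `x` form a set in `A`. -/
noncomputable def holeProb (ν : ℤ → Measure ℝ) (A : Set PointSet) (x : ℤ) : ℝ :=
  (Measure.infinitePi ν).real {z | pointsOf {x}ᶜ z ∈ A}

/-- If all points with index in `W` have a uniformly large chance `p` to be distributed according
to `u`, then the laws with a hole that is uniform in `W`, or uniform in half of `W`, are close. -/
theorem abs_average_holeProb_sub_le {u : Measure ℝ} [IsProbabilityMeasure u] {p : ℝ} (hp : 0 < p)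
    {W W₀ : Finset ℤ} (hW : W₀ ⊆ W) {N : ℝ} (hN : 0 < N) (hW₀N : (W₀.card : ℝ) = N)
    (hWN : (W.card : ℝ) = 2 * N) (hle : ∀ w ∈ W, ENNReal.ofReal p • u ≤ ν w)
    {A : Set PointSet} (hA : MeasurableSet A) :
    |N⁻¹ * ∑ x ∈ W₀, holeProb ν A x - (2 * N)⁻¹ * ∑ x ∈ W, holeProb ν A x|
      ≤ 2 * √((p * (2 * N))⁻¹) + 2 * (p * (2 * N))⁻¹ := by
  classical
  have hfin : IsFiniteMeasure (ENNReal.ofReal p • u) := u.smul_finite ENNReal.ofReal_ne_top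
  have hex : ∀ w, ∃ D : ℝ → ℝ, Measurable D ∧ (∀ a, 0 ≤ D a) ∧ (∀ a, D a ≤ 1) ∧
      (w ∈ W → (ν w).withDensity (fun a => ENNReal.ofReal (D a)) = ENNReal.ofReal p • u) := by
    intro w
    by_cases hw : w ∈ W
    · obtain ⟨D, h1, h2, h3, h4⟩ := exists_density_le_one (hle w hw)
      exact ⟨D, h1, h2, h3, fun _ => h4⟩
    · exact ⟨0, measurable_const, fun _ => le_rfl, fun _ => zero_le_one, fun h => absurd h hw⟩
  choose D hDm hD0 hD1 hDu using hex
  set h : ℤ → (ℤ → ℝ) → ℝ := fun x => {z | pointsOf {x}ᶜ z ∈ A}.indicator 1 with hh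
  have hset : ∀ x, MeasurableSet {z | pointsOf {x}ᶜ z ∈ A} := fun x => measurable_pointsOf _ hA
  have hhm : ∀ x, Measurable (h x) := fun x => measurable_one.indicator (hset x)
  have hh0 : ∀ x z, 0 ≤ h x z := fun x z => Set.indicator_nonneg (fun _ _ => zero_le_one) z
  have hh1 : ∀ x z, h x z ≤ 1 := fun x z => Set.indicator_le_self' (fun _ _ => zero_le_one) z
  have hkey : ∀ x z, h x z = A.indicator 1 (pointsOf {x}ᶜ z) := fun _ _ => rfl
  have hhinv : ∀ x z a, h x (Function.update z x a) = h x z := by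
    intro x z a
    rw [hkey, hkey, pointsOf_update_of_notMem (by simp)]
  have hED : ∀ x ∈ W, ∫ a, D x a ∂ν x = p := by
    intro x hx
    have h := integral_withDensity_eq_integral_toReal_smul (μ := ν x)
      (f := fun a => ENNReal.ofReal (D x a)) (hDm x).ennreal_ofReal (by simp) (fun _ => (1 : ℝ))
    rw [hDu x hx, integral_smul_measure, ENNReal.toReal_ofReal hp.le] at h
    simpa [ENNReal.toReal_ofReal (hD0 x _)] using h.symm
  have hDz : ∀ x, Measurable fun z : ℤ → ℝ => D x (z x) := fun x =>
    (hDm x).comp (measurable_pi_apply x)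
  have hE1 : ∀ x ∈ W, ∫ z, D x (z x) ∂Measure.infinitePi ν = p := by
    intro x hx
    have := integral_mul_of_update_eq (ν := ν) x (hDm x) (g := fun _ => 1) measurable_const
      (fun _ _ => rfl)
    simpa [hED x hx] using this
  have hEDg : ∀ x ∈ W, ∀ g : (ℤ → ℝ) → ℝ, Measurable g →
      (∀ z a, g (Function.update z x a) = g z) →
      ∫ z, D x (z x) * g z ∂Measure.infinitePi ν = p * ∫ z, g z ∂Measure.infinitePi ν := by
    intro x hx g hg hgi
    rw [integral_mul_of_update_eq x (hDm x) hg hgi, hED x hx]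
  -- Once `x` and `y` are both biased towards `u`, removing `x` leaves the points outside `{x, y}`
  -- and one independent point of law `u`. The right-hand side is symmetric in `x` and `y`, so the
  -- same law remains when `y` is removed.
  have hsymm : ∀ x ∈ W, ∀ y ∈ W, x ≠ y →
      ∫ z, D x (z x) * D y (z y) * h x z ∂Measure.infinitePi ν
        = p * (p * ∫ z, ∫ a, A.indicator 1 ((pointsOf {x, y}ᶜ z).add a) ∂u
            ∂Measure.infinitePi ν) := by
    intro x hx y hy hxy
    simp only [mul_assoc]
    rw [hEDg x hx (fun z => D y (z y) * h x z) ((hDz y).mul (hhm x))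
      (fun z a => by rw [hhinv, Function.update_of_ne hxy.symm]),
      integral_density_mul y hp.le (hDm y) (hD0 y) (hD1 y) (hDu y hy) (hhm x) (hh0 x) (hh1 x)]
    congr 3
    ext z
    congr 1
    ext a
    have hins : ({x}ᶜ : Set ℤ) = insert y {x, y}ᶜ := by
      ext w
      simp only [Set.mem_compl_iff, Set.mem_singleton_iff, Set.mem_insert_iff]
      by_cases hwy : w = y
      · subst hwy; simp [hxy.symm]
      · simp [hwy]
    rw [hkey, hins, pointsOf_update_insert (by simp)]
  -- Difference of the two uniform weights. As `W₀` is exactly half of `W`, it is `±(2N)⁻¹`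
  -- everywhere and sums to zero.
  set c : ℤ → ℝ := fun x => (if x ∈ W₀ then N⁻¹ else 0) - (2 * N)⁻¹ with hc
  have hcabs : ∀ x ∈ W, |c x| = (2 * N)⁻¹ := by
    intro x _
    have h2 : N⁻¹ = 2 * (2 * N)⁻¹ := by field_simp
    have h3 : 0 < (2 * N)⁻¹ := by positivity
    by_cases hx : x ∈ W₀
    · simp only [hc, hx, if_true]
      rw [abs_of_pos (by linarith)]; linarith
    · simp only [hc, hx, if_false]
      rw [zero_sub, abs_neg, abs_of_pos h3]
  have hcsum : ∀ q : ℤ → ℝ, ∑ x ∈ W, c x * q x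
      = N⁻¹ * ∑ x ∈ W₀, q x - (2 * N)⁻¹ * ∑ x ∈ W, q x := by
    intro q
    simp only [hc, sub_mul, Finset.sum_sub_distrib, ite_mul, zero_mul, ← Finset.sum_filter,
      Finset.mul_sum]
    rw [Finset.filter_mem_eq_inter, Finset.inter_eq_right.2 hW]
  have hc0 : ∑ x ∈ W, c x = 0 := by
    have := hcsum fun _ => 1
    simp only [mul_one, Finset.sum_const, nsmul_eq_mul, hW₀N, hWN] at this
    rw [this]; field_simp; ring
  rw [← hcsum]
  refine abs_sum_biased_mean_le (P := Measure.infinitePi ν) (D := fun x z => D x (z x)) (h := h)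
    hp hDz (fun x z => hD0 x _) (fun x z => hD1 x _) hE1 ?_ hhm hh0 hh1 ?_ ?_ (by positivity)
    hWN hcabs hc0
  · intro x hx y hy hxy
    rw [hEDg x hx (fun z => D y (z y)) (hDz y) (fun z a => by rw [Function.update_of_ne hxy.symm]),
      hE1 y hy, sq]
  · intro x hx y hy hxy
    have e : ∀ z : ℤ → ℝ, D x (z x) * D y (z y) * h y z = D y (z y) * D x (z x) * h y z :=
      fun z => by ring
    simp only [e]
    rw [hsymm x hx y hy hxy, hsymm y hy x hx hxy.symm, Set.pair_comm]
  · intro x hx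
    rw [hEDg x hx (h x) (hhm x) (hhinv x), holeProb, integral_indicator_one (hset x)]

end ProductSpace

/-! ### From convergence on a π-system to setwise convergence. -/

section UniformCauchy

open Filter Topology

/-- If probability measures converge on a generating π-system, with uniformly summable increments,
then they converge on all measurable sets. -/
theorem tendsto_measureReal_of_summable {X : Type*} {mX : MeasurableSpace X}
    {κ : ℕ → Measure X} [∀ k, IsProbabilityMeasure (κ k)] {Q : Measure X} [IsProbabilityMeasure Q]
    {b : ℕ → ℝ} (hb : Summable b)
    (hκ : ∀ k A, MeasurableSet A → |(κ k).real A - (κ (k + 1)).real A| ≤ b k)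
    {C : Set (Set X)} (hC : mX = MeasurableSpace.generateFrom C) (hpi : IsPiSystem C)
    (hlim : ∀ A ∈ C, Tendsto (fun k => (κ k).real A) atTop (𝓝 (Q.real A)))
    {A : Set X} (hA : MeasurableSet A) :
    Tendsto (fun k => (κ k).real A) atTop (𝓝 (Q.real A)) := by
  induction A, hA using MeasurableSpace.induction_on_inter hC hpi with
  | empty => simp
  | basic A hA => exact hlim A hA
  | compl A hA ih =>
    simp only [probReal_compl_eq_one_sub hA]
    exact ih.const_sub 1
  | iUnion f hd hf ih =>
    set H : ℕ → Set X := fun n => ⋃ i ∈ Finset.range n, f i with hH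
    have hHm : ∀ n, MeasurableSet (H n) := fun n => Finset.measurableSet_biUnion _ fun i _ => hf i
    have hHsum : ∀ (R : Measure X) [IsProbabilityMeasure R] (n : ℕ),
        R.real (H n) = ∑ i ∈ Finset.range n, R.real (f i) := fun R _ n =>
      measureReal_biUnion_finset (fun i _ j _ hij => hd hij) fun i _ => hf i
    have hHU : ⋃ i, f i = ⋃ n, H n := by
      ext x
      simp only [hH, Set.mem_iUnion, Finset.mem_range, exists_prop]
      exact ⟨fun ⟨i, hi⟩ => ⟨i + 1, i, Nat.lt_succ_self i, hi⟩, fun ⟨_, i, _, hi⟩ => ⟨i, hi⟩⟩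
    have hHmono : Monotone H := fun m n hmn =>
      Set.biUnion_subset_biUnion_left fun i hi => by
        simp only [Finset.coe_range, Set.mem_Iio] at hi ⊢; omega
    have hHlim : ∀ (R : Measure X) [IsProbabilityMeasure R],
        Tendsto (fun n => R.real (H n)) atTop (𝓝 (R.real (⋃ i, f i))) := by
      intro R _
      rw [hHU]
      exact (ENNReal.tendsto_toReal (measure_ne_top _ _)).comp
        (tendsto_measure_iUnion_atTop hHmono)
    -- On the finite unions `H n` the limit is known by additivity, and the error at stage `k` is at
    -- most a tail of `b` that does not depend on `n`; this uniformity permits `n → ∞`.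
    have hbound : ∀ k, dist ((κ k).real (⋃ i, f i)) (Q.real (⋃ i, f i)) ≤ ∑' m, b (k + m) := by
      intro k
      refine le_of_tendsto ((hHlim (κ k)).dist (hHlim Q)) (Eventually.of_forall fun n => ?_)
      refine dist_le_tsum_of_dist_le_of_tendsto (f := fun k => (κ k).real (H n)) b
        (fun j => hκ j _ (hHm n)) hb ?_ k
      simp only [hHsum]
      exact tendsto_finsetSum _ fun i _ => ih i
    rw [tendsto_iff_dist_tendsto_zero]
    refine squeeze_zero (fun _ => dist_nonneg) hbound ?_
    simpa only [add_comm] using tendsto_sum_nat_add b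

end UniformCauchy

/-! ### Laws of the lattice with a random hole, and translation. -/

section Lattice

open Filter Topology

/-- The law of `w + Y` when `Y` has law `μ`. -/
noncomputable def shiftLaw (μ : Measure ℝ) (w : ℤ) : Measure ℝ := μ.map fun y => (w : ℝ) + y

variable {μ : Measure ℝ}

instance [IsProbabilityMeasure μ] (w : ℤ) : IsProbabilityMeasure (shiftLaw μ w) :=
  Measure.isProbabilityMeasure_map (by fun_prop)

/-- An interval of length `b - a` contains at most `b - a + 1` points of the grid `ℤ + y`. -/
theorem tsum_indicator_Icc_le {a b : ℝ} (hab : a ≤ b) (y : ℝ) :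
    ∑' x : ℤ, (Set.Icc a b).indicator (1 : ℝ → ℝ≥0∞) (x + y) ≤ ENNReal.ofReal (b - a + 1) := by
  have h1 : ∀ x : ℤ, (Set.Icc a b).indicator (1 : ℝ → ℝ≥0∞) (x + y)
      = (Finset.Icc ⌈a - y⌉ ⌊b - y⌋ : Set ℤ).indicator (fun _ => 1) x := by
    intro x
    have : (x : ℝ) + y ∈ Set.Icc a b ↔ x ∈ (Finset.Icc ⌈a - y⌉ ⌊b - y⌋ : Set ℤ) := by
      simp only [Set.mem_Icc, Finset.coe_Icc, Int.ceil_le, Int.le_floor]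
      constructor <;> rintro ⟨h1, h2⟩ <;> constructor <;> linarith
    by_cases h : (x : ℝ) + y ∈ Set.Icc a b
    · simp only [Set.indicator_of_mem h, Set.indicator_of_mem (this.1 h)]; rfl
    · simp only [Set.indicator_of_notMem h, Set.indicator_of_notMem fun h' => h (this.2 h')]
  simp only [h1]
  rw [← tsum_subtype, Finset.tsum_subtype' (f := fun _ : ℤ => (1 : ℝ≥0∞))]
  simp only [Finset.sum_const, nsmul_eq_mul, mul_one, Int.card_Icc]
  rw [← ENNReal.ofReal_natCast]
  refine ENNReal.ofReal_le_ofReal ?_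
  have h2 : ((⌊b - y⌋ + 1 - ⌈a - y⌉ : ℤ) : ℝ) ≤ b - a + 1 := by
    push_cast
    linarith [Int.floor_le (b - y), Int.le_ceil (a - y)]
  rcases le_or_gt 0 (⌊b - y⌋ + 1 - ⌈a - y⌉) with h | h
  · have : (((⌊b - y⌋ + 1 - ⌈a - y⌉).toNat : ℤ) : ℝ) = ((⌊b - y⌋ + 1 - ⌈a - y⌉ : ℤ) : ℝ) := by
      rw [Int.toNat_of_nonneg h]
    rw [Int.cast_natCast] at this
    rw [this]; exact h2
  · rw [Int.toNat_of_nonpos h.le]; push_cast; linarith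

/-- The left side is the expected number of indices whose points lie in the interval. By Tonelli it
is an average of grid counts, so no moment of `μ` is needed. -/
theorem tsum_shiftLaw_Icc_le [IsProbabilityMeasure μ] {a b : ℝ} (hab : a ≤ b) :
    ∑' x : ℤ, shiftLaw μ x (Set.Icc a b) ≤ ENNReal.ofReal (b - a + 1) := by
  have h1 : ∀ x : ℤ, shiftLaw μ x (Set.Icc a b)
      = ∫⁻ y, (Set.Icc a b).indicator (1 : ℝ → ℝ≥0∞) (x + y) ∂μ := by
    intro x
    rw [← lintegral_indicator_one measurableSet_Icc, shiftLaw,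
      lintegral_map (measurable_one.indicator measurableSet_Icc) (by fun_prop)]
  simp only [h1]
  rw [← lintegral_tsum (f := fun (x : ℤ) (y : ℝ) =>
    (Set.Icc a b).indicator (1 : ℝ → ℝ≥0∞) (x + y)) fun x =>
      ((measurable_one.indicator measurableSet_Icc).comp
        (measurable_const_add (x : ℝ))).aemeasurable]
  refine (lintegral_mono fun y => tsum_indicator_Icc_le hab y).trans ?_
  simp

section Laws

variable {ν : ℤ → Measure ℝ} [∀ w, IsProbabilityMeasure (ν w)]

theorem map_pointsOf_insert {I : Set ℤ} {y : ℤ} (hy : y ∉ I) :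
    (Measure.infinitePi ν).map (pointsOf (insert y I))
      = ((Measure.infinitePi ν).prod (ν y)).map fun p => (pointsOf I p.1).add p.2 := by
  conv_lhs => rw [← map_update_infinitePi (ν := ν) y]
  rw [Measure.map_map (measurable_pointsOf _) (measurable_update_prod y)]
  congr 1
  ext1 p
  exact pointsOf_update_insert hy p.1 p.2

/-- Both configurations consist of the points outside `{x, y}` and one independent point, of law `ν
y` in one case and `ν x` in the other. -/
theorem map_pointsOf_compl_singleton_absolutelyContinuous {x y : ℤ} (h : ν y ≪ ν x) :
    (Measure.infinitePi ν).map (pointsOf {x}ᶜ) ≪ (Measure.infinitePi ν).map (pointsOf {y}ᶜ) := by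
  by_cases hxy : x = y
  · rw [hxy]
  have h1 : ({x}ᶜ : Set ℤ) = insert y {x, y}ᶜ := by
    ext w
    simp only [Set.mem_compl_iff, Set.mem_singleton_iff, Set.mem_insert_iff]
    by_cases hwy : w = y
    · subst hwy; simp [Ne.symm hxy]
    · simp [hwy]
  have h2 : ({y}ᶜ : Set ℤ) = insert x {x, y}ᶜ := by
    ext w
    simp only [Set.mem_compl_iff, Set.mem_singleton_iff, Set.mem_insert_iff]
    by_cases hwx : w = x
    · subst hwx; simp [hxy]
    · simp [hwx]
  rw [h1, h2, map_pointsOf_insert (by simp), map_pointsOf_insert (by simp)]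
  exact (Measure.AbsolutelyContinuous.rfl.prod h).map (measurable_pointsOf_add _)

/-- A hole at `x` can be noticed in the window only when the missing point would have landed there.
-/
theorem abs_holeProb_sub_le {n : ℕ} {A : Set PointSet}
    (hA : MeasurableSet[PointSet.windowSpace n] A) (x : ℤ) :
    |holeProb ν A x - (Measure.infinitePi ν).real {z | pointsOf Set.univ z ∈ A}|
      ≤ (ν x).real (Set.Icc (-n : ℝ) n) := by
  obtain ⟨A', -, rfl⟩ := hA
  have hE : (Measure.infinitePi ν).real {z | z x ∈ Set.Icc (-n : ℝ) n}
      = (ν x).real (Set.Icc (-n : ℝ) n) := by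
    rw [← Measure.infinitePi_map_eval ν x, map_measureReal_apply (measurable_pi_apply x)
      measurableSet_Icc]
    rfl
  have hsame : ∀ z : ℤ → ℝ, z x ∉ Set.Icc (-n : ℝ) n →
      (pointsOf {x}ᶜ z).inter (Set.Icc (-n : ℝ) n)
        = (pointsOf Set.univ z).inter (Set.Icc (-n : ℝ) n) := by
    intro z hz
    ext a
    simp only [PointSet.inter, pointsOf, Set.mem_inter_iff, Set.mem_image, Set.mem_univ, true_and]
    refine and_congr_left fun ha => ⟨fun ⟨w, _, h⟩ => ⟨w, h⟩, fun ⟨w, h⟩ => ⟨w, ?_, h⟩⟩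
    rintro rfl
    exact hz (h ▸ ha)
  have key : ∀ s t e : Set (ℤ → ℝ), s ⊆ t ∪ e → (Measure.infinitePi ν).real s
      ≤ (Measure.infinitePi ν).real t + (Measure.infinitePi ν).real e := fun s t e h =>
    (measureReal_mono h).trans (measureReal_union_le _ _)
  rw [← hE, holeProb, abs_sub_le_iff]
  constructor
  · rw [sub_le_iff_le_add, add_comm]
    refine key _ _ _ fun z hz => ?_
    by_cases h : z x ∈ Set.Icc (-n : ℝ) n
    · exact Or.inr h
    · refine Or.inl ?_
      simp only [Set.mem_ofPred_eq, Set.mem_preimage] at hz ⊢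
      rwa [← hsame z h]
  · rw [sub_le_iff_le_add, add_comm]
    refine key _ _ _ fun z hz => ?_
    by_cases h : z x ∈ Set.Icc (-n : ℝ) n
    · exact Or.inr h
    · refine Or.inl ?_
      simp only [Set.mem_ofPred_eq, Set.mem_preimage] at hz ⊢
      rwa [hsame z h]

/-- The law of the point set with a hole uniformly distributed in `{0, …, 2 ^ k - 1}`. -/
noncomputable def avgHoleLaw (ν : ℤ → Measure ℝ) (k : ℕ) : Measure PointSet :=
  ENNReal.ofReal ((2 : ℝ) ^ k)⁻¹ •
    ∑ x ∈ Finset.Ico (0 : ℤ) (2 ^ k), (Measure.infinitePi ν).map (pointsOf {x}ᶜ)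

theorem avgHoleLaw_real (k : ℕ) {A : Set PointSet} (hA : MeasurableSet A) :
    (avgHoleLaw ν k).real A
      = ((2 : ℝ) ^ k)⁻¹ * ∑ x ∈ Finset.Ico (0 : ℤ) (2 ^ k), holeProb ν A x := by
  rw [avgHoleLaw, measureReal_ennreal_smul_apply, ENNReal.toReal_ofReal (by positivity)]
  congr 1
  rw [measureReal_def, Measure.finsetSum_apply, ENNReal.toReal_sum]
  · refine Finset.sum_congr rfl fun x _ => ?_
    rw [Measure.map_apply (measurable_pointsOf _) hA]
    rfl
  · intro x _
    rw [Measure.map_apply (measurable_pointsOf _) hA]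
    exact measure_ne_top _ _

theorem card_Ico_two_pow (k : ℕ) : ((Finset.Ico (0 : ℤ) (2 ^ k)).card : ℝ) = 2 ^ k := by
  rw [Int.card_Ico, sub_zero]
  have : ((2 : ℤ) ^ k).toNat = 2 ^ k := by
    rw [Int.toNat_pow_of_nonneg (by norm_num)]; rfl
  rw [this]; push_cast; rfl

instance (k : ℕ) : IsProbabilityMeasure (avgHoleLaw ν k) := by
  have h1 : (avgHoleLaw ν k).real Set.univ = 1 := by
    rw [avgHoleLaw_real k MeasurableSet.univ]
    simp only [holeProb, Set.mem_univ, Set.ofPred_true, probReal_univ, Finset.sum_const,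
      nsmul_eq_mul, mul_one, card_Ico_two_pow]
    field_simp
  refine ⟨?_⟩
  rw [measureReal_def] at h1
  rwa [ENNReal.toReal_eq_one_iff] at h1

/-- Summed over all holes, the errors are at most the expected count in the window, a constant `K`;
averaging over `2^k` holes leaves `K / 2^k`. -/
theorem tendsto_avgHoleLaw_of_window
    (hν : ∀ n : ℕ, ∑' x, ν x (Set.Icc (-n : ℝ) n) ≠ ∞) {n : ℕ} {A : Set PointSet}
    (hA : MeasurableSet[PointSet.windowSpace n] A) :
    Tendsto (fun k => (avgHoleLaw ν k).real A) atTop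
      (𝓝 (((Measure.infinitePi ν).map (pointsOf Set.univ)).real A)) := by
  have hA' := PointSet.windowSpace_le n A hA
  rw [tendsto_iff_dist_tendsto_zero]
  set K := (∑' x, ν x (Set.Icc (-n : ℝ) n)).toReal with hK
  have hbound : ∀ k, dist ((avgHoleLaw ν k).real A)
      (((Measure.infinitePi ν).map (pointsOf Set.univ)).real A) ≤ ((2 : ℝ) ^ k)⁻¹ * K := by
    intro k
    rw [Real.dist_eq, avgHoleLaw_real k hA', map_measureReal_apply (measurable_pointsOf _) hA']
    set q := (Measure.infinitePi ν).real (pointsOf Set.univ ⁻¹' A) with hq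
    have : ((2 : ℝ) ^ k)⁻¹ * ∑ x ∈ Finset.Ico (0 : ℤ) (2 ^ k), holeProb ν A x - q
        = ((2 : ℝ) ^ k)⁻¹ * ∑ x ∈ Finset.Ico (0 : ℤ) (2 ^ k), (holeProb ν A x - q) := by
      rw [Finset.sum_sub_distrib, Finset.sum_const, nsmul_eq_mul, card_Ico_two_pow]
      field_simp
    rw [this, abs_mul, abs_of_pos (by positivity)]
    refine mul_le_mul_of_nonneg_left ?_ (by positivity)
    refine (Finset.abs_sum_le_sum_abs _ _).trans ?_
    refine (Finset.sum_le_sum fun x _ => abs_holeProb_sub_le hA x).trans ?_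
    simp only [measureReal_def]
    rw [← ENNReal.toReal_sum fun x _ => measure_ne_top _ _]
    exact ENNReal.toReal_mono (hν n) (ENNReal.sum_le_tsum _)
  refine squeeze_zero (fun _ => dist_nonneg) hbound ?_
  have h2 : Tendsto (fun k : ℕ => ((2 : ℝ) ^ k)⁻¹) atTop (𝓝 0) :=
    tendsto_inv_atTop_zero.comp (tendsto_pow_atTop_atTop_of_one_lt one_lt_two)
  simpa using h2.mul_const K

theorem tendsto_avgHoleLaw (hν : ∀ n : ℕ, ∑' x, ν x (Set.Icc (-n : ℝ) n) ≠ ∞)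
    {b : ℕ → ℝ} (hb : Summable b)
    (hstep : ∀ k A, MeasurableSet A →
      |(avgHoleLaw ν k).real A - (avgHoleLaw ν (k + 1)).real A| ≤ b k)
    {A : Set PointSet} (hA : MeasurableSet A) :
    Tendsto (fun k => (avgHoleLaw ν k).real A) atTop
      (𝓝 (((Measure.infinitePi ν).map (pointsOf Set.univ)).real A)) := by
  have : IsProbabilityMeasure ((Measure.infinitePi ν).map (pointsOf Set.univ)) :=
    Measure.isProbabilityMeasure_map (measurable_pointsOf _).aemeasurable
  refine tendsto_measureReal_of_summable hb hstep
    (C := {A | ∃ n, MeasurableSet[PointSet.windowSpace n] A}) ?_ ?_ ?_ hA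
  · rw [← PointSet.iSup_windowSpace, MeasurableSpace.measurableSpace_iSup_eq]
  · rintro s ⟨m, hs⟩ t ⟨n, ht⟩ -
    exact ⟨max m n, MeasurableSet.inter
      (PointSet.monotone_windowSpace (le_max_left m n) s hs)
      (PointSet.monotone_windowSpace (le_max_right m n) t ht)⟩
  · rintro A ⟨n, hA⟩
    exact tendsto_avgHoleLaw_of_window hν hA

end Laws

section Translation

variable [IsProbabilityMeasure μ]

/-- Moving every point by `m` and relabelling `w` as `w + m` preserves the law of the labelled
family, so a translation acts in law by shifting the set of retained indices. -/
theorem map_pointsOf_translate (I : Set ℤ) (m : ℤ) :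
    ((Measure.infinitePi (shiftLaw μ)).map (pointsOf I)).map (PointSet.translate m)
      = (Measure.infinitePi (shiftLaw μ)).map (pointsOf ((fun w => w + m) '' I)) := by
  have h1 : (Measure.infinitePi (shiftLaw μ)).map (fun z w => z (w - m) + (m : ℝ))
      = Measure.infinitePi (shiftLaw μ) := by
    have e1 := Measure.map_infinitePi_infinitePi_of_inj (P := shiftLaw μ)
      (f := fun w : ℤ => w - m) (sub_left_injective)
    have e2 := Measure.infinitePi_map_pi (μ := fun w => shiftLaw μ (w - m))
      (f := fun _ a => a + (m : ℝ)) (fun _ => by fun_prop)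
    rw [← e1, Measure.map_map (by fun_prop) (by fun_prop)] at e2
    have e3 : ∀ w : ℤ, (shiftLaw μ (w - m)).map (fun a => a + (m : ℝ)) = shiftLaw μ w := by
      intro w
      rw [shiftLaw, shiftLaw, Measure.map_map (by fun_prop) (by fun_prop)]
      congr 1
      ext y
      simp only [Function.comp_apply]
      push_cast; ring
    simp only [e3] at e2
    exact e2
  conv_rhs => rw [← h1]
  rw [Measure.map_map (PointSet.measurable_translate _) (measurable_pointsOf _),
    Measure.map_map (measurable_pointsOf _) (by fun_prop)]
  congr 1
  ext z a
  simp only [Function.comp_apply, PointSet.translate, pointsOf, Set.image_image]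
  simp

/-- If the laws with a random hole in a growing window converge setwise to the law without a hole,
then the law with the hole at `0` is absolutely continuous. -/
theorem hole_absolutelyContinuous
    (h : ∀ A, MeasurableSet A → Tendsto (fun k => (avgHoleLaw (shiftLaw μ) k).real A) atTop
      (𝓝 (((Measure.infinitePi (shiftLaw μ)).map (pointsOf Set.univ)).real A))) :
    (Measure.infinitePi (shiftLaw μ)).map (pointsOf {0}ᶜ)
      ≪ (Measure.infinitePi (shiftLaw μ)).map (pointsOf Set.univ) := by
  refine Measure.AbsolutelyContinuous.mk fun A hA hA0 => ?_
  -- The saturation is still null for the full lattice, whose law is invariant, and being invariant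
  -- itself it cannot distinguish holes at different positions. The averaged probabilities are
  -- therefore constant in `k`.
  set A' : Set PointSet := ⋃ m : ℤ, PointSet.translate m ⁻¹' A with hA'
  have hA'm : MeasurableSet A' :=
    MeasurableSet.iUnion fun m => PointSet.measurable_translate m hA
  have hinv : ∀ x : ℤ, PointSet.translate x ⁻¹' A' = A' := by
    intro x
    have hcomp : ∀ m : ℤ, PointSet.translate x ⁻¹' (PointSet.translate m ⁻¹' A)
        = PointSet.translate ((m + x : ℤ) : ℝ) ⁻¹' A := by
      intro m
      ext S
      have : (S.translate x).translate m = S.translate ((m + x : ℤ) : ℝ) := by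
        ext a
        simp only [PointSet.translate, Set.image_image]
        push_cast
        simp only [add_assoc, add_comm (x : ℝ) (m : ℝ)]
      simp only [Set.mem_preimage, this]
    rw [hA', Set.preimage_iUnion]
    simp only [hcomp]
    exact (Equiv.addRight x).surjective.iUnion_comp
      (fun m : ℤ => PointSet.translate (m : ℝ) ⁻¹' A)
  have hQ : (Measure.infinitePi (shiftLaw μ)).map (pointsOf Set.univ) A' = 0 := by
    refine measure_iUnion_null fun m => ?_
    rw [← Measure.map_apply (PointSet.measurable_translate m) hA, map_pointsOf_translate]
    have : (fun w => w + m) '' (Set.univ : Set ℤ) = Set.univ :=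
      Set.image_univ_of_surjective (Equiv.addRight m).surjective
    rwa [this]
  have hhole : ∀ x : ℤ, holeProb (shiftLaw μ) A' x
      = ((Measure.infinitePi (shiftLaw μ)).map (pointsOf {0}ᶜ)).real A' := by
    intro x
    have h1 := map_pointsOf_translate (μ := μ) {0}ᶜ x
    have h2 : (fun w => w + x) '' ({0}ᶜ : Set ℤ) = {x}ᶜ :=
      (Set.image_compl_eq (Equiv.addRight x).bijective).trans (by simp)
    rw [h2] at h1
    rw [holeProb]
    change (Measure.infinitePi (shiftLaw μ)).real (pointsOf {x}ᶜ ⁻¹' A') = _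
    rw [← map_measureReal_apply (measurable_pointsOf _) hA'm, ← h1,
      map_measureReal_apply (PointSet.measurable_translate _) hA'm, hinv]
  have h0 := h A' hA'm
  have hconst : ∀ k, (avgHoleLaw (shiftLaw μ) k).real A'
      = ((Measure.infinitePi (shiftLaw μ)).map (pointsOf {0}ᶜ)).real A' := by
    intro k
    rw [avgHoleLaw_real k hA'm]
    simp only [hhole, Finset.sum_const, nsmul_eq_mul, card_Ico_two_pow]
    field_simp
  simp only [hconst] at h0
  have h3 := tendsto_nhds_unique tendsto_const_nhds h0
  rw [measureReal_def, measureReal_def, hQ, ENNReal.toReal_zero] at h3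
  have : IsProbabilityMeasure ((Measure.infinitePi (shiftLaw μ)).map (pointsOf {0}ᶜ)) :=
    Measure.isProbabilityMeasure_map (measurable_pointsOf _).aemeasurable
  have h4 := (ENNReal.toReal_eq_zero_iff _).1 h3
  refine measure_mono_null ?_ (h4.resolve_right (measure_ne_top _ _))
  intro S hS
  refine Set.mem_iUnion.2 ⟨0, ?_⟩
  have : S.translate ((0 : ℤ) : ℝ) = S := by
    ext a; simp [PointSet.translate]
  rwa [Set.mem_preimage, this]

/-- An event that is null for the hole at `0` is null for every other hole by exchanging one point,
hence for all averages and for their limit. -/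
theorem absolutelyContinuous_hole (hμ : ∀ x, shiftLaw μ 0 ≪ shiftLaw μ x)
    (h : ∀ A, MeasurableSet A → Tendsto (fun k => (avgHoleLaw (shiftLaw μ) k).real A) atTop
      (𝓝 (((Measure.infinitePi (shiftLaw μ)).map (pointsOf Set.univ)).real A))) :
    (Measure.infinitePi (shiftLaw μ)).map (pointsOf Set.univ)
      ≪ (Measure.infinitePi (shiftLaw μ)).map (pointsOf {0}ᶜ) := by
  refine Measure.AbsolutelyContinuous.mk fun A hA hA0 => ?_
  have hx : ∀ x, holeProb (shiftLaw μ) A x = 0 := by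
    intro x
    have := map_pointsOf_compl_singleton_absolutelyContinuous (hμ x) hA0
    rw [Measure.map_apply (measurable_pointsOf _) hA] at this
    exact (ENNReal.toReal_eq_zero_iff _).2 (Or.inl this)
  have h0 := h A hA
  simp only [avgHoleLaw_real _ hA, hx, Finset.sum_const_zero, mul_zero] at h0
  have h3 := tendsto_nhds_unique tendsto_const_nhds h0
  have : IsProbabilityMeasure ((Measure.infinitePi (shiftLaw μ)).map (pointsOf Set.univ)) :=
    Measure.isProbabilityMeasure_map (measurable_pointsOf _).aemeasurable
  exact ((ENNReal.toReal_eq_zero_iff _).1 h3.symm).resolve_right (measure_ne_top _ _)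

end Translation

end Lattice

/-! ### Summable increments from a lower bound on the density. -/

section HeavyTails

open Filter Topology

variable {μ : Measure ℝ}

/-- For `0 ≤ w ≤ M` the displacement from `w` to a point of `[0, M]` lies in `[-M, M]`. All these
indices thus share a common uniform component on `[0, M]`. -/
theorem smul_restrict_le_shiftLaw {a : ℝ≥0∞} {M : ℝ}
    (hlow : a • (volume.restrict (Set.Icc (-M) M)) ≤ μ) {w : ℤ} (hw0 : 0 ≤ w) (hwM : (w : ℝ) ≤ M) :
    a • (volume.restrict (Set.Icc 0 M)) ≤ shiftLaw μ w := by
  have hw0' : (0 : ℝ) ≤ w := by exact_mod_cast hw0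
  refine Measure.le_iff.2 fun B hB => ?_
  have hm : Measurable fun y : ℝ => (w : ℝ) + y := by fun_prop
  rw [shiftLaw, Measure.map_apply hm hB]
  refine le_trans ?_ (hlow _)
  simp only [Measure.smul_apply, smul_eq_mul]
  gcongr a * ?_
  rw [Measure.restrict_apply hB, Measure.restrict_apply (hm hB),
    ← measure_preimage_add volume (w : ℝ) (B ∩ Set.Icc 0 M)]
  refine measure_mono fun y hy => ⟨hy.1, ?_⟩
  have h1 := hy.2.1
  have h2 := hy.2.2
  exact ⟨by linarith, by linarith⟩

/-- With `M = 2^(k+1)` the uniform law on `[0, M]` is a component of weight `p = c M^(-α)`, and `(p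
M)⁻¹ = c⁻¹ M^(α-1)` is the geometric term in the bound. -/
theorem abs_avgHoleLaw_sub_le [IsProbabilityMeasure μ] {α c : ℝ} (hc : 0 < c)
    (hlow : ∀ M : ℝ, 1 ≤ M →
      ENNReal.ofReal (c * M ^ (-1 - α)) • (volume.restrict (Set.Icc (-M) M)) ≤ μ)
    (k : ℕ) {A : Set PointSet} (hA : MeasurableSet A) :
    |(avgHoleLaw (shiftLaw μ) k).real A - (avgHoleLaw (shiftLaw μ) (k + 1)).real A|
      ≤ 2 * √(c⁻¹ * ((2 : ℝ) ^ (α - 1)) ^ (k + 1)) + 2 * (c⁻¹ * ((2 : ℝ) ^ (α - 1)) ^ (k + 1)) := by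
  set M : ℝ := 2 ^ (k + 1) with hM
  have hM0 : 0 < M := by positivity
  have hM1 : 1 ≤ M := one_le_pow₀ one_le_two
  set p : ℝ := c * M ^ (-α) with hp
  have hp0 : 0 < p := by positivity
  set u : Measure ℝ := ENNReal.ofReal M⁻¹ • volume.restrict (Set.Icc 0 M) with hu
  have hu1 : IsProbabilityMeasure u := by
    refine ⟨?_⟩
    simp only [hu, Measure.smul_apply, Measure.restrict_apply_univ, Real.volume_Icc, sub_zero,
      smul_eq_mul]
    rw [← ENNReal.ofReal_mul (by positivity), inv_mul_cancel₀ hM0.ne', ENNReal.ofReal_one]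
  have hpu : ENNReal.ofReal p • u
      = ENNReal.ofReal (c * M ^ (-1 - α)) • volume.restrict (Set.Icc 0 M) := by
    rw [hu, smul_smul, ← ENNReal.ofReal_mul hp0.le]
    congr 2
    rw [hp, mul_assoc, ← Real.rpow_neg_one M, ← Real.rpow_add hM0]
    congr 2
    ring
  have hη : (p * (2 * 2 ^ k))⁻¹ = c⁻¹ * ((2 : ℝ) ^ (α - 1)) ^ (k + 1) := by
    have h1 : (2 : ℝ) * 2 ^ k = M := by rw [hM, pow_succ]; ring
    have h2 : ((2 : ℝ) ^ (α - 1)) ^ (k + 1) = M ^ (α - 1) := by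
      rw [hM, ← Real.rpow_natCast, ← Real.rpow_natCast, ← Real.rpow_mul two_pos.le,
        ← Real.rpow_mul two_pos.le, mul_comm]
    rw [h1, h2, hp, mul_assoc, mul_inv]
    congr 1
    conv_lhs => rw [← Real.rpow_one M, ← Real.rpow_mul hM0.le, one_mul, ← Real.rpow_add hM0]
    rw [← Real.rpow_neg hM0.le]
    congr 1
    ring
  have key := abs_average_holeProb_sub_le (ν := shiftLaw μ) (u := u) hp0
    (W := Finset.Ico 0 (2 ^ (k + 1))) (W₀ := Finset.Ico 0 (2 ^ k))
    (Finset.Ico_subset_Ico_right (pow_le_pow_right₀ one_le_two (Nat.le_succ k)))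
    (N := 2 ^ k) (by positivity) (card_Ico_two_pow k)
    (by rw [card_Ico_two_pow (k + 1), pow_succ]; ring)
    (fun w hw => by
      rw [hpu]
      rw [Finset.mem_Ico] at hw
      refine smul_restrict_le_shiftLaw (hlow M hM1) hw.1 ?_
      rw [hM]
      exact_mod_cast hw.2.le) hA
  rw [hη] at key
  rw [avgHoleLaw_real k hA, avgHoleLaw_real (k + 1) hA]
  have : ((2 : ℝ) ^ (k + 1))⁻¹ = (2 * 2 ^ k)⁻¹ := by rw [pow_succ]; ring
  rw [this]
  exact key

/-- The assumption `α < 1` makes the ratio `2^(α-1)`, and hence its square root, less than `1`, so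
the increments are summable. -/
theorem tendsto_avgHoleLaw_of_heavyTail [IsProbabilityMeasure μ] {α c : ℝ} (hα : α < 1) (hc : 0 < c)
    (hlow : ∀ M : ℝ, 1 ≤ M →
      ENNReal.ofReal (c * M ^ (-1 - α)) • (volume.restrict (Set.Icc (-M) M)) ≤ μ)
    {A : Set PointSet} (hA : MeasurableSet A) :
    Tendsto (fun k => (avgHoleLaw (shiftLaw μ) k).real A) atTop
      (𝓝 (((Measure.infinitePi (shiftLaw μ)).map (pointsOf Set.univ)).real A)) := by
  set r : ℝ := 2 ^ (α - 1) with hr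
  have hr0 : 0 ≤ r := by positivity
  have hr1 : r < 1 := Real.rpow_lt_one_of_one_lt_of_neg one_lt_two (by linarith)
  have hsr : ∀ k : ℕ, √(c⁻¹ * r ^ (k + 1)) = √c⁻¹ * √r * √r ^ k := by
    intro k
    rw [Real.sqrt_mul (by positivity), mul_assoc, ← pow_succ']
    congr 1
    rw [Real.sqrt_eq_iff_mul_self_eq (by positivity) (by positivity), ← mul_pow,
      Real.mul_self_sqrt hr0]
  refine tendsto_avgHoleLaw ?_ (b := fun k => 2 * √(c⁻¹ * r ^ (k + 1)) + 2 * (c⁻¹ * r ^ (k + 1)))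
    ?_ (fun k A hA => abs_avgHoleLaw_sub_le hc hlow k hA) hA
  · intro n
    exact ne_top_of_le_ne_top ENNReal.ofReal_ne_top
      (tsum_shiftLaw_Icc_le (by linarith [(Nat.cast_nonneg n : (0 : ℝ) ≤ n)]))
  · refine Summable.add (Summable.mul_left _ ?_) (Summable.mul_left _ (Summable.mul_left _ ?_))
    · simp only [hsr]
      refine (summable_geometric_of_lt_one (Real.sqrt_nonneg _) ?_).mul_left _
      rw [Real.sqrt_lt' one_pos]; simpa using hr1
    · exact (summable_nat_add_iff 1).2 (summable_geometric_of_lt_one hr0 hr1)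

theorem volume_absolutelyContinuous_of_heavyTail {α c : ℝ} (hc : 0 < c)
    (hlow : ∀ M : ℝ, 1 ≤ M →
      ENNReal.ofReal (c * M ^ (-1 - α)) • (volume.restrict (Set.Icc (-M) M)) ≤ μ) :
    volume ≪ μ := by
  refine Measure.AbsolutelyContinuous.mk fun B hB h0 => ?_
  have h1 : ∀ n : ℕ, volume (B ∩ Set.Icc (-((n : ℝ) + 1)) (n + 1)) = 0 := by
    intro n
    have hn : (1 : ℝ) ≤ n + 1 := by linarith [(Nat.cast_nonneg n : (0 : ℝ) ≤ n)]
    have h2 := (hlow (n + 1) hn B).trans_eq h0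
    simp only [Measure.smul_apply, smul_eq_mul, Measure.restrict_apply hB, nonpos_iff_eq_zero,
      mul_eq_zero, ENNReal.ofReal_eq_zero] at h2
    refine h2.resolve_left (not_le.2 ?_)
    positivity
  have h2 : B = ⋃ n : ℕ, B ∩ Set.Icc (-((n : ℝ) + 1)) (n + 1) := by
    ext z
    simp only [Set.mem_iUnion, Set.mem_inter_iff, Set.mem_Icc]
    obtain ⟨n, hn⟩ := exists_nat_ge |z|
    have := abs_le.1 hn
    exact ⟨fun h => ⟨n, h, by linarith, by linarith⟩, fun ⟨_, h, _⟩ => h⟩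
  rw [h2]
  exact measure_iUnion_null h1

theorem shiftLaw_absolutelyContinuous_volume (h : μ ≪ volume) (w : ℤ) :
    shiftLaw μ w ≪ volume := by
  have := h.map (f := fun y : ℝ => (w : ℝ) + y) (by fun_prop)
  rwa [map_add_left_eq_self volume] at this

theorem volume_absolutelyContinuous_shiftLaw (h : volume ≪ μ) (w : ℤ) :
    volume ≪ shiftLaw μ w := by
  have := h.map (f := fun y : ℝ => (w : ℝ) + y) (by fun_prop)
  rwa [map_add_left_eq_self volume] at this

end HeavyTails

/-! ### The tent function as the characteristic function of the Fejér law. -/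

section Fejer

open Filter Topology Real FourierTransform

/-- The tent function `max 0 (1 - |v|)`. -/
noncomputable def tent (v : ℝ) : ℝ := max 0 (1 - |v|)

theorem continuous_tent : Continuous tent := by unfold tent; fun_prop

theorem tent_nonneg (v : ℝ) : 0 ≤ tent v := le_max_left _ _

theorem tent_le_one (v : ℝ) : tent v ≤ 1 := max_le zero_le_one (by linarith [abs_nonneg v])

theorem tent_eq_zero {v : ℝ} (hv : 1 ≤ |v|) : tent v = 0 := max_eq_left (by linarith)

theorem integrable_tent : Integrable tent :=
  continuous_tent.integrable_of_hasCompactSupport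
    (HasCompactSupport.intro (K := Set.Icc (-1) 1) isCompact_Icc fun v hv => tent_eq_zero (by
      by_contra h
      exact hv (abs_le.1 (not_le.1 h).le)))

theorem intervalIntegral_one_sub_mul_cexp {a : ℂ} (ha : a ≠ 0) :
    ∫ v in (0 : ℝ)..1, (1 - (v : ℂ)) * Complex.exp (a * v)
      = Complex.exp a / a ^ 2 - 1 / a - 1 / a ^ 2 := by
  have hderiv : ∀ v : ℝ, HasDerivAt
      (fun v : ℝ => (1 - (v : ℂ)) * Complex.exp (a * v) / a + Complex.exp (a * v) / a ^ 2)
      ((1 - (v : ℂ)) * Complex.exp (a * v)) v := by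
    intro v
    have h1 : HasDerivAt (fun v : ℝ => (v : ℂ)) 1 v := (hasDerivAt_id v).ofReal_comp
    have h2 : HasDerivAt (fun v : ℝ => Complex.exp (a * v)) (Complex.exp (a * v) * (a * 1)) v :=
      (h1.const_mul a).cexp
    have h3 := (((h1.const_sub 1).mul h2).div_const a).add (h2.div_const (a ^ 2))
    refine h3.congr_deriv ?_
    field_simp
    ring
  rw [intervalIntegral.integral_eq_sub_of_hasDerivAt (fun v _ => hderiv v)
    ((by fun_prop : Continuous fun v : ℝ => (1 - (v : ℂ)) * Complex.exp (a * v)).intervalIntegrable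
      _ _)]
  simp
  ring

theorem fourier_tent {ξ : ℝ} (hξ : ξ ≠ 0) :
    𝓕 (fun v => (tent v : ℂ)) ξ = ((sinc (π * ξ) ^ 2 : ℝ) : ℂ) := by
  set a : ℂ := -2 * π * ξ * Complex.I with ha
  have ha0 : a ≠ 0 := by
    simp [ha, hξ, pi_ne_zero]
  have hF : 𝓕 (fun v => (tent v : ℂ)) ξ = ∫ v : ℝ, (tent v : ℂ) * Complex.exp (a * v) := by
    rw [Real.fourier_eq']
    congr 1
    ext v
    simp only [smul_eq_mul, RCLike.inner_apply, conj_trivial]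
    rw [mul_comm]
    congr 2
    rw [ha]; push_cast; ring
  have hsupp : ∫ v : ℝ, (tent v : ℂ) * Complex.exp (a * v)
      = ∫ v in (-1 : ℝ)..1, (tent v : ℂ) * Complex.exp (a * v) := by
    rw [intervalIntegral.integral_of_le (by norm_num)]
    refine (setIntegral_eq_integral_of_forall_compl_eq_zero fun v hv => ?_).symm
    rw [tent_eq_zero, Complex.ofReal_zero, zero_mul]
    by_contra h
    have := abs_lt.1 (not_le.1 h)
    exact hv ⟨this.1, this.2.le⟩
  have hcont : Continuous fun v : ℝ => (tent v : ℂ) * Complex.exp (a * v) := by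
    have := continuous_tent
    fun_prop
  have hpos : ∫ v in (0 : ℝ)..1, (tent v : ℂ) * Complex.exp (a * v)
      = ∫ v in (0 : ℝ)..1, (1 - (v : ℂ)) * Complex.exp (a * v) := by
    refine intervalIntegral.integral_congr fun v hv => ?_
    rw [Set.uIcc_of_le zero_le_one] at hv
    simp only [tent, abs_of_nonneg hv.1, max_eq_right (sub_nonneg.2 hv.2)]
    push_cast; rfl
  have hneg : ∫ v in (-1 : ℝ)..0, (tent v : ℂ) * Complex.exp (a * v)
      = ∫ v in (0 : ℝ)..1, (1 - (v : ℂ)) * Complex.exp (-a * v) := by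
    have h1 := intervalIntegral.integral_comp_neg (a := 0) (b := 1)
      (fun v : ℝ => (tent v : ℂ) * Complex.exp (a * v))
    rw [neg_zero] at h1
    rw [← h1]
    refine intervalIntegral.integral_congr fun v hv => ?_
    rw [Set.uIcc_of_le zero_le_one] at hv
    simp only [tent, abs_neg, abs_of_nonneg hv.1, max_eq_right (sub_nonneg.2 hv.2)]
    push_cast
    rw [mul_neg, neg_mul]
  rw [hF, hsupp, ← intervalIntegral.integral_add_adjacent_intervals
    (hcont.intervalIntegrable (-1) 0) (hcont.intervalIntegrable 0 1), hpos, hneg,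
    intervalIntegral_one_sub_mul_cexp ha0, intervalIntegral_one_sub_mul_cexp (neg_ne_zero.2 ha0)]
  have hπξ : π * ξ ≠ 0 := mul_ne_zero pi_ne_zero hξ
  rw [sinc_of_ne_zero hπξ]
  have hsum : Complex.exp a + Complex.exp (-a) = 2 - 4 * (Real.sin (π * ξ) : ℂ) ^ 2 := by
    have h1 : a = -((2 * (π * ξ) : ℂ)) * Complex.I := by rw [ha]; ring
    have h2 := Complex.two_cos (2 * (π * ξ) : ℂ)
    rw [h1, neg_mul, neg_neg, ← neg_mul, add_comm, ← h2, Complex.cos_two_mul, Complex.cos_sq']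
    push_cast
    ring
  have ha2 : a ^ 2 = -(4 * (π * ξ : ℂ) ^ 2) := by
    rw [ha, mul_pow, Complex.I_sq]; ring
  have hπξ' : (π * ξ : ℂ) ≠ 0 := by exact_mod_cast hπξ
  have : Complex.exp (-a) / (-a) ^ 2 - 1 / -a - 1 / (-a) ^ 2
      + (Complex.exp a / a ^ 2 - 1 / a - 1 / a ^ 2)
      = ((Complex.exp a + Complex.exp (-a)) - 2) / a ^ 2 := by
    field_simp; ring
  rw [this, hsum, ha2]
  push_cast
  field_simp
  ring

theorem sinc_sq_le (ξ : ℝ) : sinc (π * ξ) ^ 2 ≤ 2 * (1 + ξ ^ 2)⁻¹ := by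
  have h1 : sinc (π * ξ) ^ 2 ≤ 1 := (sq_le_one_iff_abs_le_one _).2 (abs_le.2
    ⟨neg_one_le_sinc _, sinc_le_one _⟩)
  rw [← div_eq_mul_inv, le_div_iff₀ (by positivity)]
  rcases eq_or_ne ξ 0 with rfl | hξ
  · simp
  have hπξ : π * ξ ≠ 0 := mul_ne_zero pi_ne_zero hξ
  have h2 : sinc (π * ξ) ^ 2 * ξ ^ 2 ≤ 1 := by
    rw [sinc_of_ne_zero hπξ, div_pow, div_mul_eq_mul_div, div_le_one (by positivity), mul_pow]
    have h3 := sin_sq_le_one (π * ξ)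
    have h4 : 1 ≤ π ^ 2 := by nlinarith [pi_gt_three]
    have h5 : 0 ≤ ξ ^ 2 := sq_nonneg ξ
    nlinarith [mul_le_mul_of_nonneg_right h3 h5, mul_le_mul_of_nonneg_right h4 h5]
  linarith

theorem measurable_sinc_sq : Measurable fun ξ : ℝ => sinc (π * ξ) ^ 2 :=
  ((continuous_sinc.comp (continuous_const_mul π)).pow 2).measurable

theorem integrable_sinc_sq : Integrable fun ξ : ℝ => sinc (π * ξ) ^ 2 := by
  refine (integrable_inv_one_add_sq.const_mul 2).mono'
    measurable_sinc_sq.aestronglyMeasurable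
    (Eventually.of_forall fun ξ => ?_)
  rw [norm_of_nonneg (sq_nonneg _)]
  exact sinc_sq_le ξ

/-- Fourier inversion for the tent: it is continuous and integrable, and its transform is almost
everywhere the integrable function `sinc²`. The frequency `0`, where the explicit formula would
divide by zero, is negligible. -/
theorem integral_sinc_sq_mul_cexp (t : ℝ) :
    ∫ ξ : ℝ, ((sinc (π * ξ) ^ 2 : ℝ) : ℂ) * Complex.exp ((2 * π * (t * ξ) : ℝ) * Complex.I)
      = tent t := by
  have hae : 𝓕 (fun v => (tent v : ℂ)) =ᵐ[volume] fun ξ => ((sinc (π * ξ) ^ 2 : ℝ) : ℂ) := by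
    filter_upwards [(measure_singleton (0 : ℝ) : volume {(0 : ℝ)} = 0) |> compl_mem_ae_iff.2]
      with ξ hξ
    exact fourier_tent hξ
  have hint : Integrable (𝓕 (fun v => (tent v : ℂ))) :=
    integrable_sinc_sq.ofReal.congr hae.symm
  have hinv := congrFun ((Complex.continuous_ofReal.comp continuous_tent).fourierInv_fourier_eq
    integrable_tent.ofReal hint) t
  rw [Function.comp_apply] at hinv
  rw [← hinv, Real.fourierInv_eq']
  refine integral_congr_ae ?_
  filter_upwards [hae] with ξ hξ
  rw [← hξ, smul_eq_mul, mul_comm]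
  congr 2

/-- The Fejér law, with density `sinc (π ξ) ^ 2`. -/
noncomputable def fejerMeasure : Measure ℝ :=
  volume.withDensity fun ξ => ENNReal.ofReal (sinc (π * ξ) ^ 2)

theorem integral_cexp_fejerMeasure (t : ℝ) :
    ∫ ξ, Complex.exp ((2 * π * (t * ξ) : ℝ) * Complex.I) ∂fejerMeasure = tent t := by
  rw [fejerMeasure, integral_withDensity_eq_integral_toReal_smul
    measurable_sinc_sq.ennreal_ofReal (by simp),
    ← integral_sinc_sq_mul_cexp]
  congr 1
  ext ξ
  rw [ENNReal.toReal_ofReal (sq_nonneg _), Complex.real_smul]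

instance : IsProbabilityMeasure fejerMeasure := by
  refine ⟨?_⟩
  have h1 := integral_sinc_sq_mul_cexp 0
  simp only [zero_mul, mul_zero, Complex.ofReal_zero, Complex.exp_zero, mul_one] at h1
  rw [integral_complex_ofReal] at h1
  have h2 : ∫ ξ : ℝ, sinc (π * ξ) ^ 2 = 1 := by
    have : tent 0 = 1 := by simp [tent]
    rw [this] at h1
    exact_mod_cast h1
  rw [fejerMeasure, withDensity_apply _ MeasurableSet.univ, Measure.restrict_univ,
    ← ofReal_integral_eq_lintegral_ofReal integrable_sinc_sq
      (Eventually.of_forall fun _ => sq_nonneg _), h2, ENNReal.ofReal_one]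

/-- Jordan's inequality `sin x ≥ 2x/π` on `[0, π/2]` gives `sinc (π ξ) ≥ 2/π` for `|ξ| ≤ 1/2`. -/
theorem le_fejerMeasure {B : Set ℝ} (hB : MeasurableSet B) (hB2 : ∀ ξ ∈ B, |ξ| ≤ 1 / 2) :
    ENNReal.ofReal (4 / π ^ 2) * volume B ≤ fejerMeasure B := by
  rw [fejerMeasure, withDensity_apply _ hB, ← setLIntegral_const]
  refine setLIntegral_mono' hB fun ξ hξ => ENNReal.ofReal_le_ofReal ?_
  rcases eq_or_ne ξ 0 with rfl | h0
  · rw [mul_zero, sinc_zero, one_pow, div_le_one (by positivity)]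
    nlinarith [pi_gt_three]
  have h1 : 0 < |ξ| := abs_pos.2 h0
  have h2 : 2 / π * (π * |ξ|) ≤ sin (π * |ξ|) := by
    refine mul_le_sin (by positivity) ?_
    nlinarith [hB2 ξ hξ, pi_pos]
  have h3 : sinc (π * ξ) = sinc (π * |ξ|) := by
    rcases abs_choice ξ with h | h <;> rw [h]
    rw [mul_neg, sinc_neg]
  have h4 : 2 / π ≤ sinc (π * |ξ|) := by
    rw [sinc_of_ne_zero (by positivity), le_div_iff₀ (by positivity)]
    exact h2
  rw [h3]
  calc 4 / π ^ 2 = (2 / π) ^ 2 := by ring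
    _ ≤ _ := pow_le_pow_left₀ (by positivity) h4 2

end Fejer

/-! ### Pólya representation and density bounds for `α < 1`. -/

section StableDensity

open Filter Topology Real

/-- The second derivative of `s ↦ exp (-c s ^ α)` on `(0, ∞)`. -/
noncomputable def stableConvexity (c α s : ℝ) : ℝ :=
  (c ^ 2 * α ^ 2 * s ^ 2 * (s ^ (α - 2)) ^ 2 + c * α * (1 - α) * s ^ (α - 2)) * exp (-(c * s ^ α))

variable {c α : ℝ}

theorem stableConvexity_nonneg (hc : 0 < c) (hα0 : 0 < α) (hα : α < 1) {s : ℝ} (hs : 0 ≤ s) :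
    0 ≤ stableConvexity c α s := by
  have : 0 ≤ 1 - α := by linarith
  unfold stableConvexity
  positivity

theorem measurable_mul_stableConvexity : Measurable fun s => s * stableConvexity c α s := by
  unfold stableConvexity
  fun_prop

/-- An antiderivative of `s ↦ (s - t) * stableConvexity c α s`. -/
noncomputable def stableAntideriv (c α t s : ℝ) : ℝ :=
  -(c * α) * (s ^ α * exp (-(c * s ^ α))) + t * (c * α) * (s ^ (α - 1) * exp (-(c * s ^ α)))
    - exp (-(c * s ^ α))

theorem hasDerivAt_stableAntideriv (t : ℝ) {s : ℝ} (hs : 0 < s) :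
    HasDerivAt (stableAntideriv c α t) ((s - t) * stableConvexity c α s) s := by
  have h1 : HasDerivAt (fun s : ℝ => s ^ α) (α * s ^ (α - 1)) s :=
    hasDerivAt_rpow_const (Or.inl hs.ne')
  have h2 : HasDerivAt (fun s : ℝ => s ^ (α - 1)) ((α - 1) * s ^ (α - 1 - 1)) s :=
    hasDerivAt_rpow_const (Or.inl hs.ne')
  have h3 : HasDerivAt (fun s : ℝ => exp (-(c * s ^ α)))
      (exp (-(c * s ^ α)) * (-(c * (α * s ^ (α - 1))))) s := (h1.const_mul c).neg.exp
  have h4 := (((h1.mul h3).const_mul (-(c * α))).add ((h2.mul h3).const_mul (t * (c * α)))).sub h3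
  refine h4.congr_deriv ?_
  have e1 : s ^ (α - 1 - 1) = s ^ (α - 2) := by congr 1; ring
  have e2 : s ^ (α - 1) = s * s ^ (α - 2) := by
    rw [show α - 1 = 1 + (α - 2) by ring, rpow_add hs, rpow_one]
  have e3 : s ^ α = s ^ 2 * s ^ (α - 2) := by
    rw [← rpow_natCast, ← rpow_add hs]; congr 1; push_cast; ring
  rw [stableConvexity, e1, e2]
  generalize hE : exp (-(c * s ^ α)) = E
  rw [e3]
  ring

theorem tendsto_stableAntideriv (hc : 0 < c) (hα0 : 0 < α) (hα : α < 1) (t : ℝ) :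
    Tendsto (stableAntideriv c α t) atTop (𝓝 0) := by
  have hp : Tendsto (fun s : ℝ => s ^ α) atTop atTop := tendsto_rpow_atTop hα0
  have h1 : Tendsto (fun s : ℝ => s ^ α * exp (-(c * s ^ α))) atTop (𝓝 0) := by
    have := (tendsto_rpow_mul_exp_neg_mul_atTop_nhds_zero 1 c hc).comp hp
    simpa [Function.comp_def] using this
  have h2 : Tendsto (fun s : ℝ => exp (-(c * s ^ α))) atTop (𝓝 0) :=
    tendsto_exp_neg_atTop_nhds_zero.comp (hp.const_mul_atTop hc)
  have h3 : Tendsto (fun s : ℝ => s ^ (α - 1)) atTop (𝓝 0) := by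
    have := tendsto_rpow_neg_atTop (y := 1 - α) (by linarith)
    simpa using this
  have := ((h1.const_mul (-(c * α))).add ((h3.mul h2).const_mul (t * (c * α)))).sub h2
  simp only [mul_zero, add_zero, sub_zero] at this
  exact this

theorem stableAntideriv_self (hα0 : 0 < α) {t : ℝ} (ht : 0 ≤ t) :
    stableAntideriv c α t t = -exp (-(c * t ^ α)) := by
  rw [stableAntideriv]
  rcases ht.eq_or_lt with rfl | ht
  · simp [zero_rpow hα0.ne']
  · have : t * t ^ (α - 1) = t ^ α := by
      rw [rpow_sub_one ht.ne']; field_simp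
    rw [← this]; ring

/-- The only delicate case is `t = 0`: the factor `s^(α-1)`, singular at the origin, is then
multiplied by `t = 0`. -/
theorem continuousWithinAt_stableAntideriv (hα0 : 0 < α) {t : ℝ} (ht : 0 ≤ t) :
    ContinuousWithinAt (stableAntideriv c α t) (Set.Ici t) t := by
  rcases ht.eq_or_lt with rfl | ht
  · have h1 : Continuous fun s : ℝ => s ^ α := continuous_rpow_const hα0.le
    have : stableAntideriv c α 0
        = fun s => -(c * α) * (s ^ α * exp (-(c * s ^ α))) - exp (-(c * s ^ α)) := by
      ext s; simp [stableAntideriv]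
    rw [this]
    exact Continuous.continuousWithinAt (by fun_prop)
  · exact (hasDerivAt_stableAntideriv t ht).continuousAt.continuousWithinAt

theorem integrableOn_sub_mul_stableConvexity (hc : 0 < c) (hα0 : 0 < α) (hα : α < 1) {t : ℝ}
    (ht : 0 ≤ t) : IntegrableOn (fun s => (s - t) * stableConvexity c α s) (Set.Ioi t) :=
  integrableOn_Ioi_deriv_of_nonneg (continuousWithinAt_stableAntideriv hα0 ht)
    (fun _ hs => hasDerivAt_stableAntideriv t (ht.trans_lt hs))
    (fun _ hs => mul_nonneg (sub_nonneg.2 (le_of_lt hs))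
      (stableConvexity_nonneg hc hα0 hα (ht.trans (le_of_lt hs))))
    (tendsto_stableAntideriv hc hα0 hα t)

/-- Taylor's formula with base point at infinity: for `f s = exp(-c s^α)` the antiderivative is `(s
- t) f' - f`, which vanishes at infinity and equals `-f t` at `s = t`. -/
theorem integral_sub_mul_stableConvexity (hc : 0 < c) (hα0 : 0 < α) (hα : α < 1) {t : ℝ}
    (ht : 0 ≤ t) :
    ∫ s in Set.Ioi t, (s - t) * stableConvexity c α s = exp (-(c * t ^ α)) := by
  rw [integral_Ioi_of_hasDerivAt_of_nonneg (continuousWithinAt_stableAntideriv hα0 ht)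
    (fun _ hs => hasDerivAt_stableAntideriv t (ht.trans_lt hs))
    (fun _ hs => mul_nonneg (sub_nonneg.2 (le_of_lt hs))
      (stableConvexity_nonneg hc hα0 hα (ht.trans (le_of_lt hs))))
    (tendsto_stableAntideriv hc hα0 hα t), stableAntideriv_self hα0 ht]
  ring

/-- The mixing measure in the representation of the stable characteristic function, `α < 1`, as a
mixture of tent functions. -/
noncomputable def mixingMeasure (c α : ℝ) : Measure ℝ :=
  (volume.restrict (Set.Ioi 0)).withDensity fun s => ENNReal.ofReal (s * stableConvexity c α s)

theorem isProbabilityMeasure_mixingMeasure (hc : 0 < c) (hα0 : 0 < α) (hα : α < 1) :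
    IsProbabilityMeasure (mixingMeasure c α) := by
  refine ⟨?_⟩
  have h1 := integral_sub_mul_stableConvexity hc hα0 hα le_rfl
  have h2 := integrableOn_sub_mul_stableConvexity hc hα0 hα le_rfl
  simp only [sub_zero, zero_rpow hα0.ne', mul_zero, neg_zero, exp_zero] at h1 h2
  rw [mixingMeasure, withDensity_apply _ MeasurableSet.univ, Measure.restrict_univ,
    ← ofReal_integral_eq_lintegral_ofReal h2, h1, ENNReal.ofReal_one]
  filter_upwards [ae_restrict_mem measurableSet_Ioi] with s hs
  exact mul_nonneg (le_of_lt hs) (stableConvexity_nonneg hc hα0 hα (le_of_lt hs))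

/-- Pólya's representation: for `s > 0` the positive part of `s - |t|` is `s * tent (t / s)`, so
Taylor's formula reads as a mixture of tents with density `s f''(s)`. -/
theorem integral_tent_mixingMeasure (hc : 0 < c) (hα0 : 0 < α) (hα : α < 1) (t : ℝ) :
    ∫ s, tent (t / s) ∂mixingMeasure c α = exp (-(c * |t| ^ α)) := by
  rw [mixingMeasure, integral_withDensity_eq_integral_toReal_smul
    measurable_mul_stableConvexity.ennreal_ofReal (by simp),
    ← integral_sub_mul_stableConvexity hc hα0 hα (abs_nonneg t)]
  have h1 : ∀ s ∈ Set.Ioi (0 : ℝ), (ENNReal.ofReal (s * stableConvexity c α s)).toReal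
      • tent (t / s)
      = (Set.Ioi |t|).indicator (fun s => (s - |t|) * stableConvexity c α s) s := by
    intro s hs
    have hs0 : 0 < s := hs
    rw [ENNReal.toReal_ofReal (mul_nonneg hs0.le (stableConvexity_nonneg hc hα0 hα hs0.le)),
      smul_eq_mul]
    by_cases hst : |t| < s
    · rw [Set.indicator_of_mem (Set.mem_Ioi.2 hst), tent, abs_div, abs_of_pos hs0,
        max_eq_right (sub_nonneg.2 ((div_le_one hs0).2 hst.le))]
      field_simp
    · rw [Set.indicator_of_notMem (by simpa using hst), tent_eq_zero, mul_zero]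
      rw [abs_div, abs_of_pos hs0, le_div_iff₀ hs0, one_mul]
      exact not_lt.1 hst
  rw [setIntegral_congr_fun measurableSet_Ioi h1, setIntegral_indicator measurableSet_Ioi,
    Set.inter_eq_right.2 (Set.Ioi_subset_Ioi (abs_nonneg t))]

theorem measurable_two_pi_mul_div : Measurable fun q : ℝ × ℝ => 2 * π * q.2 / q.1 := by
  fun_prop

/-- For `α < 1` a symmetric stable law is a scale mixture of Fejér laws. -/
theorem stable_eq_map_prod {μ : Measure ℝ} [IsProbabilityMeasure μ] (hc : 0 < c) (hα0 : 0 < α)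
    (hα : α < 1) (hμ : ∀ t : ℝ, charFun μ t = ((exp (-(c * |t| ^ α)) : ℝ) : ℂ)) :
    μ = ((mixingMeasure c α).prod fejerMeasure).map fun q => 2 * π * q.2 / q.1 := by
  have := isProbabilityMeasure_mixingMeasure hc hα0 hα
  have : IsProbabilityMeasure
      (((mixingMeasure c α).prod fejerMeasure).map fun q => 2 * π * q.2 / q.1) :=
    Measure.isProbabilityMeasure_map measurable_two_pi_mul_div.aemeasurable
  refine Measure.ext_of_charFun (funext fun t => ?_)
  have hm : Measurable fun q : ℝ × ℝ => Complex.exp (t * (2 * π * q.2 / q.1 : ℝ) * Complex.I) := by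
    fun_prop
  rw [hμ, charFun_apply_real, integral_map measurable_two_pi_mul_div.aemeasurable
    (by fun_prop : Measurable fun x : ℝ => Complex.exp (t * x * Complex.I)).aestronglyMeasurable,
    integral_prod]
  · rw [← integral_tent_mixingMeasure hc hα0 hα t, ← integral_complex_ofReal]
    congr 1
    ext s
    rw [← integral_cexp_fejerMeasure]
    congr 1
    ext ξ
    congr 2
    push_cast
    ring
  · refine Integrable.of_bound hm.aestronglyMeasurable 1 (Eventually.of_forall fun q => ?_)
    rw [← Complex.ofReal_mul, Complex.norm_exp_ofReal_mul_I]

theorem map_prod_apply_eq_lintegral (hc : 0 < c) (hα0 : 0 < α) (hα : α < 1) {B : Set ℝ}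
    (hB : MeasurableSet B) :
    (((mixingMeasure c α).prod fejerMeasure).map fun q => 2 * π * q.2 / q.1) B
      = ∫⁻ s in Set.Ioi 0, ENNReal.ofReal (s * stableConvexity c α s)
          * fejerMeasure ((fun ξ => 2 * π / s * ξ) ⁻¹' B) := by
  have := isProbabilityMeasure_mixingMeasure hc hα0 hα
  have hset := measurable_two_pi_mul_div hB
  rw [Measure.map_apply measurable_two_pi_mul_div hB, Measure.prod_apply hset, mixingMeasure,
    lintegral_withDensity_eq_lintegral_mul _
      measurable_mul_stableConvexity.ennreal_ofReal
      (measurable_measure_prodMk_left hset)]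
  refine lintegral_congr fun s => ?_
  simp only [Pi.mul_apply]
  congr 2
  ext ξ
  simp only [Set.mem_preimage]
  rw [div_mul_eq_mul_div]

theorem volume_preimage_two_pi_div_mul {s : ℝ} (hs : 0 < s) (B : Set ℝ) :
    volume ((fun ξ => 2 * π / s * ξ) ⁻¹' B) = ENNReal.ofReal (s / (2 * π)) * volume B := by
  rw [Real.volume_preimage_mul_left (by positivity), inv_div, abs_of_pos (by positivity)]

theorem stable_absolutelyContinuous_volume {μ : Measure ℝ} [IsProbabilityMeasure μ] (hc : 0 < c)
    (hα0 : 0 < α) (hα : α < 1) (hμ : ∀ t : ℝ, charFun μ t = ((exp (-(c * |t| ^ α)) : ℝ) : ℂ)) :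
    μ ≪ volume := by
  refine Measure.AbsolutelyContinuous.mk fun B hB h0 => ?_
  rw [stable_eq_map_prod hc hα0 hα hμ, map_prod_apply_eq_lintegral hc hα0 hα hB]
  refine (setLIntegral_congr_fun measurableSet_Ioi fun s hs => ?_).trans lintegral_zero
  have h1 := volume_preimage_two_pi_div_mul hs B
  rw [h0, mul_zero] at h1
  have h2 : fejerMeasure ≪ volume := withDensity_absolutelyContinuous _ _
  simp only [h2 h1, mul_zero]

/-- Only the term with `s^(α-2)` is kept. Of the two factors `s`, one belongs to the mixing density
and the other comes from rescaling Lebesgue measure. -/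
theorem le_mul_stableConvexity (hc : 0 < c) (hα0 : 0 < α) (hα : α < 1) {s : ℝ} (hs : 0 < s)
    (hs1 : s ≤ 1) : c * α * (1 - α) * exp (-c) * s ^ α ≤ s * stableConvexity c α s * s := by
  have h1 : 0 < 1 - α := by linarith
  have e3 : s ^ α = s ^ 2 * s ^ (α - 2) := by
    rw [← rpow_natCast, ← rpow_add hs]; congr 1; push_cast; ring
  have h2 : exp (-c) ≤ exp (-(c * s ^ α)) := by
    refine exp_le_exp.2 (neg_le_neg ?_)
    exact mul_le_of_le_one_right hc.le (rpow_le_one hs.le hs1 hα0.le)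
  have h3 : c * α * (1 - α) * s ^ (α - 2) * exp (-c) ≤ stableConvexity c α s := by
    unfold stableConvexity
    refine mul_le_mul ?_ h2 (exp_pos _).le (by positivity)
    have : 0 ≤ c ^ 2 * α ^ 2 * s ^ 2 * (s ^ (α - 2)) ^ 2 := by positivity
    linarith
  calc c * α * (1 - α) * exp (-c) * s ^ α
      = s * (c * α * (1 - α) * s ^ (α - 2) * exp (-c)) * s := by rw [e3]; ring
    _ ≤ _ := by gcongr

/-- For `α < 1` the density of a symmetric stable law at distance at most `M` is at least of order
`M ^ (-1 - α)`. -/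
theorem exists_smul_restrict_le_stable {μ : Measure ℝ} [IsProbabilityMeasure μ] (hc : 0 < c)
    (hα0 : 0 < α) (hα : α < 1) (hμ : ∀ t : ℝ, charFun μ t = ((exp (-(c * |t| ^ α)) : ℝ) : ℂ)) :
    ∃ K : ℝ, 0 < K ∧ ∀ M : ℝ, 1 ≤ M →
      ENNReal.ofReal (K * M ^ (-1 - α)) • (volume.restrict (Set.Icc (-M) M)) ≤ μ := by
  have h1α : 0 < 1 - α := by linarith
  set K₁ : ℝ := c * α * (1 - α) * exp (-c) with hK₁
  set K₂ : ℝ := 4 / π ^ 2 / (2 * π) with hK₂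
  have hK₁0 : 0 < K₁ := by positivity
  have hK₂0 : 0 < K₂ := by positivity
  refine ⟨K₁ * K₂ * (2 : ℝ) ^ (-1 - α), by positivity, fun M hM => ?_⟩
  have hM0 : 0 < M := by linarith
  refine Measure.le_iff.2 fun B hB => ?_
  rw [Measure.smul_apply, Measure.restrict_apply hB, smul_eq_mul]
  set B' := B ∩ Set.Icc (-M) M with hB'
  have hB'm : MeasurableSet B' := hB.inter measurableSet_Icc
  refine le_trans ?_ (measure_mono (Set.inter_subset_left : B' ⊆ B))
  conv_rhs => rw [stable_eq_map_prod hc hα0 hα hμ]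
  rw [map_prod_apply_eq_lintegral hc hα0 hα hB'm]
  -- These scales suffice: for `s ≤ 1/M` the preimage of `[-M, M]` under `ξ ↦ 2πξ/s` lies in `[-1/2,
  -- 1/2]`, where the Fejér density is bounded below. The integrand is of order `s^α`, hence
  -- `M^(-α)`, over a range of length `1/(2M)`.
  have hsub : Set.Ioc (1 / (2 * M)) (1 / M) ⊆ Set.Ioi (0 : ℝ) := fun s hs =>
    lt_trans (by positivity) hs.1
  refine le_trans ?_ (lintegral_mono_set hsub)
  have hpt : ∀ s ∈ Set.Ioc (1 / (2 * M)) (1 / M),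
      ENNReal.ofReal (K₁ * K₂ * (1 / (2 * M)) ^ α) * volume B'
        ≤ ENNReal.ofReal (s * stableConvexity c α s)
          * fejerMeasure ((fun ξ => 2 * π / s * ξ) ⁻¹' B') := by
    intro s hs
    have hs0 : 0 < s := hsub hs
    have hs1 : s ≤ 1 := hs.2.trans ((div_le_one hM0).2 hM)
    have hsM : s * M ≤ 1 := by
      have := hs.2
      rwa [le_div_iff₀ hM0] at this
    have hF : ENNReal.ofReal (4 / π ^ 2) * (ENNReal.ofReal (s / (2 * π)) * volume B')
        ≤ fejerMeasure ((fun ξ => 2 * π / s * ξ) ⁻¹' B') := by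
      rw [← volume_preimage_two_pi_div_mul hs0]
      refine le_fejerMeasure ((measurable_const_mul _) hB'm) fun ξ hξ => ?_
      have h1 : |2 * π / s * ξ| ≤ M := abs_le.2 hξ.2
      rw [abs_mul, abs_of_pos (by positivity : 0 < 2 * π / s), div_mul_eq_mul_div,
        div_le_iff₀ hs0] at h1
      nlinarith [pi_gt_three, abs_nonneg ξ]
    refine le_trans ?_ (mul_le_mul_right hF _)
    rw [← mul_assoc, ← mul_assoc, ← ENNReal.ofReal_mul
      (mul_nonneg hs0.le (stableConvexity_nonneg hc hα0 hα hs0.le)),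
      ← ENNReal.ofReal_mul (by have := stableConvexity_nonneg hc hα0 hα hs0.le; positivity)]
    refine mul_le_mul_left (ENNReal.ofReal_le_ofReal ?_) _
    have h2 := le_mul_stableConvexity hc hα0 hα hs0 hs1
    have h3 : (1 / (2 * M)) ^ α ≤ s ^ α := rpow_le_rpow (by positivity) hs.1.le hα0.le
    calc K₁ * K₂ * (1 / (2 * M)) ^ α ≤ K₁ * K₂ * s ^ α := by gcongr
      _ = (K₁ * s ^ α) * K₂ := by ring
      _ ≤ (s * stableConvexity c α s * s) * K₂ := by gcongr
      _ = _ := by rw [hK₂]; ring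
  refine le_trans ?_ (setLIntegral_mono' measurableSet_Ioc hpt)
  rw [setLIntegral_const, Real.volume_Ioc, mul_right_comm (ENNReal.ofReal _) (volume B'),
    ← ENNReal.ofReal_mul (by positivity)]
  refine mul_le_mul_left (ENNReal.ofReal_le_ofReal (le_of_eq ?_)) _
  have h5 : 1 / M - 1 / (2 * M) = 1 / (2 * M) := by field_simp; norm_num
  have h6 : (2 : ℝ) ^ (-1 - α) * M ^ (-1 - α) = (1 / (2 * M)) ^ α * (1 / (2 * M)) := by
    rw [← mul_rpow two_pos.le hM0.le, one_div, inv_rpow (by positivity),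
      ← rpow_neg (by positivity), show -1 - α = -α + -1 by ring, rpow_add (by positivity),
      rpow_neg_one]
  rw [h5]
  linear_combination (K₁ * K₂) * h6

end StableDensity

/-! ### Tolerance of the perturbed lattice. -/

section PerturbedLattice

open Filter Topology

variable {Ω : Type*} {Y : ℤ → Ω → ℝ}

theorem perturbedLattice_eq_pointsOf (ω : Ω) :
    perturbedLattice Y ω = pointsOf Set.univ fun w : ℤ => (w : ℝ) + Y w ω := by
  ext a
  simp [perturbedLattice, pointsOf, eq_comm]

theorem perturbedLatticeOff_eq_pointsOf (S : Set ℤ) (ω : Ω) :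
    perturbedLatticeOff S Y ω = pointsOf Sᶜ fun w : ℤ => (w : ℝ) + Y w ω := by
  ext a
  simp [perturbedLatticeOff, pointsOf, eq_comm]

/-- Injectivity is essential: if two indices gave the same point, deleting it would remove both. -/
theorem delete_eq_perturbedLatticeOff {ω : Ω}
    (hinj : Function.Injective fun w : ℤ => (w : ℝ) + Y w ω) (x : ℤ) :
    (perturbedLattice Y ω).delete (x + Y x ω) = perturbedLatticeOff {x} Y ω := by
  ext a
  simp only [PointSet.delete, perturbedLattice, perturbedLatticeOff, Set.mem_sdiff,
    Set.mem_ofPred_eq, Set.mem_singleton_iff]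
  constructor
  · rintro ⟨⟨w, rfl⟩, h⟩
    exact ⟨w, fun hw => h (by rw [hw]), rfl⟩
  · rintro ⟨w, hw, rfl⟩
    exact ⟨⟨w, rfl⟩, fun h => hw (hinj h)⟩

variable [MeasurableSpace Ω] {P : Measure Ω} [IsProbabilityMeasure P] {μ : Measure ℝ}

theorem map_eq_infinitePi_shiftLaw (hYmeas : ∀ x, Measurable (Y x))
    (hYlaw : ∀ x, P.map (Y x) = μ) (hYindep : iIndepFun Y P) :
    P.map (fun ω (w : ℤ) => (w : ℝ) + Y w ω) = Measure.infinitePi (shiftLaw μ) := by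
  have h1 : iIndepFun (fun (w : ℤ) ω => (w : ℝ) + Y w ω) P :=
    hYindep.comp (fun w y => (w : ℝ) + y) fun w => by fun_prop
  rw [(iIndepFun_iff_map_fun_eq_infinitePi_map fun w => (hYmeas w).const_add _).1 h1]
  congr 1
  ext1 w
  rw [shiftLaw, ← hYlaw w, Measure.map_map (by fun_prop) (hYmeas w)]
  rfl

theorem map_perturbedLattice (hYmeas : ∀ x, Measurable (Y x))
    (hYlaw : ∀ x, P.map (Y x) = μ) (hYindep : iIndepFun Y P) :
    P.map (perturbedLattice Y) = (Measure.infinitePi (shiftLaw μ)).map (pointsOf Set.univ) := by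
  rw [← map_eq_infinitePi_shiftLaw hYmeas hYlaw hYindep, Measure.map_map (measurable_pointsOf _)
    (measurable_pi_iff.2 fun w => (hYmeas w).const_add _)]
  congr 1
  ext1 ω
  exact perturbedLattice_eq_pointsOf ω

theorem map_perturbedLatticeOff (hYmeas : ∀ x, Measurable (Y x))
    (hYlaw : ∀ x, P.map (Y x) = μ) (hYindep : iIndepFun Y P) (S : Set ℤ) :
    P.map (perturbedLatticeOff S Y)
      = (Measure.infinitePi (shiftLaw μ)).map (pointsOf Sᶜ) := by
  rw [← map_eq_infinitePi_shiftLaw hYmeas hYlaw hYindep, Measure.map_map (measurable_pointsOf _)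
    (measurable_pi_iff.2 fun w => (hYmeas w).const_add _)]
  congr 1
  ext1 ω
  exact perturbedLatticeOff_eq_pointsOf S ω

theorem ae_injective_perturbed (hμ0 : ∀ a, μ {a} = 0) (hYmeas : ∀ x, Measurable (Y x))
    (hYlaw : ∀ x, P.map (Y x) = μ) (hYindep : iIndepFun Y P) :
    ∀ᵐ ω ∂P, Function.Injective fun w : ℤ => (w : ℝ) + Y w ω := by
  have hμ : IsProbabilityMeasure μ := by
    rw [← hYlaw 0]; exact Measure.isProbabilityMeasure_map (hYmeas 0).aemeasurable
  have h1 : ∀ x y : ℤ, x ≠ y → ∀ᵐ ω ∂P, (x : ℝ) + Y x ω ≠ y + Y y ω := by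
    intro x y hxy
    have h2 := (indepFun_iff_map_prod_eq_prod_map_map (hYmeas x).aemeasurable
      (hYmeas y).aemeasurable).1 (hYindep.indepFun hxy)
    rw [hYlaw, hYlaw] at h2
    have hset : MeasurableSet {p : ℝ × ℝ | (x : ℝ) + p.1 = y + p.2} :=
      measurableSet_eq_fun (by fun_prop) (by fun_prop)
    have h3 : (μ.prod μ) {p : ℝ × ℝ | (x : ℝ) + p.1 = y + p.2} = 0 := by
      rw [Measure.measure_prod_null hset]
      refine Eventually.of_forall fun a => ?_
      refine measure_mono_null ?_ (hμ0 ((x : ℝ) + a - y))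
      intro b hb
      simp only [Set.mem_preimage, Set.mem_ofPred_eq, Set.mem_singleton_iff] at hb ⊢
      linarith
    rw [← h2, Measure.map_apply ((hYmeas x).prodMk (hYmeas y)) hset] at h3
    exact measure_eq_zero_iff_ae_notMem.1 h3
  have h4 : ∀ᵐ ω ∂P, ∀ x y : ℤ, x ≠ y → (x : ℝ) + Y x ω ≠ y + Y y ω := by
    refine ae_all_iff.2 fun x => ae_all_iff.2 fun y => ?_
    by_cases hxy : x = y
    · exact Eventually.of_forall fun _ h => absurd hxy h
    · filter_upwards [h1 x y hxy] with ω hω _ using hω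
  filter_upwards [h4] with ω hω x y hxy
  by_contra hne
  exact hω x y hne hxy

/-- Tolerance of the perturbed lattice when the displacement has a density with sufficiently heavy
tails. -/
theorem tolerance_of_heavyTail [IsProbabilityMeasure μ] (hYmeas : ∀ x, Measurable (Y x))
    (hYlaw : ∀ x, P.map (Y x) = μ) (hYindep : iIndepFun Y P) (hμv : μ ≪ volume) {α K : ℝ}
    (hα : α < 1) (hK : 0 < K) (hlow : ∀ M : ℝ, 1 ≤ M →
      ENNReal.ofReal (K * M ^ (-1 - α)) • (volume.restrict (Set.Icc (-M) M)) ≤ μ) :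
    DeletionTolerant P (perturbedLattice Y) ∧
      InsertionTolerant P (perturbedLattice Y) ∧
      P.map (perturbedLattice Y) ≪ P.map (perturbedLatticeOff {0} Y) ∧
      P.map (perturbedLatticeOff {0} Y) ≪ P.map (perturbedLattice Y) := by
  have hvμ : volume ≪ μ := volume_absolutelyContinuous_of_heavyTail hK hlow
  have hμ0 : ∀ a, μ {a} = 0 := fun a => hμv (measure_singleton a)
  have hνν : ∀ x y, shiftLaw μ x ≪ shiftLaw μ y := fun x y =>
    (shiftLaw_absolutelyContinuous_volume hμv x).trans (volume_absolutelyContinuous_shiftLaw hvμ y)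
  have hconv := fun A (hA : MeasurableSet A) =>
    tendsto_avgHoleLaw_of_heavyTail (μ := μ) hα hK hlow hA
  have hins : P.map (perturbedLattice Y) ≪ P.map (perturbedLatticeOff {0} Y) := by
    rw [map_perturbedLattice hYmeas hYlaw hYindep, map_perturbedLatticeOff hYmeas hYlaw hYindep]
    exact absolutelyContinuous_hole (fun x => hνν 0 x) hconv
  have hdel : P.map (perturbedLatticeOff {0} Y) ≪ P.map (perturbedLattice Y) := by
    rw [map_perturbedLattice hYmeas hYlaw hYindep, map_perturbedLatticeOff hYmeas hYlaw hYindep]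
    exact hole_absolutelyContinuous hconv
  refine ⟨fun Z hZ => ?_, fun V hV hV0 hVt => ?_, hins, hdel⟩
  · refine Measure.AbsolutelyContinuous.mk fun A hA hA0 => ?_
    rw [Measure.map_apply (measurable_perturbedLattice_delete hYmeas hZ.1) hA]
    -- The deleted point has a random index, but there are only countably many, so it is enough to
    -- treat each fixed index.
    have hx : ∀ x : ℤ, P (perturbedLatticeOff {x} Y ⁻¹' A) = 0 := by
      intro x
      rw [← Measure.map_apply (measurable_perturbedLatticeOff _ hYmeas) hA,
        map_perturbedLatticeOff hYmeas hYlaw hYindep]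
      refine map_pointsOf_compl_singleton_absolutelyContinuous (hνν 0 x) ?_
      rw [← map_perturbedLatticeOff hYmeas hYlaw hYindep]
      exact hdel hA0
    have hall : ∀ᵐ ω ∂P, ∀ x : ℤ, ω ∉ perturbedLatticeOff {x} Y ⁻¹' A :=
      ae_all_iff.2 fun x => measure_eq_zero_iff_ae_notMem.1 (hx x)
    refine measure_eq_zero_iff_ae_notMem.2 ?_
    filter_upwards [hall, hZ.2, ae_injective_perturbed hμ0 hYmeas hYlaw hYindep] with ω h1 h2 h3 h4
    obtain ⟨x, hx⟩ := h2
    refine h1 x ?_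
    simp only [Set.mem_preimage] at h4 ⊢
    rwa [hx, delete_eq_perturbedLatticeOff h3] at h4
  · refine Measure.AbsolutelyContinuous.mk fun A hA hA0 => ?_
    have hU : cond volume V ≪ shiftLaw μ 0 :=
      cond_absolutelyContinuous.trans (volume_absolutelyContinuous_shiftLaw hvμ 0)
    have hm := measurable_perturbedLattice_add hYmeas
    have hUp : IsProbabilityMeasure (cond volume V) :=
      cond_isProbabilityMeasure_of_finite hV0.ne' hVt.ne
    have hac := ((Measure.AbsolutelyContinuous.refl P).prod hU).map hm
    refine hac ?_
    -- View `Π` as `Π₀` with an independent point of law `shiftLaw μ 0`. For almost every position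
    -- `a` of that point the event `Π₀ ∪ {a} ∈ A` is null, and `Π ≪ Π₀` transfers this to `Π ∪ {a}`.
    have h1 := hA0
    rw [map_perturbedLattice hYmeas hYlaw hYindep,
      show (Set.univ : Set ℤ) = insert 0 {0}ᶜ by ext; simp [em],
      map_pointsOf_insert (by simp), Measure.map_apply (measurable_pointsOf_add _) hA,
      Measure.prod_apply_symm (measurable_pointsOf_add _ hA),
      lintegral_eq_zero_iff (measurable_measure_prodMk_right (measurable_pointsOf_add _ hA))] at h1
    rw [Measure.map_apply hm hA, Measure.prod_apply_symm (hm hA),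
      lintegral_eq_zero_iff (measurable_measure_prodMk_right (hm hA))]
    filter_upwards [h1] with a ha
    have hadd : MeasurableSet ((fun S : PointSet => S.add a) ⁻¹' A) :=
      PointSet.measurable_add_const a hA
    have h2 : P.map (perturbedLatticeOff {0} Y) ((fun S : PointSet => S.add a) ⁻¹' A) = 0 := by
      rw [map_perturbedLatticeOff hYmeas hYlaw hYindep,
        Measure.map_apply (measurable_pointsOf _) hadd]
      exact ha
    have h3 := hins h2
    rw [Measure.map_apply (measurable_perturbedLattice hYmeas) hadd] at h3
    exact h3

/-- A symmetric stable law of index less than one gives a tolerant perturbed lattice. -/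
theorem tolerance_of_stable [IsProbabilityMeasure μ] {α : ℝ} (hμ : IsSymmetricStable α μ)
    (hYmeas : ∀ x, Measurable (Y x)) (hYlaw : ∀ x, P.map (Y x) = μ) (hYindep : iIndepFun Y P)
    (hα : α < 1) :
    DeletionTolerant P (perturbedLattice Y) ∧
      InsertionTolerant P (perturbedLattice Y) ∧
      P.map (perturbedLattice Y) ≪ P.map (perturbedLatticeOff {0} Y) ∧
      P.map (perturbedLatticeOff {0} Y) ≪ P.map (perturbedLattice Y) := by
  obtain ⟨hα0, -, c, hc, hchar⟩ := hμ
  obtain ⟨K, hK, hlow⟩ := exists_smul_restrict_le_stable hc hα0 hα hchar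
  exact tolerance_of_heavyTail hYmeas hYlaw hYindep
    (stable_absolutelyContinuous_volume hc hα0 hα hchar) hα hK hlow

end PerturbedLattice

/-! ### Absence of atoms, and the tail bound for `α ≥ 1`. -/

section StableTail

open Filter Topology Real

variable {μ : Measure ℝ} [IsProbabilityMeasure μ] {c α : ℝ}

theorem integrable_comp_abs {f : ℝ → ℝ} (hf : IntegrableOn f (Set.Ioi 0)) :
    Integrable fun x => f |x| := by
  have h1 : IntegrableOn (fun x => f |x|) (Set.Ioi 0) :=
    hf.congr_fun (fun x hx => by rw [abs_of_pos (by exact hx)]) measurableSet_Ioi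
  have h2 : IntegrableOn (fun x => f |x|) (Set.Iic 0) := by
    rw [← Measure.map_neg_eq_self (volume : Measure ℝ)]
    let m : MeasurableEmbedding fun x : ℝ => -x := (Homeomorph.neg ℝ).measurableEmbedding
    rw [m.integrableOn_map_iff]
    simp_rw [Function.comp_def, abs_neg, Set.neg_preimage, Set.neg_Iic, neg_zero]
    exact Iff.mpr integrableOn_Ici_iff_integrableOn_Ioi h1
  rw [← integrableOn_univ, ← Set.Iic_union_Ioi (a := (0 : ℝ))]
  exact h2.union h1

/-- The mass of an atom, moved to `0`, is the limit of the averages of the characteristic function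
over `[-n-1, n+1]`, that is, of the integrals of `sinc ((n+1) x)`. These vanish in the limit since
the characteristic function is integrable. -/
theorem stable_singleton_eq_zero (hc : 0 < c) (hα0 : 0 < α)
    (hμ : ∀ t : ℝ, charFun μ t = ((exp (-(c * |t| ^ α)) : ℝ) : ℂ)) (a : ℝ) : μ {a} = 0 := by
  set κ : Measure ℝ := μ.map (· + -a) with hκ
  have hκp : IsProbabilityMeasure κ := Measure.isProbabilityMeasure_map (by fun_prop)
  have hint : Integrable fun t : ℝ => exp (-(c * |t| ^ α)) := by
    have h1 := integrableOn_rpow_mul_exp_neg_mul_rpow (s := 0) (by norm_num) hα0 hc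
    simp only [rpow_zero, one_mul, neg_mul] at h1
    exact integrable_comp_abs h1
  set I := ∫ t : ℝ, exp (-(c * |t| ^ α)) with hI
  have hbound : ∀ n : ℕ, |∫ x, sinc ((n + 1 : ℝ) * x) ∂κ| ≤ I / (2 * (n + 1)) := by
    intro n
    have hn : (0 : ℝ) < n + 1 := by positivity
    have h1 := integral_charFun_Icc (μ := κ) hn
    have h2 : ‖∫ t in (-(n + 1) : ℝ)..(n + 1), charFun κ t‖ ≤ I := by
      refine (intervalIntegral.norm_integral_le_integral_norm (by linarith)).trans ?_
      have h3 : ∀ t : ℝ, ‖charFun κ t‖ = exp (-(c * |t| ^ α)) := by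
        intro t
        rw [hκ, charFun_map_add_const, hμ, norm_mul, Complex.norm_exp_ofReal_mul_I, mul_one,
          Complex.norm_real, norm_of_nonneg (exp_pos _).le]
      simp only [h3]
      rw [intervalIntegral.integral_of_le (by linarith)]
      exact setIntegral_le_integral hint (Eventually.of_forall fun _ => (exp_pos _).le)
    rw [h1] at h2
    have h4 : ‖(2 * ((n + 1 : ℝ) : ℂ) * ((∫ x, sinc ((n + 1 : ℝ) * x) ∂κ : ℝ) : ℂ))‖
        = 2 * (n + 1) * |∫ x, sinc ((n + 1 : ℝ) * x) ∂κ| := by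
      rw [norm_mul, norm_mul, Complex.norm_real, Complex.norm_real, norm_of_nonneg hn.le]
      simp
    rw [h4] at h2
    rw [le_div_iff₀ (by positivity)]
    linarith
  have hlim0 : Tendsto (fun n : ℕ => ∫ x, sinc ((n + 1 : ℝ) * x) ∂κ) atTop (𝓝 0) := by
    rw [tendsto_zero_iff_abs_tendsto_zero]
    refine squeeze_zero (fun _ => abs_nonneg _) hbound ?_
    have h1 := tendsto_one_div_add_atTop_nhds_zero_nat (𝕜 := ℝ)
    have h2 := h1.const_mul (I / 2)
    rw [mul_zero] at h2
    refine h2.congr fun n => ?_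
    field_simp
  have hlim1 : Tendsto (fun n : ℕ => ∫ x, sinc ((n + 1 : ℝ) * x) ∂κ) atTop
      (𝓝 (∫ x, ({0} : Set ℝ).indicator 1 x ∂κ)) := by
    refine tendsto_integral_of_dominated_convergence (fun _ => 1)
      (fun n => (continuous_sinc.comp (continuous_const_mul _)).aestronglyMeasurable)
      (integrable_const _) (fun n => Eventually.of_forall fun x => ?_)
      (Eventually.of_forall fun x => ?_)
    · rw [norm_eq_abs]; exact abs_le.2 ⟨neg_one_le_sinc _, sinc_le_one _⟩
    · rcases eq_or_ne x 0 with rfl | hx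
      · simp
      · rw [Set.indicator_of_notMem (by simpa using hx), tendsto_zero_iff_abs_tendsto_zero]
        refine squeeze_zero (g := fun n : ℕ => |x|⁻¹ * (1 / ((n : ℝ) + 1)))
          (fun _ => abs_nonneg _) (fun n => ?_) ?_
        · have hn : (0 : ℝ) < n + 1 := by positivity
          rw [Function.comp_apply, sinc_of_ne_zero (mul_ne_zero hn.ne' hx), abs_div, abs_mul,
            abs_of_pos hn, div_le_iff₀ (by positivity)]
          have : |x|⁻¹ * (1 / ((n : ℝ) + 1)) * ((n + 1) * |x|) = 1 := by
            have := abs_pos.2 hx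
            field_simp
          rw [this]
          exact abs_sin_le_one _
        · simpa using (tendsto_one_div_add_atTop_nhds_zero_nat (𝕜 := ℝ)).const_mul |x|⁻¹
  have h := tendsto_nhds_unique hlim0 hlim1
  rw [integral_indicator_one (measurableSet_singleton 0), measureReal_def] at h
  have h2 := ((ENNReal.toReal_eq_zero_iff _).1 h.symm).resolve_right (measure_ne_top _ _)
  rw [hκ, Measure.map_apply (by fun_prop) (measurableSet_singleton 0)] at h2
  convert h2 using 2
  ext y
  simp [← sub_eq_add_neg, sub_eq_zero]

theorem exists_stable_tail_le (hc : 0 < c) (hα : 1 ≤ α)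
    (hμ : ∀ t : ℝ, charFun μ t = ((exp (-(c * |t| ^ α)) : ℝ) : ℂ)) :
    ∃ C : ℝ, 0 < C ∧ ∀ r : ℝ, 0 < r → μ.real {x | r < |x|} ≤ C / r := by
  -- The summand `2` handles `r < 2`, where a probability is at most `1 ≤ 2/r`. For `r ≥ 2` only
  -- `|t| ≤ 2/r ≤ 1` matters, and there `|t|^α ≤ |t|` because `α ≥ 1`.
  refine ⟨4 * c + 2, by positivity, fun r hr => ?_⟩
  rcases lt_or_ge r 2 with h2 | h2
  · refine measureReal_le_one.trans ?_
    rw [le_div_iff₀ hr]; linarith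
  refine (measureReal_abs_gt_le_integral_charFun hr).trans ?_
  have hb : ∀ t ∈ Set.uIoc (-2 * r⁻¹) (2 * r⁻¹), ‖1 - charFun μ t‖ ≤ c * (2 * r⁻¹) := by
    intro t ht
    have hle : -2 * r⁻¹ ≤ 2 * r⁻¹ := by have := inv_pos.2 hr; linarith
    rw [Set.uIoc_of_le hle] at ht
    have ht' : |t| ≤ 2 * r⁻¹ := abs_le.2 ⟨by linarith [ht.1], ht.2⟩
    have ht1 : |t| ≤ 1 := ht'.trans (by rw [← div_eq_mul_inv, div_le_one hr]; exact h2)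
    rw [hμ, ← Complex.ofReal_one, ← Complex.ofReal_sub, Complex.norm_real, norm_eq_abs]
    have h3 : 0 ≤ c * |t| ^ α := by positivity
    have h4 : exp (-(c * |t| ^ α)) ≤ 1 := exp_le_one_iff.2 (by linarith)
    have h5 := add_one_le_exp (-(c * |t| ^ α))
    have h6 : |t| ^ α ≤ |t| := by
      conv_rhs => rw [← rpow_one |t|]
      exact rpow_le_rpow_of_exponent_ge' (abs_nonneg t) ht1 zero_le_one hα
    rw [abs_of_nonneg (by linarith)]
    have h7 : c * |t| ^ α ≤ c * (2 * r⁻¹) := by gcongr; exact h6.trans ht'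
    linarith
  have h8 := intervalIntegral.norm_integral_le_of_norm_le_const hb
  have h9 : |2 * r⁻¹ - -2 * r⁻¹| = 4 * r⁻¹ := by
    rw [abs_of_pos (by have := inv_pos.2 hr; linarith)]; ring
  rw [h9] at h8
  calc 2⁻¹ * r * ‖∫ t in (-2 * r⁻¹)..(2 * r⁻¹), 1 - charFun μ t‖
      ≤ 2⁻¹ * r * (c * (2 * r⁻¹) * (4 * r⁻¹)) := by gcongr
    _ = 4 * c / r := by field_simp
    _ ≤ (4 * c + 2) / r := by gcongr; linarith

end StableTail

/-! ### Truncated moments of the displacement. -/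

section TruncatedMoment

open Filter Topology

/-- The truncated relative size `min (|y| / L) 1`. -/
noncomputable def relSize (L y : ℝ) : ℝ := min (|y| / L) 1

theorem measurable_relSize (L : ℝ) : Measurable (relSize L) := by
  unfold relSize; fun_prop

theorem relSize_nonneg {L : ℝ} (hL : 0 ≤ L) (y : ℝ) : 0 ≤ relSize L y :=
  le_min (by positivity) zero_le_one

theorem relSize_le_one (L y : ℝ) : relSize L y ≤ 1 := min_le_right _ _

variable {μ : Measure ℝ} [IsProbabilityMeasure μ]

/-- Layer cake: `E min(|Y|, L)² = 2 ∫₀ᴸ t P(|Y| > t) dt ≤ 2 C L`, then divide by `L`. -/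
theorem mul_integral_relSize_sq_le {C : ℝ} (hC : 0 < C)
    (htail : ∀ r : ℝ, 0 < r → μ.real {x | r < |x|} ≤ C / r) {L : ℝ} (hL : 0 < L) :
    L * ∫ y, relSize L y ^ 2 ∂μ ≤ 2 * C := by
  have hm : Measurable fun y : ℝ => min |y| L := by fun_prop
  have h0 : ∀ y : ℝ, 0 ≤ min |y| L := fun y => le_min (abs_nonneg y) hL.le
  have h1 := lintegral_rpow_eq_lintegral_meas_lt_mul μ (f := fun y => min |y| L)
    (Eventually.of_forall h0) hm.aemeasurable (p := 2) two_pos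
  have h2 : ∫⁻ t in Set.Ioi 0, μ {a : ℝ | t < min |a| L} * ENNReal.ofReal (t ^ ((2 : ℝ) - 1))
      ≤ ENNReal.ofReal (C * L) := by
    calc ∫⁻ t in Set.Ioi 0, μ {a : ℝ | t < min |a| L} * ENNReal.ofReal (t ^ ((2 : ℝ) - 1))
        ≤ ∫⁻ t in Set.Ioi 0, (Set.Iio L).indicator (fun _ => ENNReal.ofReal C) t := by
          refine setLIntegral_mono' measurableSet_Ioi fun t ht => ?_
          have ht0 : 0 < t := ht
          by_cases htL : t < L
          · rw [Set.indicator_of_mem (Set.mem_Iio.2 htL)]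
            have h3 : μ {a : ℝ | t < min |a| L} ≤ ENNReal.ofReal (C / t) := by
              refine (measure_mono fun a ha => (?_ : t < |a|)).trans
                ((ENNReal.le_ofReal_iff_toReal_le (measure_ne_top _ {x | t < |x|})
                  (by positivity)).2 (htail t ht0))
              exact (lt_min_iff.1 ha).1
            refine (mul_le_mul_left h3 _).trans ?_
            rw [← ENNReal.ofReal_mul (by positivity)]
            norm_num
            rw [div_mul_cancel₀ _ ht0.ne']
          · have : {a : ℝ | t < min |a| L} = ∅ := by
              ext a
              simp only [Set.mem_ofPred_eq, lt_min_iff, Set.mem_empty_iff_false, iff_false]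
              exact fun h => htL h.2
            rw [this]; simp
      _ = ENNReal.ofReal (C * L) := by
          rw [lintegral_indicator measurableSet_Iio, setLIntegral_const,
            Measure.restrict_apply measurableSet_Iio, Set.Iio_inter_Ioi, Real.volume_Ioo, sub_zero,
            ← ENNReal.ofReal_mul hC.le]
  have h4 : ∫⁻ y, ENNReal.ofReal (min |y| L ^ (2 : ℝ)) ∂μ ≤ ENNReal.ofReal (2 * C * L) := by
    rw [h1, mul_assoc, ENNReal.ofReal_mul two_pos.le]
    gcongr
  have h5 : ∫ y, min |y| L ^ 2 ∂μ ≤ 2 * C * L := by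
    rw [integral_eq_lintegral_of_nonneg_ae (Eventually.of_forall fun y => by positivity)
      (hm.pow_const 2).aestronglyMeasurable]
    refine ENNReal.toReal_le_of_le_ofReal (by positivity) (le_trans (le_of_eq ?_) h4)
    refine lintegral_congr fun y => ?_
    norm_cast
  have h6 : ∀ y, relSize L y ^ 2 = (L ^ 2)⁻¹ * min |y| L ^ 2 := by
    intro y
    have : relSize L y = min |y| L / L := by
      rw [relSize, ← min_div_div_right hL.le, div_self hL.ne']
    rw [this]; ring
  simp only [h6]
  rw [integral_const_mul]
  calc L * ((L ^ 2)⁻¹ * ∫ y, min |y| L ^ 2 ∂μ) ≤ L * ((L ^ 2)⁻¹ * (2 * C * L)) := by gcongr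
    _ = 2 * C := by field_simp

theorem tendsto_integral_relSize : Tendsto (fun L => ∫ y, relSize L y ∂μ) atTop (𝓝 0) := by
  have h : Tendsto (fun L => ∫ y, relSize L y ∂μ) atTop (𝓝 (∫ _, (0 : ℝ) ∂μ)) := by
    refine tendsto_integral_filter_of_dominated_convergence (fun _ => 1)
      (Eventually.of_forall fun L => (measurable_relSize L).aestronglyMeasurable) ?_
      (integrable_const _) (Eventually.of_forall fun y => ?_)
    · filter_upwards [eventually_ge_atTop 0] with L hL
      refine Eventually.of_forall fun y => ?_
      rw [Real.norm_of_nonneg (relSize_nonneg hL y)]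
      exact relSize_le_one L y
    · have h1 : Tendsto (fun L : ℝ => |y| / L) atTop (𝓝 0) :=
        tendsto_const_nhds.div_atTop tendsto_id
      have h2 := h1.min (tendsto_const_nhds (x := (1 : ℝ)))
      rwa [min_eq_left zero_le_one] at h2
  simpa using h

end TruncatedMoment

/-! ### Multiscale bump functions of small energy. -/

section TestFunction

open Filter Topology

theorem abs_tent_sub_tent_le (u v : ℝ) : |tent u - tent v| ≤ min |u - v| 1 := by
  refine le_min ?_ ?_
  · unfold tent
    refine (abs_max_sub_max_le_max _ _ _ _).trans (max_le (by simp) ?_)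
    rw [sub_sub_sub_cancel_left, abs_sub_comm u v]
    exact abs_abs_sub_abs_le v u
  · rw [abs_sub_le_iff]
    constructor <;> linarith [tent_nonneg u, tent_nonneg v, tent_le_one u, tent_le_one v]

theorem sum_indicator_Icc_le (F : Finset ℤ) {a b : ℝ} (hab : a ≤ b) (y : ℝ) :
    ∑ x ∈ F, (Set.Icc a b).indicator (1 : ℝ → ℝ) (x + y) ≤ b - a + 1 := by
  have h1 := (ENNReal.sum_le_tsum F).trans (tsum_indicator_Icc_le hab y)
  have h2 : ∀ x : ℤ, (Set.Icc a b).indicator (1 : ℝ → ℝ≥0∞) (x + y)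
      = ENNReal.ofReal ((Set.Icc a b).indicator (1 : ℝ → ℝ) (x + y)) := by
    intro x
    by_cases h : (x : ℝ) + y ∈ Set.Icc a b <;> simp only [Set.indicator, h] <;> simp
  simp only [h2] at h1
  rw [← ENNReal.ofReal_sum_of_nonneg (f := fun x : ℤ => (Set.Icc a b).indicator (1 : ℝ → ℝ) (x + y))
    fun x _ => Set.indicator_nonneg (fun _ _ => zero_le_one) _,
    ENNReal.ofReal_le_ofReal_iff (by linarith)] at h1
  exact h1

theorem abs_tent_shift_sub_le {L : ℝ} (hL : 0 < L) (x y : ℝ) :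
    |tent ((x + y) / L) - tent (x / L)| ≤ relSize L y := by
  refine (abs_tent_sub_tent_le _ _).trans (le_of_eq ?_)
  rw [relSize, ← sub_div, add_sub_cancel_left, abs_div, abs_of_pos hL]

/-- A term is nonzero only if `x` or `x + y` lies in `[-L, L]`, hence for at most `2 (2L + 1) ≤ 6L`
indices, and each term is at most `relSize L y`. -/
theorem sum_abs_tent_shift_sub_le (F : Finset ℤ) {L : ℝ} (hL : 1 ≤ L) (y : ℝ) :
    ∑ x ∈ F, |tent ((x + y) / L) - tent (x / L)| ≤ 6 * L * relSize L y := by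
  have hL0 : 0 < L := by linarith
  have hz : ∀ u : ℝ, u ∉ Set.Icc (-L) L → tent (u / L) = 0 := by
    intro u hu
    refine tent_eq_zero ?_
    rw [abs_div, abs_of_pos hL0, le_div_iff₀ hL0, one_mul]
    by_contra h
    exact hu (abs_le.1 (not_le.1 h).le)
  have h1 : ∀ x : ℤ, |tent ((x + y) / L) - tent (x / L)|
      ≤ relSize L y * ((Set.Icc (-L) L).indicator (1 : ℝ → ℝ) (x + y)
        + (Set.Icc (-L) L).indicator (1 : ℝ → ℝ) (x + 0)) := by
    intro x
    have hr := relSize_nonneg hL0.le y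
    have h2 := abs_tent_shift_sub_le hL0 x y
    rw [add_zero]
    by_cases ha : (x : ℝ) + y ∈ Set.Icc (-L) L <;> by_cases hb : (x : ℝ) ∈ Set.Icc (-L) L
    · simp only [Set.indicator_of_mem ha, Set.indicator_of_mem hb, Pi.one_apply]; linarith
    · simp only [Set.indicator_of_mem ha, Set.indicator_of_notMem hb, Pi.one_apply]; linarith
    · simp only [Set.indicator_of_notMem ha, Set.indicator_of_mem hb, Pi.one_apply]; linarith
    · rw [hz _ ha, hz _ hb, Set.indicator_of_notMem ha, Set.indicator_of_notMem hb]; simp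
  refine (Finset.sum_le_sum fun x _ => h1 x).trans ?_
  rw [← Finset.mul_sum, Finset.sum_add_distrib]
  have h3 := sum_indicator_Icc_le F (by linarith : -L ≤ L) y
  have h4 := sum_indicator_Icc_le F (by linarith : -L ≤ L) 0
  have hr := relSize_nonneg hL0.le y
  nlinarith

variable {μ : Measure ℝ} [IsProbabilityMeasure μ]

/-- There are bump functions with arbitrarily small energy with respect to the displacement. -/
theorem exists_bump_energy_le {C : ℝ} (hC : 0 < C)
    (hsq : ∀ L : ℝ, 1 ≤ L → L * ∫ y, relSize L y ^ 2 ∂μ ≤ C) {ε : ℝ} (hε : 0 < ε) (R : ℝ) :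
    ∃ h : ℝ → ℝ, Measurable h ∧ (∀ u, 0 ≤ h u) ∧ (∀ u, h u ≤ 1) ∧
      (∃ L : ℝ, 0 ≤ L ∧ ∀ u, u ∉ Set.Icc (-L) L → h u = 0) ∧ (∀ u, |u| ≤ R → 1 - ε ≤ h u) ∧
      ∀ F : Finset ℤ, ∑ x ∈ F, ∫ y, (h (x + y) - h x) ^ 2 ∂μ ≤ ε := by
  -- Scales are chosen recursively, each so large that its cross term with every earlier scale is at
  -- most `ε/2`. Starting above `R/ε` makes every tent at least `1 - ε` on `[-R, R]`.
  obtain ⟨ℓ, hℓ, hℓr⟩ := exists_seq_of_forall_finset_exists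
    (fun L : ℝ => max 1 (R / ε) ≤ L)
    (fun L L' => L ≤ L' ∧ 6 * L * ∫ y, relSize L' y ∂μ ≤ ε / 2) (by
      intro s _
      have h1 : ∀ᶠ L' in atTop, ∀ L ∈ s, L ≤ L' ∧ 6 * L * ∫ y, relSize L' y ∂μ ≤ ε / 2 := by
        rw [Filter.eventually_all_finset]
        intro L _
        refine (eventually_ge_atTop L).and ?_
        have h2 := (tendsto_integral_relSize (μ := μ)).const_mul (6 * L)
        rw [mul_zero] at h2
        exact (h2.eventually_lt_const (by positivity)).mono fun _ h => h.le
      exact ((eventually_ge_atTop _).and h1).exists)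
  have hℓ1 : ∀ j, 1 ≤ ℓ j := fun j => (le_max_left _ _).trans (hℓ j)
  have hℓ0 : ∀ j, 0 < ℓ j := fun j => zero_lt_one.trans_le (hℓ1 j)
  -- The `K` diagonal terms cost `6C` each and are divided by `K²`; this choice leaves at most `ε/2`
  -- for them.
  obtain ⟨K, hK⟩ := exists_nat_gt (12 * C / ε)
  have hK0 : (0 : ℝ) < K := lt_trans (by positivity) hK
  set h : ℝ → ℝ := fun u => (K : ℝ)⁻¹ * ∑ j ∈ Finset.range K, tent (u / ℓ j) with hh
  have hhm : Measurable h := by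
    have := continuous_tent.measurable
    fun_prop
  have hh0 : ∀ u, 0 ≤ h u := fun u =>
    mul_nonneg (inv_nonneg.2 hK0.le) (Finset.sum_nonneg fun j _ => tent_nonneg _)
  have hh1 : ∀ u, h u ≤ 1 := by
    intro u
    rw [hh, inv_mul_le_iff₀ hK0, mul_one]
    refine (Finset.sum_le_sum fun j _ => tent_le_one _).trans ?_
    simp
  refine ⟨h, hhm, hh0, hh1, ⟨∑ j ∈ Finset.range K, ℓ j,
    Finset.sum_nonneg fun j _ => (hℓ0 j).le, fun u hu => ?_⟩, fun u hu => ?_, fun F => ?_⟩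
  · rw [hh]
    refine mul_eq_zero_of_right _ (Finset.sum_eq_zero fun j hj => tent_eq_zero ?_)
    rw [abs_div, abs_of_pos (hℓ0 j), le_div_iff₀ (hℓ0 j), one_mul]
    by_contra hlt
    have h1 : ℓ j ≤ ∑ j ∈ Finset.range K, ℓ j :=
      Finset.single_le_sum (f := ℓ) (fun j _ => (hℓ0 j).le) hj
    exact hu (abs_le.1 ((not_le.1 hlt).le.trans h1))
  · have h1 : ∀ j, 1 - ε ≤ tent (u / ℓ j) := by
      intro j
      refine le_trans ?_ (le_max_right _ _)
      have h2 : R / ε ≤ ℓ j := (le_max_right _ _).trans (hℓ j)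
      rw [div_le_iff₀ hε] at h2
      have h3 : |u / ℓ j| ≤ ε := by
        rw [abs_div, abs_of_pos (hℓ0 j), div_le_iff₀ (hℓ0 j)]
        linarith
      linarith
    rw [hh]
    rw [le_inv_mul_iff₀ hK0]
    calc (K : ℝ) * (1 - ε) = ∑ j ∈ Finset.range K, (1 - ε) := by
          rw [Finset.sum_const, Finset.card_range, nsmul_eq_mul]
      _ ≤ _ := Finset.sum_le_sum fun j _ => h1 j
  · set d : ℕ → ℝ → ℝ → ℝ := fun j x y => tent ((x + y) / ℓ j) - tent (x / ℓ j) with hd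
    -- In a product of increments the smaller scale is summed over `x`, giving the factor `6 ℓ`, and
    -- the larger scale is bounded pointwise.
    set B : ℕ → ℕ → ℝ → ℝ := fun j k y =>
      6 * ℓ (min j k) * (relSize (ℓ (min j k)) y * relSize (ℓ (max j k)) y) with hB
    have hdB : ∀ j k y, ∑ x ∈ F, d j x y * d k x y ≤ B j k y := by
      have hle : ∀ j k y, j ≤ k → ∑ x ∈ F, d j x y * d k x y
          ≤ 6 * ℓ j * (relSize (ℓ j) y * relSize (ℓ k) y) := by
        intro j k y _
        calc ∑ x ∈ F, d j x y * d k x y ≤ ∑ x ∈ F, |d j x y| * relSize (ℓ k) y := by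
              refine Finset.sum_le_sum fun x _ => (le_abs_self _).trans ?_
              rw [abs_mul]
              exact mul_le_mul_of_nonneg_left (abs_tent_shift_sub_le (hℓ0 k) x y) (abs_nonneg _)
          _ = (∑ x ∈ F, |d j x y|) * relSize (ℓ k) y := by rw [Finset.sum_mul]
          _ ≤ 6 * ℓ j * relSize (ℓ j) y * relSize (ℓ k) y :=
              mul_le_mul_of_nonneg_right (sum_abs_tent_shift_sub_le F (hℓ1 j) y)
                (relSize_nonneg (hℓ0 k).le y)
          _ = _ := by ring
      intro j k y
      rcases le_total j k with hjk | hjk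
      · simp only [hB, min_eq_left hjk, max_eq_right hjk]
        exact hle j k y hjk
      · simp only [hB, min_eq_right hjk, max_eq_left hjk]
        simp only [mul_comm (d j _ _)]
        exact hle k j y hjk
    have hiR : ∀ j k, Integrable (fun y => relSize (ℓ j) y * relSize (ℓ k) y) μ := fun j k =>
      integrable_of_mem_unitInterval ((measurable_relSize _).mul (measurable_relSize _))
        (fun y => mul_nonneg (relSize_nonneg (hℓ0 j).le y) (relSize_nonneg (hℓ0 k).le y))
        (fun y => mul_le_one₀ (relSize_le_one _ _) (relSize_nonneg (hℓ0 k).le y)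
          (relSize_le_one _ _))
    have hBint : ∀ j k, ∫ y, B j k y ∂μ ≤ if j = k then 6 * C else ε / 2 := by
      intro j k
      rw [hB, integral_const_mul]
      split_ifs with hjk
      · subst hjk
        rw [min_self, max_self]
        have h1 := hsq (ℓ j) (hℓ1 j)
        simp only [← sq]
        rw [mul_assoc]
        linarith
      · refine le_trans ?_ (hℓr (min j k) (max j k) (by omega)).2
        have := hℓ0 (min j k)
        gcongr
        · exact hiR _ _
        · exact integrable_of_mem_unitInterval (measurable_relSize _)
            (relSize_nonneg (hℓ0 _).le) (relSize_le_one _)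
        · intro y
          exact mul_le_of_le_one_left (relSize_nonneg (hℓ0 _).le y) (relSize_le_one _ _)
    have hdiff : ∀ x y : ℝ, (h (x + y) - h x) ^ 2
        = (K : ℝ)⁻¹ ^ 2 * ∑ j ∈ Finset.range K, ∑ k ∈ Finset.range K, d j x y * d k x y := by
      intro x y
      rw [← Finset.sum_mul_sum, hh, ← mul_sub, mul_pow, ← Finset.sum_sub_distrib, ← sq]
    have hint : ∀ x : ℤ, Integrable (fun y => (h (x + y) - h x) ^ 2) μ := fun x =>
      integrable_of_mem_unitInterval (((hhm.comp (measurable_const_add _)).sub_const _).pow_const 2)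
        (fun y => sq_nonneg _) fun y => by
          have h1 := hh0 (x + y)
          have h2 := hh1 (x + y)
          have h3 := hh0 x
          have h4 := hh1 x
          nlinarith
    rw [← integral_finsetSum _ fun x _ => hint x]
    have hpt : ∀ y, ∑ x ∈ F, (h (x + y) - h x) ^ 2
        ≤ (K : ℝ)⁻¹ ^ 2 * ∑ j ∈ Finset.range K, ∑ k ∈ Finset.range K, B j k y := by
      intro y
      simp only [hdiff]
      rw [← Finset.mul_sum, Finset.sum_comm]
      refine mul_le_mul_of_nonneg_left (Finset.sum_le_sum fun j _ => ?_) (by positivity)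
      rw [Finset.sum_comm]
      exact Finset.sum_le_sum fun k _ => hdB j k y
    have hiB : ∀ j k, Integrable (B j k) μ := fun j k => (hiR _ _).const_mul _
    refine (integral_mono (integrable_finsetSum _ fun x _ => hint x)
      ((integrable_finsetSum _ fun j _ => integrable_finsetSum _ fun k _ => hiB j k).const_mul _)
      hpt).trans ?_
    rw [integral_const_mul, integral_finsetSum _ fun j _ => integrable_finsetSum _ fun k _ =>
      hiB j k]
    have h7 : ∀ j ∈ Finset.range K, ∫ y, ∑ k ∈ Finset.range K, B j k y ∂μ ≤ 6 * C + K * (ε / 2) := by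
      intro j hj
      rw [integral_finsetSum _ fun k _ => hiB j k]
      refine (Finset.sum_le_sum fun k _ => hBint j k).trans ?_
      calc ∑ k ∈ Finset.range K, (if j = k then 6 * C else ε / 2)
          ≤ ∑ k ∈ Finset.range K, ((if j = k then 6 * C else 0) + ε / 2) := by
            refine Finset.sum_le_sum fun k _ => ?_
            split_ifs <;> linarith
        _ = 6 * C + K * (ε / 2) := by
            rw [Finset.sum_add_distrib, Finset.sum_ite_eq, if_pos hj]; simp
    calc (K : ℝ)⁻¹ ^ 2 * ∑ j ∈ Finset.range K, ∫ y, ∑ k ∈ Finset.range K, B j k y ∂μ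
        ≤ (K : ℝ)⁻¹ ^ 2 * ∑ j ∈ Finset.range K, (6 * C + K * (ε / 2)) := by
          gcongr with j hj; exact h7 j hj
      _ = 6 * C / K + ε / 2 := by
          rw [Finset.sum_const, Finset.card_range, nsmul_eq_mul]; field_simp
      _ ≤ ε := by
          rw [div_lt_iff₀ hε] at hK
          have : 6 * C / K ≤ ε / 2 := by
            rw [div_le_iff₀ hK0]; linarith
          linarith

end TestFunction

/-! ### Decomposing linear statistics. -/

namespace PointSet

open Filter Topology

theorem sum_inter_add_sum_inter_compl (h : ℝ → ℝ≥0∞) (S : PointSet) (B : Set ℝ) :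
    (S.inter B).sum h + (S.inter Bᶜ).sum h = S.sum h := by
  simp only [sum, inter]
  rw [tsum_subtype (S.points ∩ B) h, tsum_subtype (S.points ∩ Bᶜ) h, tsum_subtype S.points h,
    ← ENNReal.tsum_add]
  refine tsum_congr fun z => ?_
  by_cases h1 : z ∈ S.points <;> by_cases h2 : z ∈ B <;> simp [Set.indicator, h1, h2]

theorem sum_delete_add (h : ℝ → ℝ≥0∞) {S : PointSet} {z : ℝ} (hz : z ∈ S.points) :
    (S.delete z).sum h + h z = S.sum h := by
  rw [← sum_inter_add_sum_inter_compl h S {z}, add_comm]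
  have h1 : S.inter {z} = ⟨{z}⟩ := by
    ext a
    simp only [inter, Set.mem_inter_iff, Set.mem_singleton_iff, and_iff_right_iff_imp]
    rintro rfl
    exact hz
  have h2 : S.delete z = S.inter {z}ᶜ := rfl
  rw [h1, h2]
  congr 1
  simp only [sum]
  exact (tsum_singleton z h).symm

theorem sum_inter_eq_finsetSum (h : ℝ → ℝ≥0∞) {S : PointSet} {B : Set ℝ}
    (hfin : (S.points ∩ B).Finite) : (S.inter B).sum h = ∑ z ∈ hfin.toFinset, h z := by
  simp only [sum, inter]
  rw [← Finset.tsum_subtype hfin.toFinset h]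
  exact (tsum_congr_set_coe h (by simp)).symm

end PointSet

/-! ### Singularity and rigidity from deterministic statistics. -/

section Statistics

open Filter Topology

theorem pointsOf_sum {z : ℤ → ℝ} (hz : Function.Injective z) (h : ℝ → ℝ≥0∞) :
    (pointsOf Set.univ z).sum h = ∑' x, h (z x) := by
  simp only [PointSet.sum, pointsOf]
  rw [tsum_image h hz.injOn]
  exact tsum_univ fun x => h (z x)

/-- If linear statistics with test functions tending to one are asymptotically deterministic
then the process is deletion singular. -/
theorem deletionSingular_of_tendsto {Ω : Type*} [MeasurableSpace Ω] {P : Measure Ω}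
    {X : Ω → PointSet} (hX : Measurable X)
    (hXdel : ∀ Z, Measurable Z → Measurable fun ω => (X ω).delete (Z ω))
    {h : ℕ → ℝ → ℝ≥0∞} {m : ℕ → ℝ} (hm : ∀ n, Measurable (h n))
    (hlim : ∀ z, Tendsto (fun n => (h n z).toReal) atTop (𝓝 1))
    (hfin : ∀ᵐ ω ∂P, ∀ n, (X ω).sum (h n) ≠ ∞)
    (hconv : ∀ᵐ ω ∂P, Tendsto (fun n => ((X ω).sum (h n)).toReal - m n) atTop (𝓝 0)) :
    DeletionSingular P X := by
  intro Z hZ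
  have hA : MeasurableSet
      {S : PointSet | Tendsto (fun n => (S.sum (h n)).toReal - m n) atTop (𝓝 0)} :=
    measurableSet_tendsto _ fun n => (PointSet.measurable_sum (hm n)).ennreal_toReal.sub_const _
  refine ⟨_, hA, ?_, ?_⟩
  · rw [Measure.map_apply (hXdel Z hZ.1) hA, measure_eq_zero_iff_ae_notMem]
    filter_upwards [hfin, hconv, hZ.2] with ω h1 h2 h3 h4
    have h5 : ∀ n, ((X ω).sum (h n)).toReal - m n
        - ((((X ω).delete (Z ω)).sum (h n)).toReal - m n) = (h n (Z ω)).toReal := by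
      intro n
      have h6 := PointSet.sum_delete_add (h n) h3
      have h7 := h1 n
      rw [← h6, ENNReal.add_ne_top] at h7
      rw [← h6, ENNReal.toReal_add h7.1 h7.2]
      ring
    have h8 := h2.sub (show Tendsto (fun n =>
      (((X ω).delete (Z ω)).sum (h n)).toReal - m n) atTop (𝓝 0) from h4)
    simp only [h5, sub_zero] at h8
    exact zero_ne_one (tendsto_nhds_unique h8 (hlim _))
  · rw [Measure.map_apply hX hA.compl, measure_eq_zero_iff_ae_notMem]
    filter_upwards [hconv] with ω h1 h2
    exact h2 h1

theorem rigid_of_tendsto {Ω : Type*} [MeasurableSpace Ω] {P : Measure Ω}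
    {X : Ω → PointSet} (hloc : ∀ n : ℕ, ∀ᵐ ω ∂P, ((X ω).points ∩ Set.Icc (-n : ℝ) n).Finite)
    {h : ℕ → ℝ → ℝ≥0∞} {m : ℕ → ℝ} (hm : ∀ n, Measurable (h n))
    (hlim : ∀ z, Tendsto (fun n => (h n z).toReal) atTop (𝓝 1))
    (hfin : ∀ᵐ ω ∂P, ∀ n, (X ω).sum (h n) ≠ ∞)
    (hconv : ∀ᵐ ω ∂P, Tendsto (fun n => ((X ω).sum (h n)).toReal - m n) atTop (𝓝 0)) :
    Rigid P X := by
  intro c r hr B hB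
  -- `limsup` and floor give a measurable function defined on every configuration; almost surely the
  -- limit exists and is the natural number sought.
  refine ⟨fun S => ⌊limsup (fun n => m n - (S.sum (h n)).toReal) atTop⌋₊,
    (Measurable.limsup fun n =>
      (PointSet.measurable_sum (hm n)).ennreal_toReal.const_sub _).nat_floor, ?_⟩
  filter_upwards [ae_all_iff.2 hloc, hfin, hconv] with ω h1 h2 h3
  have hBfin : ((X ω).points ∩ B).Finite := by
    obtain ⟨k, hk⟩ := exists_nat_ge (|c| + r)
    refine (h1 k).subset (Set.inter_subset_inter_right _ ?_)
    have hBc : B ⊆ Metric.closedBall c r := by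
      rcases hB with rfl | rfl
      · exact Metric.ball_subset_closedBall
      · exact subset_rfl
    refine hBc.trans fun z hz => ?_
    rw [Metric.mem_closedBall, Real.dist_eq] at hz
    refine abs_le.1 ?_
    have := abs_sub_abs_le_abs_sub z c
    linarith
  set T := hBfin.toFinset with hT
  have h4 : Tendsto (fun n => ∑ z ∈ T, (h n z).toReal) atTop (𝓝 (T.card : ℝ)) := by
    have := tendsto_finsetSum T fun z _ => hlim z
    simpa using this
  have h5 : ∀ n, ((X ω).sum (h n)).toReal
      = ∑ z ∈ T, (h n z).toReal + (((X ω).inter Bᶜ).sum (h n)).toReal := by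
    intro n
    have h6 := PointSet.sum_inter_add_sum_inter_compl (h n) (X ω) B
    have h7 := h2 n
    rw [← h6] at h7 ⊢
    rw [ENNReal.add_ne_top] at h7
    rw [ENNReal.toReal_add h7.1 h7.2]
    rw [PointSet.sum_inter_eq_finsetSum (h n) hBfin] at h7 ⊢
    rw [ENNReal.toReal_sum fun z hz => (ENNReal.sum_ne_top.1 h7.1 z hz)]
  have h6 : Tendsto (fun n => m n - (((X ω).inter Bᶜ).sum (h n)).toReal) atTop
      (𝓝 (T.card : ℝ)) := by
    have h7 := h4.sub h3
    rw [sub_zero] at h7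
    refine h7.congr fun n => ?_
    rw [h5 n]; ring
  rw [h6.limsup_eq, Nat.floor_natCast, PointSet.count, hBfin.encard_eq_coe_toFinset_card]

end Statistics

/-! ### Variance of linear statistics of the perturbed lattice. -/

section Fluctuations

open Filter Topology

variable {Ω : Type*} {Y : ℤ → Ω → ℝ} [MeasurableSpace Ω] {P : Measure Ω} {μ : Measure ℝ}

/-- Borel–Cantelli: the expected count in the interval is finite. -/
theorem ae_finite_perturbed_mem_Icc [IsProbabilityMeasure μ] (hYmeas : ∀ x, Measurable (Y x))
    (hYlaw : ∀ x, P.map (Y x) = μ) {a b : ℝ} (hab : a ≤ b) :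
    ∀ᵐ ω ∂P, {x : ℤ | (x : ℝ) + Y x ω ∈ Set.Icc a b}.Finite := by
  have h := ae_finite_setOfPred_mem (μ := P)
    (s := fun x : ℤ => {ω | (x : ℝ) + Y x ω ∈ Set.Icc a b}) ?_
  · exact h
  · refine ne_top_of_le_ne_top ENNReal.ofReal_ne_top
      (le_trans (le_of_eq (tsum_congr fun x => ?_)) (tsum_shiftLaw_Icc_le (μ := μ) hab))
    rw [shiftLaw, ← hYlaw x, Measure.map_map (by fun_prop) (hYmeas x),
      Measure.map_apply (by fun_prop (disch := exact hYmeas x)) measurableSet_Icc]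
    rfl

variable [IsProbabilityMeasure P]

/-- Variances add by independence, and each is at most the second moment about any constant, here
the value `h x` at the unperturbed site. -/
theorem integral_sq_sum_sub_le_energy (hYmeas : ∀ x, Measurable (Y x))
    (hYlaw : ∀ x, P.map (Y x) = μ) (hYindep : iIndepFun Y P) {h : ℝ → ℝ} (hm : Measurable h)
    (h0 : ∀ u, 0 ≤ h u) (h1 : ∀ u, h u ≤ 1) (F : Finset ℤ) :
    ∫ ω, (∑ x ∈ F, h (x + Y x ω) - ∑ x ∈ F, ∫ y, h (x + y) ∂μ) ^ 2 ∂P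
      ≤ ∑ x ∈ F, ∫ y, (h (x + y) - h x) ^ 2 ∂μ := by
  have hXm : ∀ x : ℤ, Measurable fun ω => h (x + Y x ω) := fun x =>
    hm.comp ((hYmeas x).const_add _)
  have hL2 : ∀ x : ℤ, MemLp (fun ω => h (x + Y x ω)) 2 P := fun x =>
    MemLp.of_bound (hXm x).aestronglyMeasurable 1 (Eventually.of_forall fun ω => by
      rw [Real.norm_of_nonneg (h0 _)]; exact h1 _)
  have hmean : ∀ x : ℤ, ∫ y, h (x + y) ∂μ = ∫ ω, h (x + Y x ω) ∂P := by
    intro x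
    rw [← hYlaw x]
    exact integral_map (hYmeas x).aemeasurable
      (hm.comp (measurable_const_add _)).aestronglyMeasurable
  have hind : iIndepFun (fun (x : ℤ) ω => h (x + Y x ω)) P :=
    hYindep.comp (fun x y => h (x + y)) fun x => hm.comp (measurable_const_add _)
  have hvar := IndepFun.variance_sum (s := F) (fun x _ => hL2 x)
    fun x _ y _ hxy => hind.indepFun hxy
  have h2 : ∫ ω, (∑ x ∈ F, h (x + Y x ω) - ∑ x ∈ F, ∫ y, h (x + y) ∂μ) ^ 2 ∂P
      = variance (∑ x ∈ F, fun ω => h (x + Y x ω)) P := by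
    rw [variance_eq_integral (Finset.aemeasurable_sum _ fun x _ => (hXm x).aemeasurable)]
    simp only [Finset.sum_apply]
    rw [integral_finsetSum _ fun x _ => (hL2 x).integrable one_le_two]
    simp only [hmean]
  rw [h2, hvar]
  refine Finset.sum_le_sum fun x _ => ?_
  rw [← variance_sub_const (hXm x).aestronglyMeasurable (h x)]
  refine (variance_le_expectation_sq ((hXm x).sub_const _).aestronglyMeasurable).trans_eq ?_
  rw [← hYlaw x]
  exact (integral_map (hYmeas x).aemeasurable
    (((hm.comp (measurable_const_add _)).sub_const _).pow_const 2).aestronglyMeasurable).symm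

/-- Fatou's lemma along finite index sets. Almost surely the random sum has finitely many nonzero
terms, and the means are summable, being dominated by the expected count in the support of `h`. -/
theorem lintegral_sq_tsum_sub_le_energy [IsProbabilityMeasure μ] (hYmeas : ∀ x, Measurable (Y x))
    (hYlaw : ∀ x, P.map (Y x) = μ) (hYindep : iIndepFun Y P) {h : ℝ → ℝ} (hm : Measurable h)
    (h0 : ∀ u, 0 ≤ h u) (h1 : ∀ u, h u ≤ 1) {L : ℝ} (hL : 0 ≤ L)
    (hsupp : ∀ u, u ∉ Set.Icc (-L) L → h u = 0) {ε : ℝ}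
    (hε : ∀ F : Finset ℤ, ∑ x ∈ F, ∫ y, (h (x + y) - h x) ^ 2 ∂μ ≤ ε) :
    ∫⁻ ω, ENNReal.ofReal ((∑' x : ℤ, h (x + Y x ω) - ∑' x : ℤ, ∫ y, h (x + y) ∂μ) ^ 2) ∂P
      ≤ ENNReal.ofReal ε := by
  have hXm : ∀ x : ℤ, Measurable fun ω => h (x + Y x ω) := fun x =>
    hm.comp ((hYmeas x).const_add _)
  have hmean : Summable fun x : ℤ => ∫ y, h (x + y) ∂μ := by
    have hsum : Summable fun x : ℤ => (shiftLaw μ x).real (Set.Icc (-L) L) :=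
      ENNReal.summable_toReal (ne_top_of_le_ne_top ENNReal.ofReal_ne_top
        (tsum_shiftLaw_Icc_le (μ := μ) (by linarith : -L ≤ L)))
    refine Summable.of_nonneg_of_le (fun x => integral_nonneg fun y => h0 _) (fun x => ?_) hsum
    rw [← integral_indicator_one measurableSet_Icc, shiftLaw, integral_map (by fun_prop)
      ((measurable_one.indicator measurableSet_Icc).aestronglyMeasurable)]
    refine integral_mono
      (integrable_of_mem_unitInterval (hm.comp (measurable_const_add _)) (fun y => h0 _)
        fun y => h1 _)
      (integrable_of_mem_unitInterval
        ((measurable_one.indicator measurableSet_Icc).comp (measurable_const_add _))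
        (fun y => Set.indicator_nonneg (fun _ _ => zero_le_one) _)
        fun y => Set.indicator_le_self' (fun _ _ => zero_le_one) _) fun y => ?_
    by_cases hy : (x : ℝ) + y ∈ Set.Icc (-L) L
    · simp only [Set.indicator_of_mem hy]; exact h1 _
    · simp only [Set.indicator_of_notMem hy]; exact (hsupp _ hy).le
  set f : Finset ℤ → Ω → ℝ≥0∞ := fun F ω =>
    ENNReal.ofReal ((∑ x ∈ F, h (x + Y x ω) - ∑ x ∈ F, ∫ y, h (x + y) ∂μ) ^ 2) with hf
  have hfm : ∀ F, Measurable (f F) := fun F =>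
    (((Finset.measurable_sum F fun x _ => hXm x).sub_const _).pow_const 2).ennreal_ofReal
  have hflim : ∀ᵐ ω ∂P, Tendsto (fun F => f F ω) atTop (𝓝
      (ENNReal.ofReal ((∑' x : ℤ, h (x + Y x ω) - ∑' x : ℤ, ∫ y, h (x + y) ∂μ) ^ 2))) := by
    filter_upwards [ae_finite_perturbed_mem_Icc hYmeas hYlaw (by linarith : -L ≤ L)] with ω hω
    have hs : Summable fun x : ℤ => h (x + Y x ω) :=
      summable_of_hasFiniteSupport (hω.subset fun x hx => by
        by_contra hx'
        exact hx (hsupp _ hx'))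
    have h2 : Tendsto (fun F : Finset ℤ => ∑ x ∈ F, h (x + Y x ω)) atTop
        (𝓝 (∑' x : ℤ, h (x + Y x ω))) := hs.hasSum
    have h3 : Tendsto (fun F : Finset ℤ => ∑ x ∈ F, ∫ y, h (x + y) ∂μ) atTop
        (𝓝 (∑' x : ℤ, ∫ y, h (x + y) ∂μ)) := hmean.hasSum
    exact ENNReal.tendsto_ofReal ((h2.sub h3).pow 2)
  have hfle : ∀ F, ∫⁻ ω, f F ω ∂P ≤ ENNReal.ofReal ε := by
    intro F
    have hint : Integrable (fun ω =>
        (∑ x ∈ F, h (x + Y x ω) - ∑ x ∈ F, ∫ y, h (x + y) ∂μ) ^ 2) P := by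
      have h2 : ∀ x : ℤ, MemLp (fun ω => h (x + Y x ω)) 2 P := fun x =>
        MemLp.of_bound (hXm x).aestronglyMeasurable 1 (Eventually.of_forall fun ω => by
          rw [Real.norm_of_nonneg (h0 _)]; exact h1 _)
      have h3 : MemLp (fun ω => ∑ x ∈ F, h (x + Y x ω)) 2 P :=
        memLp_finsetSum F fun x _ => h2 x
      exact (h3.sub (memLp_const (∑ x ∈ F, ∫ y, h (x + y) ∂μ))).integrable_sq
    rw [← ofReal_integral_eq_lintegral_ofReal hint (Eventually.of_forall fun ω => sq_nonneg _)]
    exact ENNReal.ofReal_le_ofReal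
      ((integral_sq_sum_sub_le_energy hYmeas hYlaw hYindep hm h0 h1 F).trans (hε F))
  calc _ = ∫⁻ ω, liminf (fun F => f F ω) atTop ∂P :=
        lintegral_congr_ae (hflim.mono fun ω hω => hω.liminf_eq.symm)
    _ ≤ liminf (fun F => ∫⁻ ω, f F ω ∂P) atTop := lintegral_liminf_le hfm
    _ ≤ ENNReal.ofReal ε := by
        exact liminf_le_of_frequently_le' (Frequently.of_forall hfle)

/-- When the truncated second moments of the displacement grow at most linearly, there are linear
statistics with test functions tending to one that are asymptotically deterministic. -/
theorem exists_deterministic_statistics [IsProbabilityMeasure μ] (hYmeas : ∀ x, Measurable (Y x))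
    (hYlaw : ∀ x, P.map (Y x) = μ) (hYindep : iIndepFun Y P) (hμ0 : ∀ a, μ {a} = 0) {C : ℝ}
    (hC : 0 < C) (hsq : ∀ L : ℝ, 1 ≤ L → L * ∫ y, relSize L y ^ 2 ∂μ ≤ C) :
    ∃ (h : ℕ → ℝ → ℝ≥0∞) (m : ℕ → ℝ), (∀ n, Measurable (h n)) ∧
      (∀ z, Tendsto (fun n => (h n z).toReal) atTop (𝓝 1)) ∧
      (∀ᵐ ω ∂P, ∀ n, (perturbedLattice Y ω).sum (h n) ≠ ∞) ∧
      ∀ᵐ ω ∂P, Tendsto (fun n => ((perturbedLattice Y ω).sum (h n)).toReal - m n) atTop (𝓝 0) := by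
  -- Any summable sequence would serve: the squared fluctuations then have a finite expected sum, so
  -- they tend to `0` almost surely.
  have hε : ∀ n : ℕ, (0 : ℝ) < (1 / 2) ^ n := fun n => by positivity
  choose k hkm hk0 hk1 hksupp hkR hkE using fun n : ℕ => exists_bump_energy_le hC hsq (hε n) n
  choose L hL hkL using hksupp
  have hsum : ∀ᵐ ω ∂P, ∀ n, (perturbedLattice Y ω).sum (fun z => ENNReal.ofReal (k n z))
      = ENNReal.ofReal (∑' x : ℤ, k n (x + Y x ω)) := by
    filter_upwards [ae_injective_perturbed hμ0 hYmeas hYlaw hYindep, ae_all_iff.2 fun n =>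
      ae_finite_perturbed_mem_Icc (P := P) hYmeas hYlaw (by linarith [hL n] : -L n ≤ L n)]
      with ω h1 h2 n
    rw [perturbedLattice_eq_pointsOf, pointsOf_sum h1, ENNReal.ofReal_tsum_of_nonneg
      (fun _ => hk0 n _)]
    exact summable_of_hasFiniteSupport ((h2 n).subset fun x hx => by
      by_contra hx'
      exact hx (hkL n _ hx'))
  refine ⟨fun n z => ENNReal.ofReal (k n z), fun n => ∑' x : ℤ, ∫ y, k n (x + y) ∂μ,
    fun n => (hkm n).ennreal_ofReal, fun z => ?_, ?_, ?_⟩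
  · simp only [ENNReal.toReal_ofReal (hk0 _ _)]
    have h1 : Tendsto (fun n : ℕ => 1 - (1 / 2 : ℝ) ^ n) atTop (𝓝 1) := by
      simpa using (tendsto_pow_atTop_nhds_zero_of_lt_one (r := (1 / 2 : ℝ)) (by norm_num)
        (by norm_num)).const_sub 1
    refine tendsto_of_tendsto_of_tendsto_of_le_of_le' h1 tendsto_const_nhds ?_
      (Eventually.of_forall fun n => hk1 n z)
    obtain ⟨N, hN⟩ := exists_nat_ge |z|
    filter_upwards [eventually_ge_atTop N] with n hn
    exact hkR n z (hN.trans (by exact_mod_cast hn))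
  · filter_upwards [hsum] with ω hω n
    rw [hω n]
    exact ENNReal.ofReal_ne_top
  · set D : ℕ → Ω → ℝ := fun n ω => ∑' x : ℤ, k n (x + Y x ω) - ∑' x : ℤ, ∫ y, k n (x + y) ∂μ
      with hD
    have hDm : ∀ n, AEMeasurable (fun ω => ENNReal.ofReal (D n ω ^ 2)) P := by
      intro n
      have h1 : Measurable fun ω => ((perturbedLattice Y ω).sum
          (fun z => ENNReal.ofReal (k n z))).toReal :=
        ((PointSet.measurable_sum (hkm n).ennreal_ofReal).comp
          (measurable_perturbedLattice hYmeas)).ennreal_toReal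
      refine ⟨_, ((h1.sub_const (∑' x : ℤ, ∫ y, k n (x + y) ∂μ)).pow_const 2).ennreal_ofReal, ?_⟩
      filter_upwards [hsum] with ω hω
      rw [hω n, ENNReal.toReal_ofReal (tsum_nonneg fun x => hk0 n _)]
    have h1 : ∫⁻ ω, ∑' n, ENNReal.ofReal (D n ω ^ 2) ∂P ≠ ∞ := by
      rw [lintegral_tsum hDm]
      refine ne_top_of_le_ne_top ?_ (ENNReal.tsum_le_tsum fun n =>
        lintegral_sq_tsum_sub_le_energy hYmeas hYlaw hYindep (hkm n) (hk0 n) (hk1 n) (hL n)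
          (hkL n) (hkE n))
      rw [← ENNReal.ofReal_tsum_of_nonneg (fun n => (hε n).le) summable_geometric_two]
      exact ENNReal.ofReal_ne_top
    filter_upwards [hsum, ae_lt_top' (AEMeasurable.tsum hDm) h1] with ω hω h2
    have h3 := ENNReal.tendsto_atTop_zero_of_tsum_ne_top h2.ne
    have h4 : Tendsto (fun n => D n ω ^ 2) atTop (𝓝 0) := by
      have h5 := (ENNReal.tendsto_toReal ENNReal.zero_ne_top).comp h3
      refine h5.congr fun n => ?_
      exact ENNReal.toReal_ofReal (sq_nonneg _)
    have h6 : Tendsto (fun n => D n ω) atTop (𝓝 0) := by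
      rw [tendsto_zero_iff_abs_tendsto_zero]
      have h7 := h4.sqrt
      simp only [Real.sqrt_sq_eq_abs, Real.sqrt_zero] at h7
      exact h7
    refine h6.congr fun n => ?_
    rw [hω n, ENNReal.toReal_ofReal (tsum_nonneg fun x => hk0 n _)]

/-- A symmetric stable law of index at least one gives a deletion singular, rigid perturbed
lattice. -/
theorem rigidity_of_stable [IsProbabilityMeasure μ] {α : ℝ} (hμ : IsSymmetricStable α μ)
    (hYmeas : ∀ x, Measurable (Y x)) (hYlaw : ∀ x, P.map (Y x) = μ) (hYindep : iIndepFun Y P)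
    (hα : 1 ≤ α) :
    DeletionSingular P (perturbedLattice Y) ∧ Rigid P (perturbedLattice Y) := by
  obtain ⟨hα0, -, c, hc, hchar⟩ := hμ
  obtain ⟨C, hC, htail⟩ := exists_stable_tail_le hc hα hchar
  obtain ⟨h, m, hm, hlim, hfin, hconv⟩ := exists_deterministic_statistics hYmeas hYlaw hYindep
    (stable_singleton_eq_zero hc hα0 hchar) (mul_pos two_pos hC)
    fun L hL => mul_integral_relSize_sq_le hC htail (zero_lt_one.trans_le hL)
  refine ⟨deletionSingular_of_tendsto (measurable_perturbedLattice hYmeas)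
    (fun Z hZ => measurable_perturbedLattice_delete hYmeas hZ) hm hlim hfin hconv,
    rigid_of_tendsto (fun n => ?_) hm hlim hfin hconv⟩
  filter_upwards [ae_finite_perturbed_mem_Icc (P := P) hYmeas hYlaw
    (by linarith [n.cast_nonneg (α := ℝ)] : -(n : ℝ) ≤ n)] with ω hω
  refine (hω.image fun x : ℤ => (x : ℝ) + Y x ω).subset ?_
  rintro z ⟨⟨x, rfl⟩, hz⟩
  exact ⟨x, hz, rfl⟩

end Fluctuations

theorem theorem1p3 {Ω : Type*} [MeasurableSpace Ω] (P : Measure Ω) [IsProbabilityMeasure P]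
    (α : ℝ) (μ : Measure ℝ) [IsProbabilityMeasure μ] (hμ : IsSymmetricStable α μ)
    (Y : ℤ → Ω → ℝ) (hYmeas : ∀ x, Measurable (Y x)) (hYlaw : ∀ x, P.map (Y x) = μ)
    (hYindep : iIndepFun Y P) :
    (α < 1 →
      DeletionTolerant P (perturbedLattice Y) ∧
      InsertionTolerant P (perturbedLattice Y) ∧
      P.map (perturbedLattice Y) ≪ P.map (perturbedLatticeOff {0} Y) ∧
      P.map (perturbedLatticeOff {0} Y) ≪ P.map (perturbedLattice Y)) ∧
    (1 ≤ α →
      DeletionSingular P (perturbedLattice Y) ∧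
      Rigid P (perturbedLattice Y)) :=
  ⟨fun hα => tolerance_of_stable hμ hYmeas hYlaw hYindep hα,
    fun hα => rigidity_of_stable hμ hYmeas hYlaw hYindep hα⟩
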